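/- **Setting.** Fix $\theta\in(0,1)$ and edge probabilities $q=q(n)\in[0,1]$ with $q=\Theta(n^{-2(1-\theta)})$. Let $G\sim\mathrm{ER}(n,q)$ be the random graph on $\{0,\dots,n-1\}$ in which each pair of vertices is an edge independently with probability $q$; let $E$ be its edge set and $\bar k=q\binom n2$ the expected number of edges. An edge-detecting test on a vertex set $S$ is negative if no edge of $G$ is contained in $S$, and positive otherwise. Fix any constants $C_1>27$, $C_2=C_1^2$, $C'>3$. Non-integer quantities below are rounded up. $\log$ is the natural logarithm. **Testing.** Put $L=\lceil\log_2 n\rceil$ (so $n$ is padded to $2^L$ by isolated dummy vertices) and $\ell_{\min}=\lceil\log_2\sqrt{\bar k}\rceil$. At each level $\ell\in\{\ell_{\min},\dots,L\}$ the $2^L$ vertices are split into $2^\ell$ blocks of $2^{L-\ell}$ consecutive vertices. At each level $\ell<L$ there are $C_2\sqrt{\bar k}$ iterations; at level $L$ there are $C'\log n$ rounds of $C_2\sqrt{\bar k}$ iterations each. Each iteration consists of $C_1\sqrt{\bar k}$ tests, and each block is assigned to one of them uniformly at random, all assignments being independent of each other and of $G$. A test is applied to the union of the blocks assigned to it. **Decoding.**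 Let $\mathcal{PD}^{(\ell_{\min})}$ be the set of all unordered pairs of distinct blocks at level $\ell_{\min}$. For $\ell=\ell_{\min},\dots,L-1$, let $\mathcal{PD}^{(\ell+1)}$ be the set of all pairs of distinct blocks among the four children of $A,B$, over all pairs $\{A,B\}\in\mathcal{PD}^{(\ell)}$ that are not both contained in a negative test of level $\ell$. The estimate $\widehat E$ is the set of pairs in $\mathcal{PD}^{(L)}$ that are not both contained in a negative test of level $L$. **Theorem.** The number of tests is $O(\bar k\log n)$, and $\mathbb P[\widehat E\ne E]\to0$ as $n\to\infty$. On a unit-cost random access machine (reading an entry of the test assignment, retrieving a test outcome, an arithmetic operation, a comparison, and a memory access each take one step), $\widehat E$ is always correctly computed by the decoder that scans all iterations of level $\ell$ for each pair in $\mathcal{PD}^{(\ell)}$, and also by the decoder that, for each such pair, looks only at the list of tests containing both blocks, these lists being prepared in advance by a pre-processing that sees no test outcomes and always takes $O(n^2\sqrt{\bar k}\log n)$ steps. With probability $1-o(1)$ the running times satisfy: (a) if $\theta>1/2$: decoding takes $O(\bar k^{1.5}\log n)$ steps, and with the pre-processing $O(\bar k\log^2 n)$ steps; (b) if $\theta\le1/2$: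 decoding takes $O(\bar k^{1.5}\log^2\bar k\,\log n)$ steps, and with the pre-processing $O(\bar k\log^2\bar k\,\log^2 n)$ steps. -/

import Mathlib

open Filter Topology MeasureTheory ProbabilityTheory

namespace GraphSplitting

/-! ### The test design -/

/-- The integer parameters of a test design.  The binary tree of blocks has levels
`lmin, …, depth`; level `ℓ` has `2 ^ ℓ` blocks.  One iteration at a level consists of `width`
tests.  Every level below the last one has `reps` iterations, the last level has
`finalRounds` rounds of `reps` iterations each. -/
structure Design where
  lmin : ℕ
  depth : ℕ
  width : ℕ
  reps : ℕ
  finalRounds : ℕ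

/-- The design for `n` vertices, expected number of edges `k`, and constants `C₁, C₂, Cfin`.
The depth is `⌈log₂ n⌉`, so that `n` is padded to the next power of two by isolated dummy
vertices; non-integer quantities are rounded up. -/
noncomputable def design (n : ℕ) (k C₁ C₂ Cfin : ℝ) : Design where
  lmin := ⌈Real.logb 2 (Real.sqrt k)⌉₊
  depth := Nat.clog 2 n
  width := ⌈C₁ * Real.sqrt k⌉₊
  reps := ⌈C₂ * Real.sqrt k⌉₊
  finalRounds := ⌈Cfin * Real.log n⌉₊

/-- Number of iterations at level `ℓ`. -/
def Design.iters (D : Design) (ℓ : ℕ) : ℕ :=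
  if ℓ < D.depth then D.reps else D.finalRounds * D.reps

/-- Total number of tests, over all levels. -/
def Design.numTests (D : Design) : ℕ :=
  ∑ ℓ ∈ Finset.Icc D.lmin D.depth, D.iters ℓ * D.width

/-- A realisation of the random test assignment: at every level and in every iteration, each
block is put into one of the `width` tests. -/
def Placement (D : Design) : Type :=
  (ℓ : Finset.Icc D.lmin D.depth) → Fin (D.iters ℓ) → Fin (2 ^ (ℓ : ℕ)) → Fin D.width

instance (D : Design) : MeasurableSpace (Placement D) := ⊤

/-- The test that contains block `j` in iteration `r` of level `ℓ`
(the value `0` outside the range of the indices is never used). -/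
def slot {D : Design} (h : Placement D) (ℓ r j : ℕ) : ℕ :=
  if hℓ : ℓ ∈ Finset.Icc D.lmin D.depth then
    if hr : r < D.iters ℓ then
      if hj : j < 2 ^ ℓ then (h ⟨ℓ, hℓ⟩ ⟨r, hr⟩ ⟨j, hj⟩ : ℕ) else 0
    else 0
  else 0

/-- The set of vertices in test `t` of iteration `r` of level `ℓ`.  The block of the vertex `v` at
level `ℓ` consists of `2 ^ (depth - ℓ)` consecutive vertices. -/
def pool {D : Design} (h : Placement D) (n ℓ r t : ℕ) : Finset (Fin n) :=
  Finset.univ.filter fun v => slot h ℓ r ((v : ℕ) / 2 ^ (D.depth - ℓ)) = t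

open Classical in
/-- The answer to the edge-detecting query on `S`: is some edge of `G` contained in `S`? -/
noncomputable def query {n : ℕ} (G : SimpleGraph (Fin n)) (S : Finset (Fin n)) : Bool :=
  decide (∃ u ∈ S, ∃ v ∈ S, G.Adj u v)

/-- All test outcomes; `outcomes G h ℓ r t` is the outcome of test `t` of iteration `r` of
level `ℓ`. -/
noncomputable def outcomes {n : ℕ} {D : Design} (G : SimpleGraph (Fin n)) (h : Placement D) :
    ℕ → ℕ → ℕ → Bool :=
  fun ℓ r t => query G (pool h n ℓ r t)

/-! ### The decoder, as a map from test outcomes to edge sets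

A pair of blocks is represented by the pair of its indices, the smaller one first. -/

/-- Some negative test of level `ℓ` contains both blocks of the pair `p`. -/
abbrev Excluded {D : Design} (h : Placement D) (Y : ℕ → ℕ → ℕ → Bool) (ℓ : ℕ) (p : ℕ × ℕ) :
    Prop :=
  ∃ r ∈ Finset.range (D.iters ℓ),
    slot h ℓ r p.1 = slot h ℓ r p.2 ∧ Y ℓ r (slot h ℓ r p.1) = false

/-- The six child pairs of a pair of blocks; block `i` splits into `2 * i` and `2 * i + 1`. -/
def childPairs (p : ℕ × ℕ) : Finset (ℕ × ℕ) :=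
  {(2 * p.1, 2 * p.2), (2 * p.1, 2 * p.2 + 1), (2 * p.1 + 1, 2 * p.2),
    (2 * p.1 + 1, 2 * p.2 + 1), (2 * p.1, 2 * p.1 + 1), (2 * p.2, 2 * p.2 + 1)}

/-- The possibly defective pairs at level `lmin + s`. -/
def possiblyDefective {D : Design} (h : Placement D) (Y : ℕ → ℕ → ℕ → Bool) :
    ℕ → Finset (ℕ × ℕ)
  | 0 => (Finset.range (2 ^ D.lmin) ×ˢ Finset.range (2 ^ D.lmin)).filter fun p => p.1 < p.2
  | s + 1 =>
      ((possiblyDefective h Y s).filter fun p => ¬ Excluded h Y (D.lmin + s) p).biUnion childPairs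

/-- The estimated edge set: the possibly defective pairs of the last level that are in no
negative test of that level. -/
def estimate {D : Design} (h : Placement D) (Y : ℕ → ℕ → ℕ → Bool) : Finset (ℕ × ℕ) :=
  (possiblyDefective h Y (D.depth - D.lmin)).filter fun p => ¬ Excluded h Y D.depth p

open Classical in
/-- The edge set of `G`, as a set of pairs with the smaller vertex first. -/
noncomputable def edgePairs {n : ℕ} (G : SimpleGraph (Fin n)) : Finset (ℕ × ℕ) :=
  (Finset.univ.filter fun p : Fin n × Fin n => p.1 < p.2 ∧ G.Adj p.1 p.2).image
    fun p => ((p.1 : ℕ), (p.2 : ℕ))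

/-! ### The unit-cost random access machine

A computation maps the working memory to a result, a new memory, and a number of steps.  All
programs below are built from the instructions that follow; each of them takes one step (a
branching on a bit belongs to the instruction that produced the bit), sequencing is free, and
loops pay for their control.  All the integers that the programs handle are array indices. -/

/-- Working memory: an array of flags and an array of linked lists of test indices
`(iteration, test)`, both indexed by a level and a pair of blocks. -/
structure Memory where
  mark : ℕ → ℕ → ℕ → Bool
  ind : ℕ → ℕ → ℕ → List (ℕ × ℕ)

/-- The initial memory. -/
def Memory.init : Memory where
  mark := fun _ _ _ => false
  ind := fun _ _ _ => []

/-- Computations on the machine. -/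
def RAM (α : Type) : Type := Memory → α × Memory × ℕ

instance : Monad RAM where
  pure a := fun s => (a, s, 0)
  bind x f := fun s =>
    ((f (x s).1 (x s).2.1).1, (f (x s).1 (x s).2.1).2.1,
      (x s).2.2 + (f (x s).1 (x s).2.1).2.2)

namespace RAM

variable {α β : Type}

/-- The result of a computation. -/
def result (x : RAM α) (s : Memory) : α := (x s).1

/-- The memory that a computation leaves. -/
def memory (x : RAM α) (s : Memory) : Memory := (x s).2.1

/-- The number of steps of a computation. -/
def steps (x : RAM α) (s : Memory) : ℕ := (x s).2.2

/-- One step of loop control. -/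
def tick : RAM Unit := fun s => ((), s, 1)

/-- Addition. -/
def add (a b : ℕ) : RAM ℕ := fun s => (a + b, s, 1)

/-- Comparison. -/
def eq (a b : ℕ) : RAM Bool := fun s => (decide (a = b), s, 1)

/-- Read from the test assignment (read-only input): the test containing block `j` in
iteration `r` of level `ℓ`. -/
def readSlot {D : Design} (h : Placement D) (ℓ r j : ℕ) : RAM ℕ := fun s => (slot h ℓ r j, s, 1)

/-- Retrieve a test outcome (read-only input). -/
def readOutcome (Y : ℕ → ℕ → ℕ → Bool) (ℓ r t : ℕ) : RAM Bool := fun s => (Y ℓ r t, s, 1)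

/-- Add an element to the front of a linked list. -/
def cons (x : α) (l : List α) : RAM (List α) := fun s => (x :: l, s, 1)

/-- Read a flag. -/
def readMark (ℓ i j : ℕ) : RAM Bool := fun s => (s.mark ℓ i j, s, 1)

/-- Set a flag. -/
def setMark (ℓ i j : ℕ) : RAM Unit := fun s =>
  ((), { s with
    mark := fun ℓ' i' j' => if ℓ' = ℓ ∧ i' = i ∧ j' = j then true else s.mark ℓ' i' j' }, 1)

/-- Read (a pointer to) a stored list. -/
def readInd (ℓ i j : ℕ) : RAM (List (ℕ × ℕ)) := fun s => (s.ind ℓ i j, s, 1)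

/-- Store (a pointer to) a list. -/
def writeInd (ℓ i j : ℕ) (l : List (ℕ × ℕ)) : RAM Unit := fun s =>
  ((), { s with
    ind := fun ℓ' i' j' => if ℓ' = ℓ ∧ i' = i ∧ j' = j then l else s.ind ℓ' i' j' }, 1)

/-- `for i = 0, …, N - 1 do a := body i a`, with two steps of control (increment and test) per
iteration and one for leaving the loop. -/
def forRange (N : ℕ) (body : ℕ → α → RAM α) (a : α) : RAM α := do
  tick
  go N
where
  /-- The first `m` iterations. -/
  go : ℕ → RAM α
    | 0 => pure a
    | m + 1 => do
        let b ← go m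
        tick
        tick
        body m b

/-- `for x in l do a := body x a`, with two steps of control (read and advance the pointer) per
element and one for leaving the loop. -/
def forList (body : β → α → RAM α) : List β → α → RAM α
  | [], a => do
      tick
      pure a
  | x :: l, a => do
      tick
      tick
      let b ← body x a
      forList body l b

/-- `2 ^ e`, by repeated doubling. -/
def pow2 (e : ℕ) : RAM ℕ := forRange e (fun _ x => add x x) 1

/-! ### Programs -/

/-- Is the pair of blocks `(i, j)` contained in a negative test of level `ℓ`?  All iterations of
the level are inspected. -/
def checkAll {D : Design} (h : Placement D) (Y : ℕ → ℕ → ℕ → Bool) (ℓ i j : ℕ) : RAM Bool :=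
  forRange (D.iters ℓ)
    (fun r found => do
      let a ← readSlot h ℓ r i
      let b ← readSlot h ℓ r j
      if ← eq a b then
        if ← readOutcome Y ℓ r a then pure found else pure true
      else pure found)
    false

/-- The same, with the stored list of the tests that contain both blocks. -/
def checkStored (Y : ℕ → ℕ → ℕ → Bool) (ℓ i j : ℕ) : RAM Bool := do
  let l ← readInd ℓ i j
  forList
    (fun (rt : ℕ × ℕ) found => do
      if ← readOutcome Y ℓ rt.1 rt.2 then pure found else pure true)
    l false

/-- Insert the pair `(i, j)` into the set `acc` of pairs of level `ℓ`, unless it is there. -/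
def insertPair (ℓ i j : ℕ) (acc : List (ℕ × ℕ)) : RAM (List (ℕ × ℕ)) := do
  if ← readMark ℓ i j then pure acc
  else do
    setMark ℓ i j
    cons (i, j) acc

/-- Insert the six child pairs of `(i, j)` into the set `acc` of pairs of level `ℓ`. -/
def insertChildren (ℓ i j : ℕ) (acc : List (ℕ × ℕ)) : RAM (List (ℕ × ℕ)) := do
  let iL ← add i i
  let iR ← add iL 1
  let jL ← add j j
  let jR ← add jL 1
  let acc ← insertPair ℓ iL jL acc
  let acc ← insertPair ℓ iL jR acc
  let acc ← insertPair ℓ iR jL acc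
  let acc ← insertPair ℓ iR jR acc
  let acc ← insertPair ℓ iL iR acc
  insertPair ℓ jL jR acc

/-- The list of all pairs of blocks among `g` blocks. -/
def allPairs (g : ℕ) : RAM (List (ℕ × ℕ)) :=
  forRange g (fun j acc => forRange j (fun i acc => cons (i, j) acc) acc) []

/-- The decoder, with a procedure `check` that tells if a pair of blocks is in a negative test
of its level. -/
def decode (D : Design) (check : ℕ → ℕ → ℕ → RAM Bool) : RAM (List (ℕ × ℕ)) := do
  let g ← pow2 D.lmin
  let pd₀ ← allPairs g
  let pd ← forRange (D.depth - D.lmin)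
    (fun s pd => do
      let ℓ ← add D.lmin s
      let ℓ₁ ← add ℓ 1
      forList
        (fun (p : ℕ × ℕ) acc => do
          if ← check ℓ p.1 p.2 then pure acc else insertChildren ℓ₁ p.1 p.2 acc)
        pd [])
    pd₀
  forList
    (fun (p : ℕ × ℕ) acc => do
      if ← check D.depth p.1 p.2 then pure acc else cons p acc)
    pd []

/-- Pre-processing, which sees the test assignment but no outcome: for every level and every pair
of blocks, store the list of the tests that contain both blocks. -/
def preprocess {D : Design} (h : Placement D) : RAM Unit :=
  forRange (D.depth + 1 - D.lmin)
    (fun s _ => do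
      let ℓ ← add D.lmin s
      let g ← pow2 ℓ
      forRange g
        (fun j _ => forRange j
          (fun i _ => forRange (D.iters ℓ)
            (fun r _ => do
              let a ← readSlot h ℓ r i
              let b ← readSlot h ℓ r j
              if ← eq a b then do
                let l ← readInd ℓ i j
                let l ← cons (r, a) l
                writeInd ℓ i j l
              else pure ())
            ())
          ())
        ())
    ()

end RAM

/-! ### Outputs, running times, and the probability space -/

section Runs

variable {D : Design} (h : Placement D) (Y : ℕ → ℕ → ℕ → Bool)

/-- Output of the decoder without pre-processing. -/
def decoderOutput : List (ℕ × ℕ) := (RAM.decode D (RAM.checkAll h Y)).result Memory.init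

/-- Running time of the decoder without pre-processing. -/
def decoderTime : ℕ := (RAM.decode D (RAM.checkAll h Y)).steps Memory.init

/-- Running time of the pre-processing. -/
def preprocessTime : ℕ := (RAM.preprocess h).steps Memory.init

/-- Output of the decoder started on the memory left by the pre-processing. -/
def fastDecoderOutput : List (ℕ × ℕ) :=
  (RAM.decode D (RAM.checkStored Y)).result ((RAM.preprocess h).memory Memory.init)

/-- Running time of the decoder started on the memory left by the pre-processing. -/
def fastDecoderTime : ℕ :=
  (RAM.decode D (RAM.checkStored Y)).steps ((RAM.preprocess h).memory Memory.init)

end Runs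

/-- Expected number of edges of the Erdős–Rényi graph with `n` vertices and edge probability
`q`. -/
noncomputable def expectedEdges (n : ℕ) (q : unitInterval) : ℝ := (q : ℝ) * (n.choose 2 : ℝ)

/-- The joint law of the Erdős–Rényi graph and the test assignment: these are independent, and
all blocks of all levels and iterations are assigned independently and uniformly. -/
noncomputable def law (n : ℕ) (q : unitInterval) (D : Design) :
    Measure (SimpleGraph (Fin n) × Placement D) :=
  (SimpleGraph.binomialRandom (Fin n) q).prod (uniformOn Set.univ)

end GraphSplitting

namespace GraphSplitting

/-! ### The machine: evaluation rules, loop rules, duplicate-free insertion -/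

namespace RAM

variable {α β : Type}

/-! A pair of blocks whose union contains an edge is never excluded (`Defective.not_excluded`), so
every edge stays inside some possibly defective pair down to the last level
(`exists_possiblyDefective`). It remains to see that the other pairs disappear fast enough at the
intermediate levels and completely at the last one. This is proved over the random placement for a
fixed typical graph; `law_le` then adds the probability of an atypical graph.

One iteration: let W, of order √k, be the width. Two blocks share a test with probability 1/W. For a
nondefective pair, an edge that lies inside a block or meets one of the two blocks spoils this test
at a cost of 1/W² in probability, any other edge at a cost of 1/W³
(`le_unifProb_colocated_negative`). A typical graph has at most 6√k edges inside blocks, at most 6√k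
meeting each given block, and at most 2k in all. As W ≥ 27√k, one iteration eliminates the pair with
probability at least 0.33/W (`le_unifProb_detects`), and it survives a whole level with probability
at most e⁻³ ≤ 1/12.

Branching: a survivor has at most six children, and 6/12 < 1. The defective pairs of level ℓ number
at most |E| plus 2^ℓ times the number of edges inside blocks; κ ≥ k is a budget for the second term.
Colocations of distinct pairs are independent even when the pairs share a block, so survival events
have small covariance, and Chebyshev's inequality controls the survivors of a level up to a failure
probability O(1/√k) (`unifProb_survivors_le`). Levels are independent, so the number of possibly
defective pairs stays below 48κ (`card_possiblyDefective_le`), with total failure probability O(log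
n/√k).

The budget: for θ > 1/2 a Chernoff bound allows κ = 6k, because k/n is at least of the order of a
positive power of n. In general Markov's inequality and a union bound over O(log n) levels allow κ =
k log² k, which is the source of the additional factor log² k.

At the last level, the log n rounds push survival below n⁻³, which beats the O(n²) pairs. The lists
of common tests have binomial lengths with mean O(log n), so all of them are O(log n) with high
probability. The running times follow from a deterministic bound of the cost by the numbers of
possibly defective pairs times the cost of a check (`decode_spec`). -/

@[simp] lemma result_pure (a : α) (s : Memory) : (pure a : RAM α).result s = a := rfl
@[simp] lemma memory_pure (a : α) (s : Memory) : (pure a : RAM α).memory s = s := rfl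
@[simp] lemma steps_pure (a : α) (s : Memory) : (pure a : RAM α).steps s = 0 := rfl
@[simp] lemma result_bind (x : RAM α) (f : α → RAM β) (s : Memory) :
    (x >>= f).result s = (f (x.result s)).result (x.memory s) := rfl
@[simp] lemma memory_bind (x : RAM α) (f : α → RAM β) (s : Memory) :
    (x >>= f).memory s = (f (x.result s)).memory (x.memory s) := rfl
@[simp] lemma steps_bind (x : RAM α) (f : α → RAM β) (s : Memory) :
    (x >>= f).steps s = x.steps s + (f (x.result s)).steps (x.memory s) := rfl
@[simp] lemma memory_tick (s : Memory) : tick.memory s = s := rfl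
@[simp] lemma steps_tick (s : Memory) : tick.steps s = 1 := rfl
@[simp] lemma result_add (a b : ℕ) (s : Memory) : (add a b).result s = a + b := rfl
@[simp] lemma memory_add (a b : ℕ) (s : Memory) : (add a b).memory s = s := rfl
@[simp] lemma steps_add (a b : ℕ) (s : Memory) : (add a b).steps s = 1 := rfl
@[simp] lemma result_eq (a b : ℕ) (s : Memory) : (eq a b).result s = decide (a = b) := rfl
@[simp] lemma memory_eq (a b : ℕ) (s : Memory) : (eq a b).memory s = s := rfl
@[simp] lemma steps_eq (a b : ℕ) (s : Memory) : (eq a b).steps s = 1 := rfl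
@[simp] lemma result_readSlot {D : Design} (h : Placement D) (ℓ r j : ℕ) (s : Memory) :
    (readSlot h ℓ r j).result s = slot h ℓ r j := rfl
@[simp] lemma memory_readSlot {D : Design} (h : Placement D) (ℓ r j : ℕ) (s : Memory) :
    (readSlot h ℓ r j).memory s = s := rfl
@[simp] lemma steps_readSlot {D : Design} (h : Placement D) (ℓ r j : ℕ) (s : Memory) :
    (readSlot h ℓ r j).steps s = 1 := rfl
@[simp] lemma result_readOutcome (Y : ℕ → ℕ → ℕ → Bool) (ℓ r t : ℕ) (s : Memory) :
    (readOutcome Y ℓ r t).result s = Y ℓ r t := rfl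
@[simp] lemma memory_readOutcome (Y : ℕ → ℕ → ℕ → Bool) (ℓ r t : ℕ) (s : Memory) :
    (readOutcome Y ℓ r t).memory s = s := rfl
@[simp] lemma steps_readOutcome (Y : ℕ → ℕ → ℕ → Bool) (ℓ r t : ℕ) (s : Memory) :
    (readOutcome Y ℓ r t).steps s = 1 := rfl
@[simp] lemma result_cons (x : α) (l : List α) (s : Memory) : (cons x l).result s = x :: l := rfl
@[simp] lemma memory_cons (x : α) (l : List α) (s : Memory) : (cons x l).memory s = s := rfl
@[simp] lemma steps_cons (x : α) (l : List α) (s : Memory) : (cons x l).steps s = 1 := rfl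
@[simp] lemma result_readMark (ℓ i j : ℕ) (s : Memory) :
    (readMark ℓ i j).result s = s.mark ℓ i j := rfl
@[simp] lemma memory_readMark (ℓ i j : ℕ) (s : Memory) : (readMark ℓ i j).memory s = s := rfl
@[simp] lemma steps_readMark (ℓ i j : ℕ) (s : Memory) : (readMark ℓ i j).steps s = 1 := rfl
@[simp] lemma steps_setMark (ℓ i j : ℕ) (s : Memory) : (setMark ℓ i j).steps s = 1 := rfl
@[simp] lemma result_readInd (ℓ i j : ℕ) (s : Memory) :
    (readInd ℓ i j).result s = s.ind ℓ i j := rfl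
@[simp] lemma memory_readInd (ℓ i j : ℕ) (s : Memory) : (readInd ℓ i j).memory s = s := rfl
@[simp] lemma steps_readInd (ℓ i j : ℕ) (s : Memory) : (readInd ℓ i j).steps s = 1 := rfl
@[simp] lemma steps_writeInd (ℓ i j : ℕ) (l : List (ℕ × ℕ)) (s : Memory) :
    (writeInd ℓ i j l).steps s = 1 := rfl

@[simp] lemma mark_setMark (ℓ i j : ℕ) (s : Memory) (ℓ' i' j' : ℕ) :
    ((setMark ℓ i j).memory s).mark ℓ' i' j' =
      if ℓ' = ℓ ∧ i' = i ∧ j' = j then true else s.mark ℓ' i' j' := rfl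
@[simp] lemma mark_writeInd (ℓ i j : ℕ) (l : List (ℕ × ℕ)) (s : Memory) :
    ((writeInd ℓ i j l).memory s).mark = s.mark := rfl
@[simp] lemma ind_writeInd (ℓ i j : ℕ) (l : List (ℕ × ℕ)) (s : Memory) (ℓ' i' j' : ℕ) :
    ((writeInd ℓ i j l).memory s).ind ℓ' i' j' =
      if ℓ' = ℓ ∧ i' = i ∧ j' = j then l else s.ind ℓ' i' j' := rfl

/-- Loop rule for `forRange`: an invariant, and a bound on the number of steps. -/
lemma forRange_spec (I : ℕ → α → Memory → Prop) (T : ℕ → ℕ) (body : ℕ → α → RAM α) (N : ℕ)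
    (hb : ∀ m < N, ∀ a s, I m a s →
      I (m + 1) ((body m a).result s) ((body m a).memory s) ∧ (body m a).steps s ≤ T m)
    {a : α} {s : Memory} (h0 : I 0 a s) :
    I N ((forRange N body a).result s) ((forRange N body a).memory s) ∧
      (forRange N body a).steps s ≤ 1 + ∑ m ∈ Finset.range N, (T m + 2) := by
  have key : ∀ m ≤ N, I m ((forRange.go body a m).result s) ((forRange.go body a m).memory s) ∧
      (forRange.go body a m).steps s ≤ ∑ m ∈ Finset.range m, (T m + 2) := by
    intro m
    induction m with
    | zero => intro _; exact ⟨h0, by simp [forRange.go]⟩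
    | succ m ih =>
      intro hm
      obtain ⟨h1, h2⟩ := ih (by omega)
      obtain ⟨h3, h4⟩ := hb m (by omega) _ _ h1
      refine ⟨by simpa [forRange.go] using h3, ?_⟩
      rw [Finset.sum_range_succ]
      simp only [forRange.go, steps_bind, steps_tick, memory_tick]
      omega
  obtain ⟨h1, h2⟩ := key N le_rfl
  refine ⟨by simpa [forRange] using h1, ?_⟩
  simp only [forRange, steps_bind, steps_tick, memory_tick]
  omega

/-- Loop rule for `forList`: an invariant that depends on the processed prefix, and a bound on the
number of steps. -/
lemma forList_spec (I : List β → α → Memory → Prop) (T : ℕ) (body : β → α → RAM α) (l : List β)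
    (hb : ∀ pre, ∀ x ∈ l, ∀ a s, I pre a s →
      I (pre ++ [x]) ((body x a).result s) ((body x a).memory s) ∧ (body x a).steps s ≤ T)
    (pre : List β) {a : α} {s : Memory} (h0 : I pre a s) :
    I (pre ++ l) ((forList body l a).result s) ((forList body l a).memory s) ∧
      (forList body l a).steps s ≤ 1 + l.length * (T + 2) := by
  induction l generalizing pre a s with
  | nil => simpa [forList] using h0
  | cons x l ih =>
    obtain ⟨h1, h2⟩ := hb pre x (by simp) a s h0
    obtain ⟨h3, h4⟩ := ih (fun pre y hy => hb pre y (by simp [hy])) (pre ++ [x]) h1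
    constructor
    · simpa [forList] using h3
    · simp only [forList, steps_bind, steps_tick, memory_tick, List.length_cons]
      rw [add_mul]
      omega

lemma pow2_spec (e : ℕ) (s : Memory) :
    (pow2 e).result s = 2 ^ e ∧ (pow2 e).memory s = s ∧ (pow2 e).steps s ≤ 1 + e * 3 := by
  have := forRange_spec (fun m a s' => a = 2 ^ m ∧ s' = s) (fun _ => 1)
    (fun _ x => add x x) e (a := 1) (s := s)
    (by rintro m - a s' ⟨rfl, rfl⟩; simp [pow_succ]; omega) (by simp)
  simpa [pow2, and_assoc] using this

lemma allPairs_spec (g : ℕ) (s : Memory) :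
    (((allPairs g).result s).Nodup ∧ ∀ p, p ∈ (allPairs g).result s ↔ p.1 < p.2 ∧ p.2 < g) ∧
      (allPairs g).memory s = s ∧ (allPairs g).steps s ≤ 1 + g * (3 * g + 3) := by
  have := forRange_spec
    (fun m (a : List (ℕ × ℕ)) s' =>
      (a.Nodup ∧ ∀ p : ℕ × ℕ, p ∈ a ↔ p.1 < p.2 ∧ p.2 < m) ∧ s' = s)
    (fun _ => 3 * g + 1)
    (fun j acc => forRange j (fun i acc => cons (i, j) acc) acc) g (a := []) (s := s)
    (by
      rintro m hm a s' ⟨⟨hnd, hmem⟩, rfl⟩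
      have inner := forRange_spec
        (fun m' (a : List (ℕ × ℕ)) s'' => (a.Nodup ∧
          ∀ p : ℕ × ℕ, p ∈ a ↔ (p.1 < p.2 ∧ p.2 < m) ∨ (p.1 < m' ∧ p.2 = m)) ∧ s'' = s')
        (fun _ => 1) (fun i acc => cons (i, m) acc) m (a := a) (s := s')
        (by
          rintro i hi b s'' ⟨⟨hnd, hmem⟩, rfl⟩
          refine ⟨⟨⟨?_, ?_⟩, by simp⟩, by simp⟩
          · simp only [result_cons, List.nodup_cons]
            refine ⟨fun hc => ?_, hnd⟩
            rw [hmem] at hc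
            simp at hc
          · rintro ⟨p, p'⟩
            simp only [result_cons, List.mem_cons, hmem, Prod.mk.injEq]
            omega)
        (by
          refine ⟨⟨hnd, fun p => ?_⟩, rfl⟩
          rw [hmem]
          omega)
      obtain ⟨⟨⟨h1, h2⟩, h3⟩, h4⟩ := inner
      refine ⟨⟨⟨h1, fun p => ?_⟩, h3⟩, ?_⟩
      · rw [h2]
        omega
      · refine h4.trans ?_
        simp
        omega)
    (by simp)
  obtain ⟨⟨h1, h2⟩, h3⟩ := this
  refine ⟨h1, h2, h3.trans ?_⟩
  simp

/-- The list `acc` enumerates the flagged pairs of level `ℓ` without repetition. -/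
structure Enumerates (ℓ : ℕ) (acc : List (ℕ × ℕ)) (s : Memory) : Prop where
  nodup : acc.Nodup
  mark_iff : ∀ i j, s.mark ℓ i j = true ↔ (i, j) ∈ acc

/-- Two memories agree except for the flags of level `ℓ`. -/
structure AgreesOff (ℓ : ℕ) (s s' : Memory) : Prop where
  ind : s'.ind = s.ind
  mark : ∀ ℓ' ≠ ℓ, s'.mark ℓ' = s.mark ℓ'

lemma AgreesOff.refl (ℓ : ℕ) (s : Memory) : AgreesOff ℓ s s := ⟨rfl, fun _ _ => rfl⟩

lemma AgreesOff.trans {ℓ : ℕ} {s s' s'' : Memory} (h : AgreesOff ℓ s s')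
    (h' : AgreesOff ℓ s' s'') : AgreesOff ℓ s s'' :=
  ⟨h'.ind.trans h.ind, fun ℓ' hℓ => (h'.mark ℓ' hℓ).trans (h.mark ℓ' hℓ)⟩

/-- The flags give a membership test in one step. Deduplication matters because the two children of
a block arise from every pair containing that block, while the cost of the next level is the length
of the list. -/
lemma insertPair_spec (ℓ i j : ℕ) {acc : List (ℕ × ℕ)} {s : Memory} (h : Enumerates ℓ acc s) :
    Enumerates ℓ ((insertPair ℓ i j acc).result s) ((insertPair ℓ i j acc).memory s) ∧
      ((insertPair ℓ i j acc).result s).toFinset = insert (i, j) acc.toFinset ∧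
      AgreesOff ℓ s ((insertPair ℓ i j acc).memory s) ∧
      (insertPair ℓ i j acc).steps s ≤ 3 := by
  by_cases hm : s.mark ℓ i j = true
  · have hin := (h.mark_iff i j).1 hm
    simp only [insertPair, result_bind, result_readMark, memory_readMark, hm, if_true, result_pure,
      memory_bind, memory_pure, steps_bind, steps_readMark, steps_pure]
    exact ⟨h, by simp [hin], AgreesOff.refl _ _, by omega⟩
  · have hin : (i, j) ∉ acc := fun hc => hm ((h.mark_iff i j).2 hc)
    simp only [insertPair, result_bind, result_readMark, memory_readMark, hm, if_false,
      memory_bind, steps_bind, steps_readMark, result_cons, memory_cons, steps_cons, steps_setMark,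
      Bool.false_eq_true]
    refine ⟨⟨List.nodup_cons.2 ⟨hin, h.nodup⟩, fun i' j' => ?_⟩, by simp, ⟨rfl, ?_⟩, by omega⟩
    · simp only [mark_setMark, true_and, List.mem_cons, Prod.mk.injEq]
      split_ifs with hc
      · simp [hc]
      · simp [hc, h.mark_iff]
    · intro ℓ' hℓ
      funext i' j'
      simp [hℓ]

lemma insertChildren_spec (ℓ i j : ℕ) {acc : List (ℕ × ℕ)} {s : Memory} (h : Enumerates ℓ acc s) :
    Enumerates ℓ ((insertChildren ℓ i j acc).result s) ((insertChildren ℓ i j acc).memory s) ∧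
      ((insertChildren ℓ i j acc).result s).toFinset = acc.toFinset ∪ childPairs (i, j) ∧
      AgreesOff ℓ s ((insertChildren ℓ i j acc).memory s) ∧
      (insertChildren ℓ i j acc).steps s ≤ 22 := by
  simp only [insertChildren, result_bind, memory_bind, steps_bind, result_add, memory_add,
    steps_add]
  obtain ⟨e1, f1, a1, t1⟩ := insertPair_spec ℓ (i + i) (j + j) h
  obtain ⟨e2, f2, a2, t2⟩ := insertPair_spec ℓ (i + i) (j + j + 1) e1
  obtain ⟨e3, f3, a3, t3⟩ := insertPair_spec ℓ (i + i + 1) (j + j) e2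
  obtain ⟨e4, f4, a4, t4⟩ := insertPair_spec ℓ (i + i + 1) (j + j + 1) e3
  obtain ⟨e5, f5, a5, t5⟩ := insertPair_spec ℓ (i + i) (i + i + 1) e4
  obtain ⟨e6, f6, a6, t6⟩ := insertPair_spec ℓ (j + j) (j + j + 1) e5
  refine ⟨e6, ?_, a1.trans <| a2.trans <| a3.trans <| a4.trans <| a5.trans a6, by omega⟩
  rw [f6, f5, f4, f3, f2, f1]
  ext p
  simp only [childPairs, Finset.mem_insert, Finset.mem_union, two_mul, Finset.mem_singleton]
  tauto

end RAM

/-! ### Correctness and cost of the programs for a fixed placement and arbitrary outcomes -/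

section Decoder

variable {D : Design}

/-- Supplies the index range that the checks rely on: lists are stored only for ordered pairs of
existing blocks. -/
lemma possiblyDefective_lt (h : Placement D) (Y : ℕ → ℕ → ℕ → Bool) (s : ℕ) :
    ∀ p ∈ possiblyDefective h Y s, p.1 < p.2 ∧ p.2 < 2 ^ (D.lmin + s) := by
  induction s with
  | zero =>
    intro p hp
    simp only [possiblyDefective, Finset.mem_filter, Finset.mem_product, Finset.mem_range] at hp
    simpa using ⟨hp.2, hp.1.2⟩
  | succ s ih =>
    intro p hp
    simp only [possiblyDefective, Finset.mem_biUnion, Finset.mem_filter] at hp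
    obtain ⟨p', ⟨hp', -⟩, hc⟩ := hp
    obtain ⟨h1, h2⟩ := ih p' hp'
    have h3 : 2 ^ (D.lmin + (s + 1)) = 2 * 2 ^ (D.lmin + s) := by rw [← add_assoc, pow_succ']
    rw [h3]
    simp only [childPairs, Finset.mem_insert, Finset.mem_singleton] at hc
    rcases hc with rfl | rfl | rfl | rfl | rfl | rfl <;> constructor <;> simp only <;> omega

open RAM in
/-- The decoder computes the estimate from any procedure that recognises the excluded pairs. -/
lemma decode_spec (h : Placement D) (Y : ℕ → ℕ → ℕ → Bool) (hD : D.lmin ≤ D.depth)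
    (check : ℕ → ℕ → ℕ → RAM Bool) (T : ℕ → ℕ) (s₀ : Memory)
    (hmark : ∀ ℓ i j, s₀.mark ℓ i j = false)
    (hcheck : ∀ ℓ ∈ Finset.Icc D.lmin D.depth, ∀ p : ℕ × ℕ, p.1 < p.2 → p.2 < 2 ^ ℓ →
      ∀ s : Memory, s.ind = s₀.ind →
      ((check ℓ p.1 p.2).result s = decide (Excluded h Y ℓ p)) ∧
        (check ℓ p.1 p.2).memory s = s ∧ (check ℓ p.1 p.2).steps s ≤ T ℓ) :
    ((decode D check).result s₀).toFinset = estimate h Y ∧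
      (decode D check).steps s₀ ≤ (1 + D.lmin * 3) + (1 + 2 ^ D.lmin * (3 * 2 ^ D.lmin + 3)) +
        (1 + ∑ s ∈ Finset.range (D.depth - D.lmin),
          (3 + (possiblyDefective h Y s).card * (T (D.lmin + s) + 24) + 2)) +
        (1 + (possiblyDefective h Y (D.depth - D.lmin)).card * (T D.depth + 3)) := by
  obtain ⟨g1, g2, g3⟩ := pow2_spec D.lmin s₀
  obtain ⟨⟨p1, p2⟩, p3, p4⟩ := allPairs_spec (2 ^ D.lmin) s₀
  have loop := forRange_spec
    -- The last clause keeps the flags of later levels unset, so that the empty list enumerates them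
    -- when a new level starts. The clause on `ind` keeps the stored lists valid for `check`.
    (fun m (pd : List (ℕ × ℕ)) s => pd.Nodup ∧ pd.toFinset = possiblyDefective h Y m ∧
      s.ind = s₀.ind ∧ ∀ ℓ > D.lmin + m, ∀ i j, s.mark ℓ i j = false)
    (fun m => 3 + (possiblyDefective h Y m).card * (T (D.lmin + m) + 24))
    (fun s pd => do
      let ℓ ← add D.lmin s
      let ℓ₁ ← add ℓ 1
      forList
        (fun (p : ℕ × ℕ) acc => do
          if ← check ℓ p.1 p.2 then pure acc else insertChildren ℓ₁ p.1 p.2 acc)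
        pd [])
    (D.depth - D.lmin) (a := (allPairs (2 ^ D.lmin)).result s₀) (s := s₀)
    (by
      rintro m hm pd s ⟨hnd, hpd, hind, hmk⟩
      have inner := forList_spec
        (fun pre (acc : List (ℕ × ℕ)) s' => Enumerates (D.lmin + m + 1) acc s' ∧
          acc.toFinset = (pre.toFinset.filter fun p => ¬ Excluded h Y (D.lmin + m) p).biUnion
            childPairs ∧ AgreesOff (D.lmin + m + 1) s s')
        -- 22 is four additions and six insertions of at most three steps each.
        (T (D.lmin + m) + 22)
        (fun (p : ℕ × ℕ) acc => do
          if ← check (D.lmin + m) p.1 p.2 then pure acc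
          else insertChildren (D.lmin + m + 1) p.1 p.2 acc)
        pd
        (by
          rintro pre p hp acc s' ⟨he, hf, ha⟩
          have hp' : p ∈ possiblyDefective h Y m := by rw [← hpd]; simpa using hp
          obtain ⟨hlt, hlt'⟩ := possiblyDefective_lt h Y m p hp'
          obtain ⟨c1, c2, c3⟩ := hcheck (D.lmin + m) (by rw [Finset.mem_Icc]; omega) p hlt hlt' s'
            (ha.ind.trans hind)
          have hunion : ((pre ++ [p]).toFinset.filter
              fun p => ¬ Excluded h Y (D.lmin + m) p).biUnion childPairs =
              (pre.toFinset.filter fun p => ¬ Excluded h Y (D.lmin + m) p).biUnion childPairs ∪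
              (if Excluded h Y (D.lmin + m) p then ∅ else childPairs p) := by
            rw [List.toFinset_append, Finset.filter_union, Finset.union_biUnion]
            congr 1
            by_cases hx : Excluded h Y (D.lmin + m) p
            · rw [if_pos hx, Finset.filter_eq_empty_iff.2]
              · simp
              · intro x hxx
                have : x = p := by simpa using hxx
                subst this
                exact not_not.2 hx
            · rw [if_neg hx, Finset.filter_eq_self.2]
              · simp
              · intro x hxx
                have : x = p := by simpa using hxx
                subst this
                exact hx
          simp only [result_bind, memory_bind, steps_bind, c1, c2]
          by_cases hx : Excluded h Y (D.lmin + m) p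
          · simp only [decide_eq_true hx, if_true, result_pure, memory_pure, steps_pure]
            refine ⟨⟨he, ?_, ha⟩, by omega⟩
            rw [hunion, if_pos hx, hf]
            simp
          · simp only [decide_eq_false hx, Bool.false_eq_true, if_false]
            obtain ⟨i1, i2, i3, i4⟩ := insertChildren_spec (D.lmin + m + 1) p.1 p.2 he
            refine ⟨⟨i1, ?_, ha.trans i3⟩, by omega⟩
            rw [hunion, if_neg hx, i2, hf])
        [] (a := []) (s := s)
        (by
          refine ⟨⟨List.nodup_nil, fun i j => ?_⟩, by simp, AgreesOff.refl _ _⟩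
          simp [hmk (D.lmin + m + 1) (by omega)])
      obtain ⟨⟨i1, i2, i3⟩, i4⟩ := inner
      simp only [result_bind, memory_bind, steps_bind, result_add, memory_add, steps_add]
      refine ⟨⟨i1.nodup, ?_, i3.ind.trans hind, fun ℓ hℓ i j => ?_⟩, ?_⟩
      · rw [i2, List.nil_append, hpd]
        rfl
      · rw [i3.mark ℓ (by omega)]
        exact hmk ℓ (by omega) i j
      · rw [← hpd, List.toFinset_card_of_nodup hnd]
        rw [show T (D.lmin + m) + 22 + 2 = T (D.lmin + m) + 24 from rfl] at i4
        omega)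
    (by
      refine ⟨p1, ?_, rfl, fun ℓ _ i j => hmark ℓ i j⟩
      ext p
      simp only [List.mem_toFinset, p2, possiblyDefective, Finset.mem_filter, Finset.mem_product,
        Finset.mem_range]
      omega)
  obtain ⟨⟨l1, l2, l3, -⟩, l4⟩ := loop
  set x := forRange (D.depth - D.lmin)
    (fun s pd => do
      let ℓ ← add D.lmin s
      let ℓ₁ ← add ℓ 1
      forList
        (fun (p : ℕ × ℕ) acc => do
          if ← check ℓ p.1 p.2 then pure acc else insertChildren ℓ₁ p.1 p.2 acc)
        pd []) ((allPairs (2 ^ D.lmin)).result s₀) with hx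
  have last := forList_spec
    (fun pre (acc : List (ℕ × ℕ)) s' =>
      acc.toFinset = (pre.toFinset.filter fun p => ¬ Excluded h Y D.depth p) ∧
        s' = x.memory s₀)
    (T D.depth + 1)
    (fun (p : ℕ × ℕ) acc => do
      if ← check D.depth p.1 p.2 then pure acc else cons p acc)
    (x.result s₀)
    (by
      rintro pre p hp acc s' ⟨hf, rfl⟩
      have hp' : p ∈ possiblyDefective h Y (D.depth - D.lmin) := by rw [← l2]; simpa using hp
      obtain ⟨hlt, hlt'⟩ := possiblyDefective_lt h Y _ p hp'
      rw [Nat.add_sub_cancel' hD] at hlt'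
      obtain ⟨c1, c2, c3⟩ := hcheck D.depth (by simp [hD]) p hlt hlt' _ l3
      simp only [result_bind, memory_bind, steps_bind, c1, c2]
      by_cases hx : Excluded h Y D.depth p
      · simp only [decide_eq_true hx, if_true, result_pure, memory_pure, steps_pure]
        refine ⟨⟨?_, trivial⟩, by omega⟩
        rw [hf]
        ext y
        simp only [Finset.mem_filter, List.mem_toFinset, List.mem_append, List.mem_singleton]
        constructor
        · tauto
        · rintro ⟨h1 | rfl, h2⟩
          · exact ⟨h1, h2⟩
          · exact absurd hx h2
      · simp only [decide_eq_false hx, Bool.false_eq_true, if_false, result_cons, memory_cons,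
          steps_cons]
        refine ⟨⟨?_, trivial⟩, by omega⟩
        rw [List.toFinset_cons, hf]
        ext y
        simp only [Finset.mem_filter, List.mem_toFinset, List.mem_append, List.mem_singleton,
          Finset.mem_insert]
        constructor
        · rintro (rfl | h1)
          · exact ⟨Or.inr rfl, hx⟩
          · tauto
        · tauto)
    [] (a := []) (s := x.memory s₀) (by simp)
  obtain ⟨⟨e1, -⟩, e2⟩ := last
  constructor
  · have : (decode D check).result s₀ = _ := rfl
    simp only [decode, result_bind, g1, g2, p3, ← hx]
    rw [e1, List.nil_append, l2]
    rfl
  · simp only [decode, steps_bind, g1, g2, p3, ← hx]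
    rw [← List.toFinset_card_of_nodup l1, l2,
      show T D.depth + 1 + 2 = T D.depth + 3 from rfl] at e2
    omega

open RAM in
lemma checkAll_spec (h : Placement D) (Y : ℕ → ℕ → ℕ → Bool) (ℓ : ℕ) (p : ℕ × ℕ) (s : Memory) :
    (checkAll h Y ℓ p.1 p.2).result s = decide (Excluded h Y ℓ p) ∧
      (checkAll h Y ℓ p.1 p.2).memory s = s ∧
      (checkAll h Y ℓ p.1 p.2).steps s ≤ 1 + D.iters ℓ * 6 := by
  have := forRange_spec
    (fun m (a : Bool) s' => a = decide (∃ r ∈ Finset.range m,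
      slot h ℓ r p.1 = slot h ℓ r p.2 ∧ Y ℓ r (slot h ℓ r p.1) = false) ∧ s' = s)
    -- Two reads of the assignment, a comparison and an outcome; loop control adds two steps, whence
    -- the factor 6.
    (fun _ => 4)
    (fun r found => do
      let a ← readSlot h ℓ r p.1
      let b ← readSlot h ℓ r p.2
      if ← eq a b then
        if ← readOutcome Y ℓ r a then pure found else pure true
      else pure found) (D.iters ℓ) (a := false) (s := s)
    (by
      rintro m hm a s' ⟨rfl, rfl⟩
      simp only [result_bind, memory_bind, steps_bind, result_readSlot, memory_readSlot,
        result_eq, memory_eq, steps_readSlot, steps_eq]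
      by_cases h1 : slot h ℓ m p.1 = slot h ℓ m p.2
      · by_cases h2 : Y ℓ m (slot h ℓ m p.1) = true
        · simp [h1, Finset.range_add_one, h1 ▸ h2]
        · simp [h1, Finset.range_add_one, h1 ▸ h2]
      · simp [h1, Finset.range_add_one])
    (by simp)
  simpa [checkAll, and_assoc, Excluded] using this

open RAM in
-- The hypothesis determines the stored list only up to order and repetition, which suffices for the
-- answer; the cost is governed by its length.
lemma checkStored_spec (h : Placement D) (Y : ℕ → ℕ → ℕ → Bool) (ℓ : ℕ) (p : ℕ × ℕ) (s : Memory)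
    (hs : ∀ rt, rt ∈ s.ind ℓ p.1 p.2 ↔ rt.1 ∈ Finset.range (D.iters ℓ) ∧
      slot h ℓ rt.1 p.1 = slot h ℓ rt.1 p.2 ∧ rt.2 = slot h ℓ rt.1 p.1) :
    (checkStored Y ℓ p.1 p.2).result s = decide (Excluded h Y ℓ p) ∧
      (checkStored Y ℓ p.1 p.2).memory s = s ∧
      (checkStored Y ℓ p.1 p.2).steps s ≤ 2 + (s.ind ℓ p.1 p.2).length * 3 := by
  have := forList_spec
    (fun pre (a : Bool) s' => a = decide (∃ rt ∈ pre, Y ℓ rt.1 rt.2 = false) ∧ s' = s) 1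
    (fun (rt : ℕ × ℕ) found => do
      if ← readOutcome Y ℓ rt.1 rt.2 then pure found else pure true)
    (s.ind ℓ p.1 p.2)
    (by
      rintro pre x hx a s' ⟨rfl, rfl⟩
      simp only [result_bind, memory_bind, steps_bind, result_readOutcome, memory_readOutcome,
        steps_readOutcome]
      by_cases h2 : Y ℓ x.1 x.2 = true
      · simp only [h2, if_true, result_pure, memory_pure, steps_pure, List.mem_append,
          List.mem_singleton, or_and_right, exists_or, exists_eq_left]
        simp
      · simp only [h2, List.mem_append,
          List.mem_singleton, or_and_right, exists_or, exists_eq_left]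
        simp)
    [] (a := false) (s := s) (by simp)
  obtain ⟨⟨h1, h2⟩, h3⟩ := this
  have h4 : (∃ rt ∈ s.ind ℓ p.1 p.2, Y ℓ rt.1 rt.2 = false) ↔ Excluded h Y ℓ p := by
    constructor
    · rintro ⟨⟨r, t⟩, hrt, hY⟩
      obtain ⟨a1, a2, a3⟩ := (hs _).1 hrt
      simp only at a1 a2 a3 hY
      exact ⟨r, a1, a2, a3 ▸ hY⟩
    · rintro ⟨r, hr, hsl, hY⟩
      exact ⟨(r, slot h ℓ r p.1), (hs _).2 ⟨hr, hsl, rfl⟩, hY⟩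
  simp only [checkStored, result_bind, memory_bind, steps_bind, result_readInd, memory_readInd,
    steps_readInd]
  refine ⟨?_, h2, by omega⟩
  rw [h1, List.nil_append, decide_eq_decide]
  exact h4

/-- The tests of the first `N` iterations of level `ℓ` that contain both blocks of `p`. -/
def commonTests (h : Placement D) (ℓ N : ℕ) (p : ℕ × ℕ) : List (ℕ × ℕ) :=
  (((List.range N).filter fun r => slot h ℓ r p.1 = slot h ℓ r p.2).map
    fun r => (r, slot h ℓ r p.1)).reverse

lemma mem_commonTests (h : Placement D) (ℓ N : ℕ) (p rt : ℕ × ℕ) :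
    rt ∈ commonTests h ℓ N p ↔ rt.1 ∈ Finset.range N ∧
      slot h ℓ rt.1 p.1 = slot h ℓ rt.1 p.2 ∧ rt.2 = slot h ℓ rt.1 p.1 := by
  simp only [commonTests, List.mem_reverse, List.mem_map, List.mem_filter, List.mem_range,
    decide_eq_true_eq, Finset.mem_range]
  constructor
  · rintro ⟨r, ⟨h1, h2⟩, rfl⟩
    exact ⟨h1, h2, rfl⟩
  · rintro ⟨h1, h2, h3⟩
    exact ⟨rt.1, ⟨h1, h2⟩, by rw [← h3]⟩

lemma length_commonTests (h : Placement D) (ℓ N : ℕ) (p : ℕ × ℕ) :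
    (commonTests h ℓ N p).length =
      ((Finset.range N).filter fun r => slot h ℓ r p.1 = slot h ℓ r p.2).card := by
  rw [commonTests, List.length_reverse, List.length_map, ← List.toFinset_card_of_nodup
    (List.nodup_range.filter _), List.toFinset_filter, List.toFinset_range]
  simp

/-! ### The pre-processing and the lists that it stores -/

namespace RAM

/-- The innermost loop of the pre-processing. -/
def storeTests (h : Placement D) (ℓ i j : ℕ) : RAM Unit :=
  forRange (D.iters ℓ)
    (fun r _ => do
      let a ← readSlot h ℓ r i
      let b ← readSlot h ℓ r j
      if ← eq a b then do
        let l ← readInd ℓ i j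
        let l ← cons (r, a) l
        writeInd ℓ i j l
      else pure ())
    ()

lemma storeTests_spec (h : Placement D) (ℓ i j : ℕ) (s : Memory) (hs : s.ind ℓ i j = []) :
    ((∀ ℓ' i' j', ((storeTests h ℓ i j).memory s).ind ℓ' i' j' =
        if ℓ' = ℓ ∧ i' = i ∧ j' = j then commonTests h ℓ (D.iters ℓ) (i, j)
        else s.ind ℓ' i' j') ∧
      ((storeTests h ℓ i j).memory s).mark = s.mark) ∧
    (storeTests h ℓ i j).steps s ≤ 1 + D.iters ℓ * 8 := by
  have := forRange_spec
    (fun m (_ : Unit) s' => (∀ ℓ' i' j', s'.ind ℓ' i' j' =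
        if ℓ' = ℓ ∧ i' = i ∧ j' = j then commonTests h ℓ m (i, j) else s.ind ℓ' i' j') ∧
      s'.mark = s.mark)
    (fun _ => 6)
    (fun r _ => do
      let a ← readSlot h ℓ r i
      let b ← readSlot h ℓ r j
      if ← eq a b then do
        let l ← readInd ℓ i j
        let l ← cons (r, a) l
        writeInd ℓ i j l
      else pure ()) (D.iters ℓ) (a := ()) (s := s)
    (by
      rintro m - - s' ⟨hi, hmk⟩
      simp only [memory_bind, steps_bind, result_readSlot, memory_readSlot,
        result_eq, memory_eq, steps_readSlot, steps_eq]
      by_cases hsl : slot h ℓ m i = slot h ℓ m j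
      · simp only [hsl, decide_true, if_true, memory_bind, steps_bind, result_readInd,
          memory_readInd, result_cons, memory_cons, steps_cons, steps_readInd, steps_writeInd,
          mark_writeInd, ind_writeInd]
        refine ⟨⟨fun ℓ' i' j' => ?_, hmk⟩, by omega⟩
        rw [hi, hi]
        split_ifs with hc
        -- The reversal in `commonTests` turns appending `m` to the range into the `cons` of the
        -- program.
        · simp [commonTests, List.range_succ, hsl]
        · simp at *
        · rfl
      · simp only [hsl, decide_false, Bool.false_eq_true, if_false, memory_pure, steps_pure]
        refine ⟨⟨fun ℓ' i' j' => ?_, hmk⟩, by omega⟩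
        rw [hi]
        simp [commonTests, List.range_succ, hsl])
    (by
      refine ⟨fun ℓ' i' j' => ?_, rfl⟩
      split_ifs with hc
      · obtain ⟨rfl, rfl, rfl⟩ := hc
        simpa [commonTests] using hs
      · rfl)
  refine ⟨this.1, this.2.trans ?_⟩
  simp

/-- The second loop of the pre-processing. -/
def storeRow (h : Placement D) (ℓ j : ℕ) : RAM Unit :=
  forRange j (fun i _ => storeTests h ℓ i j) ()

lemma storeRow_spec (h : Placement D) (ℓ j : ℕ) (s : Memory) (hs : ∀ i, s.ind ℓ i j = []) :
    ((∀ ℓ' i' j', ((storeRow h ℓ j).memory s).ind ℓ' i' j' =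
        if ℓ' = ℓ ∧ i' < j ∧ j' = j then commonTests h ℓ (D.iters ℓ) (i', j')
        else s.ind ℓ' i' j') ∧
      ((storeRow h ℓ j).memory s).mark = s.mark) ∧
    (storeRow h ℓ j).steps s ≤ 1 + j * (3 + D.iters ℓ * 8) := by
  have := forRange_spec
    (fun m (_ : Unit) s' => (∀ ℓ' i' j', s'.ind ℓ' i' j' =
        if ℓ' = ℓ ∧ i' < m ∧ j' = j then commonTests h ℓ (D.iters ℓ) (i', j')
        else s.ind ℓ' i' j') ∧
      s'.mark = s.mark)
    (fun _ => 1 + D.iters ℓ * 8)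
    (fun i _ => storeTests h ℓ i j) j (a := ()) (s := s)
    (by
      rintro m - - s' ⟨hi, hmk⟩
      -- The list of `(m, j)` is still empty, as only first indices below `m` have been treated.
      obtain ⟨⟨h1, h2⟩, h3⟩ := storeTests_spec h ℓ m j s' (by rw [hi, if_neg (by simp), hs])
      refine ⟨⟨fun ℓ' i' j' => ?_, h2.trans hmk⟩, h3⟩
      rw [h1, hi]
      by_cases hc : ℓ' = ℓ ∧ i' = m ∧ j' = j
      · obtain ⟨rfl, rfl, rfl⟩ := hc
        simp
      · rw [if_neg hc]
        exact if_congr (by omega) rfl rfl)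
    (by simp)
  refine ⟨this.1, this.2.trans ?_⟩
  simp only [Finset.sum_const, Finset.card_range, smul_eq_mul]
  rw [show 1 + D.iters ℓ * 8 + 2 = 3 + D.iters ℓ * 8 by ring]

/-- The third loop of the pre-processing. -/
def storeLevel (h : Placement D) (ℓ g : ℕ) : RAM Unit :=
  forRange g (fun j _ => storeRow h ℓ j) ()

lemma storeLevel_spec (h : Placement D) (ℓ g : ℕ) (s : Memory) (hs : ∀ i j, s.ind ℓ i j = []) :
    ((∀ ℓ' i' j', ((storeLevel h ℓ g).memory s).ind ℓ' i' j' =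
        if ℓ' = ℓ ∧ i' < j' ∧ j' < g then commonTests h ℓ (D.iters ℓ) (i', j')
        else s.ind ℓ' i' j') ∧
      ((storeLevel h ℓ g).memory s).mark = s.mark) ∧
    (storeLevel h ℓ g).steps s ≤ 1 + g * (3 + g * (3 + D.iters ℓ * 8)) := by
  have := forRange_spec
    (fun m (_ : Unit) s' => (∀ ℓ' i' j', s'.ind ℓ' i' j' =
        if ℓ' = ℓ ∧ i' < j' ∧ j' < m then commonTests h ℓ (D.iters ℓ) (i', j')
        else s.ind ℓ' i' j') ∧
      s'.mark = s.mark)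
    (fun _ => 1 + g * (3 + D.iters ℓ * 8))
    (fun j _ => storeRow h ℓ j) g (a := ()) (s := s)
    (by
      rintro m hm - s' ⟨hi, hmk⟩
      obtain ⟨⟨h1, h2⟩, h3⟩ := storeRow_spec h ℓ m s' (fun i => by rw [hi, if_neg (by simp), hs])
      refine ⟨⟨fun ℓ' i' j' => ?_, h2.trans hmk⟩, h3.trans ?_⟩
      · rw [h1, hi]
        by_cases hc : ℓ' = ℓ ∧ i' < m ∧ j' = m
        · obtain ⟨rfl, h4, rfl⟩ := hc
          simp [h4]
        · rw [if_neg hc]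
          exact if_congr (by omega) rfl rfl
      · gcongr)
    (by simp)
  refine ⟨this.1, this.2.trans ?_⟩
  simp only [Finset.sum_const, Finset.card_range, smul_eq_mul]
  rw [show 1 + g * (3 + D.iters ℓ * 8) + 2 = 3 + g * (3 + D.iters ℓ * 8) by ring]

lemma preprocess_eq (h : Placement D) : preprocess h = forRange (D.depth + 1 - D.lmin)
    (fun s _ => do
      let ℓ ← add D.lmin s
      let g ← pow2 ℓ
      storeLevel h ℓ g) () := rfl

/-- The pre-processing stores, for all pairs of blocks, the list of the tests containing both, and
leaves the flags untouched. -/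
lemma preprocess_spec (h : Placement D) :
    ((∀ ℓ i j, ((preprocess h).memory Memory.init).ind ℓ i j =
        if D.lmin ≤ ℓ ∧ ℓ < D.lmin + (D.depth + 1 - D.lmin) ∧ i < j ∧ j < 2 ^ ℓ
        then commonTests h ℓ (D.iters ℓ) (i, j) else []) ∧
      ((preprocess h).memory Memory.init).mark = Memory.init.mark) ∧
    (preprocess h).steps Memory.init ≤ 1 + ∑ s ∈ Finset.range (D.depth + 1 - D.lmin),
      (1 + (1 + (D.lmin + s) * 3) + (1 + 2 ^ (D.lmin + s) * (3 + 2 ^ (D.lmin + s) *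
        (3 + D.iters (D.lmin + s) * 8))) + 2) := by
  rw [preprocess_eq]
  refine forRange_spec
    (fun m (_ : Unit) s => (∀ ℓ i j, s.ind ℓ i j =
        if D.lmin ≤ ℓ ∧ ℓ < D.lmin + m ∧ i < j ∧ j < 2 ^ ℓ
        then commonTests h ℓ (D.iters ℓ) (i, j) else []) ∧
      s.mark = Memory.init.mark)
    (fun s => (1 + (1 + (D.lmin + s) * 3) + (1 + 2 ^ (D.lmin + s) * (3 + 2 ^ (D.lmin + s) *
        (3 + D.iters (D.lmin + s) * 8))))) _ _ ?_ ?_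
  · rintro m hm - s ⟨hi, hmk⟩
    obtain ⟨g1, g2, g3⟩ := pow2_spec (D.lmin + m) s
    simp only [memory_bind, steps_bind, result_add, memory_add, steps_add, g1, g2]
    obtain ⟨⟨h1, h2⟩, h3⟩ := storeLevel_spec h (D.lmin + m) (2 ^ (D.lmin + m)) s
      (fun i j => by rw [hi, if_neg (by omega)])
    refine ⟨⟨fun ℓ i j => ?_, h2.trans hmk⟩, by omega⟩
    rw [h1, hi]
    by_cases hc : ℓ = D.lmin + m
    · subst hc
      generalize 2 ^ (D.lmin + m) = z
      simp
    · generalize 2 ^ ℓ = z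
      rw [if_neg (by omega)]
      exact if_congr (by omega) rfl rfl
  · refine ⟨fun ℓ i j => ?_, rfl⟩
    rw [if_neg (by omega)]
    rfl

end RAM

end Decoder

/-! ### Outputs and costs of the two decoders -/

section Runs

variable {D : Design} (h : Placement D) (Y : ℕ → ℕ → ℕ → Bool)

/-- The cost of a decoder run in which checking a pair of level `ℓ` takes at most `T ℓ` steps. -/
def decodeCost (T : ℕ → ℕ) : ℕ :=
  (1 + D.lmin * 3) + (1 + 2 ^ D.lmin * (3 * 2 ^ D.lmin + 3)) +
    (1 + ∑ s ∈ Finset.range (D.depth - D.lmin),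
      (3 + (possiblyDefective h Y s).card * (T (D.lmin + s) + 24) + 2)) +
    (1 + (possiblyDefective h Y (D.depth - D.lmin)).card * (T D.depth + 3))

lemma decoder_spec (hD : D.lmin ≤ D.depth) :
    (decoderOutput h Y).toFinset = estimate h Y ∧
      decoderTime h Y ≤ decodeCost h Y fun ℓ => 1 + D.iters ℓ * 6 := by
  have := decode_spec h Y hD (RAM.checkAll h Y) (fun ℓ => 1 + D.iters ℓ * 6) Memory.init
    (fun _ _ _ => rfl) fun ℓ _ p _ _ s _ => checkAll_spec h Y ℓ p s
  rw [decoderOutput, decoderTime, decodeCost]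
  exact this

/-- `Λ` affects the cost only. As a parameter it can be trivial when exactness is claimed for every
placement, and logarithmic when the running time is bounded for most placements. -/
lemma fastDecoder_spec (hD : D.lmin ≤ D.depth) (Λ : ℕ)
    (hΛ : ∀ ℓ ∈ Finset.Icc D.lmin D.depth, ∀ p : ℕ × ℕ, p.1 < p.2 → p.2 < 2 ^ ℓ →
      ((Finset.range (D.iters ℓ)).filter fun r => slot h ℓ r p.1 = slot h ℓ r p.2).card ≤ Λ) :
    (fastDecoderOutput h Y).toFinset = estimate h Y ∧
      fastDecoderTime h Y ≤ decodeCost h Y fun _ => 2 + Λ * 3 := by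
  obtain ⟨⟨h1, h2⟩, -⟩ := RAM.preprocess_spec h
  rw [fastDecoderOutput, fastDecoderTime, decodeCost]
  set s₀ := (RAM.preprocess h).memory Memory.init
  refine decode_spec h Y hD (RAM.checkStored Y) (fun _ => 2 + Λ * 3) s₀
    (fun ℓ i j => by rw [h2]; rfl) fun ℓ hℓ p hp hp' s hs => ?_
  have hind : s.ind ℓ p.1 p.2 = commonTests h ℓ (D.iters ℓ) p := by
    have := Finset.mem_Icc.1 hℓ
    rw [hs, h1, if_pos ⟨this.1, by omega, hp, hp'⟩]
  obtain ⟨c1, c2, c3⟩ := checkStored_spec h Y ℓ p s (by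
    intro rt
    rw [hind, mem_commonTests])
  refine ⟨c1, c2, c3.trans ?_⟩
  rw [hind, length_commonTests]
  have := hΛ ℓ hℓ p hp hp'
  omega

end Runs

open scoped BigOperators

section Uniform

/-! ### Uniform probability on finite types -/

open Classical in
/-- The proportion of the elements of a finite type that satisfy a predicate. -/
noncomputable def unifProb {Ω : Type*} [Fintype Ω] (P : Ω → Prop) : ℝ :=
  𝔼 ω, if P ω then 1 else 0

variable {Ω : Type*} [Fintype Ω]

lemma unifProb_nonneg (P : Ω → Prop) : 0 ≤ unifProb P :=
  Finset.expect_nonneg fun _ _ => by split_ifs <;> norm_num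

lemma unifProb_mono {P Q : Ω → Prop} (h : ∀ ω, P ω → Q ω) : unifProb P ≤ unifProb Q := by
  refine Finset.expect_le_expect fun ω _ => ?_
  by_cases hP : P ω
  · simp [hP, h ω hP]
  · simp only [hP, if_false]
    split_ifs <;> norm_num

lemma unifProb_congr {P Q : Ω → Prop} (h : ∀ ω, P ω ↔ Q ω) : unifProb P = unifProb Q :=
  congrArg unifProb (funext fun ω => propext (h ω))

lemma unifProb_true [Nonempty Ω] : unifProb (fun _ : Ω => True) = 1 := by
  simp [unifProb]

lemma unifProb_le_one [Nonempty Ω] (P : Ω → Prop) : unifProb P ≤ 1 := by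
  rw [← unifProb_true (Ω := Ω)]
  exact unifProb_mono fun _ _ => trivial

lemma unifProb_or_le (P Q : Ω → Prop) :
    unifProb (fun ω => P ω ∨ Q ω) ≤ unifProb P + unifProb Q := by
  rw [unifProb, unifProb, unifProb, ← Finset.expect_add_distrib]
  refine Finset.expect_le_expect fun ω _ => ?_
  by_cases hP : P ω <;> by_cases hQ : Q ω <;> simp [hP, hQ]

lemma unifProb_not [Nonempty Ω] (P : Ω → Prop) : unifProb (fun ω => ¬ P ω) = 1 - unifProb P := by
  rw [← unifProb_true (Ω := Ω), unifProb, unifProb, unifProb, ← Finset.expect_sub_distrib]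
  refine Finset.expect_congr rfl fun ω _ => ?_
  by_cases hP : P ω <;> simp [hP]

/-- Reduces joint survival of two pairs to joint detection, which is easy to bound because it forces
two colocations. -/
lemma unifProb_not_and_not [Nonempty Ω] (P Q : Ω → Prop) :
    unifProb (fun ω => ¬ P ω ∧ ¬ Q ω) =
      1 - unifProb P - unifProb Q + unifProb (fun ω => P ω ∧ Q ω) := by
  rw [← unifProb_true (Ω := Ω), unifProb, unifProb, unifProb, unifProb, unifProb,
    ← Finset.expect_sub_distrib, ← Finset.expect_sub_distrib, ← Finset.expect_add_distrib]
  refine Finset.expect_congr rfl fun ω _ => ?_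
  by_cases hP : P ω <;> by_cases hQ : Q ω <;> simp [hP, hQ]

lemma unifProb_exists_le {ι : Type*} (A : Finset ι) (P : ι → Ω → Prop) :
    unifProb (fun ω => ∃ i ∈ A, P i ω) ≤ ∑ i ∈ A, unifProb (P i) := by
  classical
  induction A using Finset.induction_on with
  | empty => simp [unifProb]
  | insert a A ha ih =>
    rw [Finset.sum_insert ha]
    refine le_trans ?_ (add_le_add_right ih _)
    refine le_trans (unifProb_mono fun ω hω => ?_) (unifProb_or_le _ _)
    simpa using hω

/-- If `P` excludes none but the `Q i`, its probability is at least that of `R` minus those of the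
`R ∧ Q i`. -/
lemma sub_sum_le_unifProb {ι : Type*} (A : Finset ι) (R : Ω → Prop) (Q : ι → Ω → Prop) :
    unifProb R - ∑ i ∈ A, unifProb (fun ω => R ω ∧ Q i ω) ≤
      unifProb (fun ω => R ω ∧ ∀ i ∈ A, ¬ Q i ω) := by
  have h1 := unifProb_exists_le A fun i ω => R ω ∧ Q i ω
  have h2 : unifProb R ≤ unifProb (fun ω => (R ω ∧ ∀ i ∈ A, ¬ Q i ω) ∨
      ∃ i ∈ A, R ω ∧ Q i ω) := by
    refine unifProb_mono fun ω hω => ?_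
    by_cases hc : ∃ i ∈ A, R ω ∧ Q i ω
    · exact Or.inr hc
    · push Not at hc
      exact Or.inl ⟨hω, fun i hi => hc i hi hω⟩
  linarith [unifProb_or_le (fun ω => R ω ∧ ∀ i ∈ A, ¬ Q i ω) fun ω => ∃ i ∈ A, R ω ∧ Q i ω]

/-- Markov's inequality. -/
lemma unifProb_mul_le_expect {f : Ω → ℝ} (hf : ∀ ω, 0 ≤ f ω) (t : ℝ) :
    unifProb (fun ω => t ≤ f ω) * t ≤ 𝔼 ω, f ω := by
  rw [unifProb, Finset.expect_mul]
  refine Finset.expect_le_expect fun ω _ => ?_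
  split_ifs with h
  · simpa using h
  · simpa using hf ω

/-- The bridge from the measure in `law` to the finite averages in which all placement probabilities
are computed. -/
lemma uniformOn_univ_eq_ofReal [MeasurableSpace Ω] [DiscreteMeasurableSpace Ω] [Nonempty Ω]
    (P : Ω → Prop) : uniformOn Set.univ {ω | P ω} = ENNReal.ofReal (unifProb P) := by
  classical
  rw [uniformOn_univ, unifProb, Fintype.expect_eq_sum_div_card, ENNReal.ofReal_div_of_pos
    (by exact_mod_cast Fintype.card_pos), ENNReal.ofReal_natCast]
  congr 1
  rw [Finset.sum_boole, ENNReal.ofReal_natCast]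
  rw [show {ω | P ω} = ((Finset.univ.filter P : Finset Ω) : Set Ω) by ext; simp,
    Measure.count_apply_finset]

/-! ### Resampling one coordinate of a product space -/

section Update

variable {ι : Type*} [Fintype ι] [DecidableEq ι] {X : ι → Type*} [∀ i, Fintype (X i)]
  [∀ i, Nonempty (X i)]

/-- Resampling one coordinate does not change expectations. -/
lemma expect_update (f : (∀ i, X i) → ℝ) (i : ι) :
    𝔼 h, f h = 𝔼 h, 𝔼 x, f (Function.update h i x) := by
  have h1 : 𝔼 z : (∀ i, X i) × X i, f z.1 = 𝔼 z : (∀ i, X i) × X i,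
      f (Function.update z.1 i z.2) := by
    -- Exchanging the coordinate `i` with an independent copy is an involution, so it preserves the
    -- uniform average.
    refine Fintype.expect_equiv
      ⟨fun z => (Function.update z.1 i z.2, z.1 i), fun z => (Function.update z.1 i z.2, z.1 i),
        fun z => by simp, fun z => by simp⟩ _ _ fun z => by simp
  rw [← Finset.univ_product_univ, Finset.expect_product, Finset.expect_product] at h1
  rw [← h1]
  refine Finset.expect_congr rfl fun h _ => ?_
  simp

/-- Conditioning on all coordinates but `i`: a bound uniform in the frozen ones survives averaging.
-/
lemma unifProb_le_of_update {P : (∀ i, X i) → Prop} (i : ι) {ε : ℝ}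
    (h : ∀ g, unifProb (fun x => P (Function.update g i x)) ≤ ε) : unifProb P ≤ ε := by
  rw [unifProb, expect_update _ i]
  exact Finset.expect_le Finset.univ_nonempty fun g _ => h g

/-- A coordinate that is compared with a quantity independent of it. -/
lemma unifProb_and_eq {B T : Type*} [Fintype B] [DecidableEq B] [Fintype T] [Nonempty T]
    (c : B) (P : (B → T) → Prop) (g : (B → T) → T)
    (hP : ∀ y t, P (Function.update y c t) ↔ P y) (hg : ∀ y t, g (Function.update y c t) = g y) :
    unifProb (fun y => P y ∧ y c = g y) = unifProb P / Fintype.card T := by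
  classical
  rw [unifProb, expect_update _ c, unifProb, Finset.expect_div]
  refine Finset.expect_congr rfl fun y _ => ?_
  rw [Fintype.expect_eq_sum_div_card]
  by_cases hy : P y <;> simp [hP, hg, hy]

end Update

/-! ### Independent iterations: product formula, tail bound, second moment -/

section Iterations

variable {Y : Type*} [Fintype Y] {N : ℕ}

lemma expect_prod_apply (g : Y → ℝ) : 𝔼 x : Fin N → Y, ∏ r, g (x r) = (𝔼 y, g y) ^ N := by
  classical
  rw [Finset.expect_pow, Fintype.piFinset_univ]

lemma unifProb_forall (P : Y → Prop) :
    unifProb (fun x : Fin N → Y => ∀ r, P (x r)) = unifProb P ^ N := by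
  classical
  rw [unifProb, unifProb, ← expect_prod_apply]
  refine Finset.expect_congr rfl fun x _ => ?_
  rw [Finset.prod_ite_zero]
  simp

/-- A Chernoff bound for the number of successes. -/
lemma unifProb_le_card_le [Nonempty Y] (P : Y → Prop) [DecidablePred P] (a : ℝ) :
    unifProb (fun x : Fin N → Y => a ≤ (Finset.univ.filter fun r => P (x r)).card) ≤
      Real.exp (2 * (N * unifProb P) - a) := by
  have h1 := unifProb_mul_le_expect (Ω := Fin N → Y)
    (f := fun x => Real.exp ((Finset.univ.filter fun r => P (x r)).card))
    (fun x => (Real.exp_pos _).le) (Real.exp a)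
  have h2 : 𝔼 x : Fin N → Y, Real.exp ((Finset.univ.filter fun r => P (x r)).card) =
      (1 + (Real.exp 1 - 1) * unifProb P) ^ N := by
    have h3 : 1 + (Real.exp 1 - 1) * unifProb P = 𝔼 y, if P y then Real.exp 1 else 1 := by
      rw [unifProb, Finset.mul_expect, ← Fintype.expect_one (M := ℝ) (ι := Y),
        ← Finset.expect_add_distrib]
      refine Finset.expect_congr rfl fun y _ => ?_
      by_cases hy : P y <;> simp [hy]
    rw [h3, ← expect_prod_apply]
    refine Finset.expect_congr rfl fun x _ => ?_
    rw [Finset.prod_ite, Finset.prod_const, Finset.prod_const_one, mul_one, ← Real.exp_nat_mul,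
      mul_one]
  have h4 : (1 + (Real.exp 1 - 1) * unifProb P) ^ N ≤ Real.exp (2 * (N * unifProb P)) := by
    -- The factor 2 comes from e - 1 ≤ 2, after 1 + x ≤ exp x.
    have h5 : 1 + (Real.exp 1 - 1) * unifProb P ≤ Real.exp (2 * unifProb P) := by
      have := Real.add_one_le_exp (2 * unifProb P)
      have := unifProb_nonneg P
      nlinarith [Real.exp_one_lt_d9]
    have h6 : 0 ≤ 1 + (Real.exp 1 - 1) * unifProb P := by
      have := unifProb_nonneg P
      have := Real.one_le_exp (zero_le_one (α := ℝ))
      nlinarith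
    calc _ ≤ Real.exp (2 * unifProb P) ^ N := pow_le_pow_left₀ h6 h5 _
      _ = _ := by rw [← Real.exp_nat_mul]; ring_nf
  rw [Real.exp_sub, le_div_iff₀ (Real.exp_pos _)]
  have h7 : unifProb (fun x : Fin N → Y => a ≤ (Finset.univ.filter fun r => P (x r)).card) =
      unifProb (fun x : Fin N → Y =>
        Real.exp a ≤ Real.exp ((Finset.univ.filter fun r => P (x r)).card)) :=
    unifProb_congr fun x => Real.exp_le_exp.symm
  rw [h7]
  linarith

/-- All factors lie in [0, 1], so exchanging them one at a time makes the error grow only linearly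
in `N`. -/
lemma pow_le_pow_add_mul {u v η : ℝ} (hu : 0 ≤ u) (hu1 : u ≤ 1) (hv : 0 ≤ v) (hv1 : v ≤ 1)
    (hη : 0 ≤ η) (h : u ≤ v + η) (N : ℕ) : u ^ N ≤ v ^ N + N * η := by
  induction N with
  | zero => simp
  | succ N ih =>
    have h1 : 0 ≤ v ^ N := pow_nonneg hv N
    have h2 : v ^ N ≤ 1 := pow_le_one₀ hv hv1
    have h3 : 0 ≤ (N : ℝ) * η := by positivity
    rw [pow_succ, pow_succ]
    push_cast
    nlinarith [mul_le_mul_of_nonneg_right ih hu, mul_le_mul_of_nonneg_left h h1]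

open Classical in
/-- Second moment bound for the number of pairs that are missed by all `N` iterations. -/
lemma unifProb_survivors_le [Nonempty Y] {ι : Type*} (A : Finset ι) (Q : ι → Y → Prop)
    {ρ η t : ℝ} (hη : 0 ≤ η) (ht : 0 < t) (hρ : ∀ p ∈ A, (1 - unifProb (Q p)) ^ N ≤ ρ)
    (hpair : ∀ p ∈ A, ∀ p' ∈ A, p ≠ p' → unifProb (fun y => Q p y ∧ Q p' y) ≤ η) :
    unifProb (fun x : Fin N → Y =>
        ρ * A.card + t ≤ (A.filter fun p => ∀ r, ¬ Q p (x r)).card) ≤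
      (A.card + (A.card : ℝ) ^ 2 * (N * η)) / t ^ 2 := by
  set S : (Fin N → Y) → ℝ := fun x => (A.filter fun p => ∀ r, ¬ Q p (x r)).card with hS
  set a : ι → ℝ := fun p => (1 - unifProb (Q p)) ^ N with ha
  set m : ℝ := ∑ p ∈ A, a p with hm
  have hS' : ∀ x, S x = ∑ p ∈ A, if ∀ r, ¬ Q p (x r) then (1 : ℝ) else 0 := fun x => by
    rw [Finset.sum_boole]
  have hprob : ∀ p, unifProb (fun x : Fin N → Y => ∀ r, ¬ Q p (x r)) = a p := fun p => by
    rw [unifProb_forall fun y => ¬ Q p y, unifProb_not]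
  have hmean : 𝔼 x, S x = m := by
    simp_rw [hS', Finset.expect_sum_comm]
    refine Finset.sum_congr rfl fun p _ => ?_
    rw [← hprob p, unifProb]
    exact Finset.expect_congr rfl fun x _ => by split_ifs <;> rfl
  have hsq : 𝔼 x, S x ^ 2 = ∑ p ∈ A, ∑ p' ∈ A,
      unifProb (fun x : Fin N → Y => (∀ r, ¬ Q p (x r)) ∧ ∀ r, ¬ Q p' (x r)) := by
    simp_rw [hS', sq, Finset.sum_mul_sum, Finset.expect_sum_comm]
    refine Finset.sum_congr rfl fun p _ => Finset.sum_congr rfl fun p' _ => ?_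
    rw [unifProb]
    refine Finset.expect_congr rfl fun x _ => ?_
    by_cases h1 : ∀ r, ¬ Q p (x r) <;> by_cases h2 : ∀ r, ¬ Q p' (x r) <;> simp [h1, h2]
  -- The diagonal contributes at most one per pair, each off-diagonal covariance at most N η.
  have hvar : 𝔼 x, (S x - m) ^ 2 ≤ A.card + (A.card : ℝ) ^ 2 * (N * η) := by
    have h1 : 𝔼 x, (S x - m) ^ 2 = 𝔼 x, S x ^ 2 - m ^ 2 := by
      have h2 : ∀ x, (S x - m) ^ 2 = S x ^ 2 - 2 * m * S x + m ^ 2 := fun x => by ring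
      simp_rw [h2]
      rw [Finset.expect_add_distrib, Finset.expect_sub_distrib, ← Finset.mul_expect, hmean,
        Fintype.expect_const]
      ring
    have h3 : m ^ 2 = ∑ p ∈ A, ∑ p' ∈ A, a p * a p' := by rw [sq, hm, Finset.sum_mul_sum]
    rw [h1, hsq, h3, ← Finset.sum_sub_distrib]
    have h4 : ∀ p ∈ A, ∑ p' ∈ A,
        unifProb (fun x : Fin N → Y => (∀ r, ¬ Q p (x r)) ∧ ∀ r, ¬ Q p' (x r)) -
        ∑ p' ∈ A, a p * a p' ≤ 1 + A.card * (N * η) := by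
      intro p hp
      rw [← Finset.sum_sub_distrib]
      have h5 : ∀ p' ∈ A,
          unifProb (fun x : Fin N → Y => (∀ r, ¬ Q p (x r)) ∧ ∀ r, ¬ Q p' (x r)) - a p * a p' ≤
            (if p = p' then 1 else 0) + N * η := by
        intro p' hp'
        have hq := unifProb_nonneg (Q p)
        have hq' := unifProb_nonneg (Q p')
        have hq1 := unifProb_le_one (Q p)
        have hq1' := unifProb_le_one (Q p')
        have ha0 : 0 ≤ a p * a p' := mul_nonneg (pow_nonneg (by linarith) _)
          (pow_nonneg (by linarith) _)
        have hN : 0 ≤ N * η := by positivity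
        by_cases hpp : p = p'
        · rw [if_pos hpp]
          linarith [unifProb_le_one
            (fun x : Fin N → Y => (∀ r, ¬ Q p (x r)) ∧ ∀ r, ¬ Q p' (x r))]
        · rw [if_neg hpp]
          have h6 : unifProb (fun x : Fin N → Y => (∀ r, ¬ Q p (x r)) ∧ ∀ r, ¬ Q p' (x r)) =
              unifProb (fun y => ¬ Q p y ∧ ¬ Q p' y) ^ N := by
            rw [← unifProb_forall]
            exact unifProb_congr fun x => forall_and.symm
          have h7 := pow_le_pow_add_mul (unifProb_nonneg fun y => ¬ Q p y ∧ ¬ Q p' y)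
            (unifProb_le_one _)
            (v := (1 - unifProb (Q p)) * (1 - unifProb (Q p')))
            (mul_nonneg (by linarith) (by linarith))
            (mul_le_one₀ (by linarith) (by linarith) (by linarith)) hη
            (by
              rw [unifProb_not_and_not]
              -- 1 - a - b + P(both) equals (1 - a)(1 - b) + P(both) - ab, and ab is nonnegative.
              nlinarith [hpair p hp p' hp' hpp, mul_nonneg hq hq'])
            N
          rw [h6, ha]
          simp only
          rw [← mul_pow]
          linarith
      refine (Finset.sum_le_sum h5).trans ?_
      rw [Finset.sum_add_distrib, Finset.sum_ite_eq, if_pos hp, Finset.sum_const, nsmul_eq_mul]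
    refine (Finset.sum_le_sum h4).trans ?_
    rw [Finset.sum_const, nsmul_eq_mul]
    apply le_of_eq
    ring
  have hm_le : m ≤ ρ * A.card := by
    rw [mul_comm, ← nsmul_eq_mul]
    exact Finset.sum_le_card_nsmul _ _ _ hρ
  rw [le_div_iff₀ (by positivity)]
  refine le_trans ?_ hvar
  -- Chebyshev: exceeding an upper bound on the mean by `t` forces a deviation of at least `t` from
  -- the mean.
  refine le_trans (mul_le_mul_of_nonneg_right (unifProb_mono (Q := fun x => t ^ 2 ≤ (S x - m) ^ 2)
    fun x hx => ?_) (by positivity)) (unifProb_mul_le_expect (fun x => sq_nonneg _) _)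
  have : t ≤ S x - m := by linarith
  exact pow_le_pow_left₀ ht.le this 2

end Iterations

end Uniform

section Graph

/-! ### Edge counts of the binomial random graph -/

/-- On this finite type it makes every set of graphs measurable, so that sums over graphs can
replace integrals. -/
instance instMeasurableSingletonClassSimpleGraph (n : ℕ) :
    MeasurableSingletonClass (SimpleGraph (Fin n)) where
  measurableSet_singleton G := by
    have h : MeasurableSet ({G.edgeSet} : Set (Set (Sym2 (Fin n)))) := measurableSet_singleton _
    convert SimpleGraph.measurableEmbedding_edgeSet.measurable h
    ext H
    simp

variable {n : ℕ}

/-- The pairs of vertices, smaller one first. -/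
def vertexPairs (n : ℕ) : Finset (Fin n × Fin n) := Finset.univ.filter fun p => p.1 < p.2

open Classical in
/-- The edges of a graph as ordered pairs. -/
noncomputable def orderedEdges (G : SimpleGraph (Fin n)) : Finset (Fin n × Fin n) :=
  Finset.univ.filter fun p => p.1 < p.2 ∧ G.Adj p.1 p.2

lemma mem_orderedEdges {G : SimpleGraph (Fin n)} {p : Fin n × Fin n} :
    p ∈ orderedEdges G ↔ p.1 < p.2 ∧ G.Adj p.1 p.2 := by
  simp [orderedEdges]

lemma orderedEdges_subset (G : SimpleGraph (Fin n)) : orderedEdges G ⊆ vertexPairs n := by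
  intro p hp
  rw [mem_orderedEdges] at hp
  simp [vertexPairs, hp.1]

lemma card_vertexPairs (n : ℕ) : (vertexPairs n).card = n.choose 2 := by
  have h : (vertexPairs n).card = (Finset.univ.filter fun p : Sym2 (Fin n) => ¬ p.IsDiag).card := by
    refine Finset.card_bij (fun p _ => s(p.1, p.2)) ?_ ?_ ?_
    · intro p hp
      simp only [vertexPairs, Finset.mem_filter, Finset.mem_univ, true_and] at hp
      simpa using hp.ne
    · rintro ⟨a, b⟩ hp ⟨c, d⟩ hp' h
      simp only [vertexPairs, Finset.mem_filter, Finset.mem_univ, true_and] at hp hp'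
      simp only [Sym2.eq_iff] at h
      rcases h with ⟨rfl, rfl⟩ | ⟨rfl, rfl⟩
      · rfl
      · exact absurd hp (not_lt.2 hp'.le)
    · intro z hz
      induction z with
      | h a b =>
        simp only [Finset.mem_filter, Finset.mem_univ, true_and, Sym2.mk_isDiag_iff] at hz
        rcases lt_or_gt_of_ne hz with h | h
        · exact ⟨(a, b), by simpa [vertexPairs] using h, rfl⟩
        · exact ⟨(b, a), by simpa [vertexPairs] using h, Sym2.eq_swap⟩
  rw [h, ← Fintype.card_subtype, Sym2.card_subtype_not_diag, Fintype.card_fin]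

lemma ncard_edgeSet (G : SimpleGraph (Fin n)) : G.edgeSet.ncard = (orderedEdges G).card := by
  rw [← Set.ncard_coe_finset]
  symm
  refine Set.ncard_congr (fun p _ => s(p.1, p.2)) ?_ ?_ ?_
  · intro p hp
    exact (mem_orderedEdges.1 hp).2
  · rintro ⟨a, b⟩ ⟨c, d⟩ hp hp' h
    have h1 := (mem_orderedEdges.1 hp).1
    have h2 := (mem_orderedEdges.1 hp').1
    simp only at h1 h2
    simp only [Sym2.eq_iff] at h
    rcases h with ⟨rfl, rfl⟩ | ⟨rfl, rfl⟩
    · rfl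
    · exact absurd h1 (not_lt.2 h2.le)
  · intro z hz
    induction z with
    | h a b =>
      have hz : G.Adj a b := hz
      rcases lt_or_gt_of_ne hz.ne with h | h
      · exact ⟨(a, b), mem_orderedEdges.2 ⟨h, hz⟩, rfl⟩
      · exact ⟨(b, a), mem_orderedEdges.2 ⟨h, hz.symm⟩, Sym2.eq_swap⟩

lemma binomialRandom_real_singleton (q : unitInterval) (G : SimpleGraph (Fin n)) :
    (SimpleGraph.binomialRandom (Fin n) q).real {G} =
      (q : ℝ) ^ (orderedEdges G).card * (1 - q) ^ (vertexPairs n \ orderedEdges G).card := by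
  rw [measureReal_def, SimpleGraph.binomialRandom_singleton, ncard_edgeSet,
    Finset.card_sdiff_of_subset (orderedEdges_subset G), card_vertexPairs]
  simp [ENNReal.toReal_mul]

/-- A graph is a set of sorted vertex pairs, so sums over graphs become expansions of products over
pairs. -/
lemma sum_graph_eq_sum_powerset (f : Finset (Fin n × Fin n) → ℝ) :
    ∑ G : SimpleGraph (Fin n), f (orderedEdges G) = ∑ S ∈ (vertexPairs n).powerset, f S := by
  refine Finset.sum_bij (fun G _ => orderedEdges G)
    (fun G _ => Finset.mem_powerset.2 (orderedEdges_subset G)) ?_ ?_ fun _ _ => rfl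
  · intro G _ H _ h
    ext a b
    have key : ∀ a b, a < b → (G.Adj a b ↔ H.Adj a b) := by
      intro a b hab
      have := congrArg (fun S => (a, b) ∈ S) h
      simpa [mem_orderedEdges, hab] using this
    rcases lt_trichotomy a b with hab | rfl | hab
    · exact key a b hab
    · simp
    · rw [G.adj_comm, H.adj_comm]
      exact key b a hab
  · intro S hS
    refine ⟨SimpleGraph.fromRel fun a b => (a, b) ∈ S, Finset.mem_univ _, ?_⟩
    ext ⟨a, b⟩
    rw [mem_orderedEdges]
    simp only [SimpleGraph.fromRel_adj]
    have hlt : ∀ a b, (a, b) ∈ S → a < b := fun a b hab => by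
      simpa [vertexPairs] using Finset.mem_powerset.1 hS hab
    constructor
    · rintro ⟨h1, h2, h3 | h3⟩
      · exact h3
      · exact absurd h1 (not_lt.2 (hlt _ _ h3).le)
    · intro h
      exact ⟨hlt _ _ h, (hlt _ _ h).ne, Or.inl h⟩

/-- The generating function of the edge set. -/
lemma sum_binomialRandom_prod (q : unitInterval) (x : Fin n × Fin n → ℝ) :
    ∑ G : SimpleGraph (Fin n), (SimpleGraph.binomialRandom (Fin n) q).real {G} *
      ∏ e ∈ orderedEdges G, x e = ∏ e ∈ vertexPairs n, (q * x e + (1 - q)) := by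
  simp_rw [binomialRandom_real_singleton]
  rw [sum_graph_eq_sum_powerset
    (fun S => (q : ℝ) ^ S.card * (1 - q) ^ (vertexPairs n \ S).card * ∏ e ∈ S, x e),
    Finset.prod_add]
  refine Finset.sum_congr rfl fun S _ => ?_
  rw [Finset.prod_mul_distrib, Finset.prod_const, Finset.prod_const]
  ring

lemma binomialRandom_real_eq_sum (q : unitInterval) (P : SimpleGraph (Fin n) → Prop)
    [DecidablePred P] :
    (SimpleGraph.binomialRandom (Fin n) q).real {G | P G} =
      ∑ G : SimpleGraph (Fin n), (SimpleGraph.binomialRandom (Fin n) q).real {G} *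
        if P G then 1 else 0 := by
  simp_rw [mul_ite, mul_one, mul_zero]
  rw [← Finset.sum_filter, sum_measureReal_singleton]
  congr 1
  ext
  simp

lemma binomialRandom_markov (q : unitInterval) (f : SimpleGraph (Fin n) → ℝ) (hf : ∀ G, 0 ≤ f G)
    (a : ℝ) : (SimpleGraph.binomialRandom (Fin n) q).real {G | a ≤ f G} * a ≤
      ∑ G : SimpleGraph (Fin n), (SimpleGraph.binomialRandom (Fin n) q).real {G} * f G := by
  classical
  rw [binomialRandom_real_eq_sum, Finset.sum_mul]
  refine Finset.sum_le_sum fun G _ => ?_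
  rw [mul_assoc]
  refine mul_le_mul_of_nonneg_left ?_ measureReal_nonneg
  split_ifs with h
  · simpa using h
  · simpa using hf G

/-- Chernoff bound for the number of edges in a given set of pairs. -/
lemma binomialRandom_chernoff (q : unitInterval) (F : Finset (Fin n × Fin n)) {m : ℝ}
    (hF : (q : ℝ) * F.card ≤ 4.2 * m) :
    (SimpleGraph.binomialRandom (Fin n) q).real {G | 6 * m ≤ ((orderedEdges G ∩ F).card : ℝ)} ≤
      Real.exp (-0.3 * m) := by
  have hm : 0 ≤ m := by
    have : 0 ≤ (q : ℝ) * F.card := mul_nonneg q.2.1 (Nat.cast_nonneg _)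
    linarith
  -- Exponential moment at parameter 1/4: the mean contributes 4.2 · 0.2841 m ≤ 1.1933 m to the
  -- exponent, against 6m/4 = 1.5 m from the threshold, which leaves more than the rate 0.3.
  have he : Real.exp (1 / 4) ≤ 1.2841 := by
    by_contra hc
    push Not at hc
    have h1 : Real.exp (1 / 4) ^ 4 = Real.exp 1 := by rw [← Real.exp_nat_mul]; norm_num
    have h2 : (1.2841 : ℝ) ^ 4 < Real.exp (1 / 4) ^ 4 :=
      pow_lt_pow_left₀ hc (by norm_num) (by norm_num)
    have := Real.exp_one_lt_d9
    norm_num at h2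
    linarith
  have h1 := binomialRandom_markov q
    (fun G => ∏ e ∈ orderedEdges G, if e ∈ F then Real.exp (1 / 4) else 1)
    (fun G => Finset.prod_nonneg fun e _ => by split_ifs <;> positivity) (Real.exp (3 / 2 * m))
  rw [sum_binomialRandom_prod] at h1
  have h2 : ∏ e ∈ vertexPairs n, (q * (if e ∈ F then Real.exp (1 / 4) else 1) + (1 - q)) ≤
      Real.exp (1.1933 * m) := by
    have h3 : ∀ e ∈ vertexPairs n, q * (if e ∈ F then Real.exp (1 / 4) else 1) + (1 - q) ≤
        if e ∈ F then Real.exp (q * 0.2841) else 1 := by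
      intro e _
      split_ifs
      · have := Real.add_one_le_exp ((q : ℝ) * 0.2841)
        nlinarith [q.2.1]
      · simp
    refine (Finset.prod_le_prod (fun e _ => ?_) h3).trans ?_
    · have := q.2.1
      have := q.2.2
      have : 0 ≤ 1 - (q : ℝ) := by linarith
      split_ifs <;> positivity
    · rw [Finset.prod_ite, Finset.prod_const_one, mul_one, Finset.prod_const, ← Real.exp_nat_mul,
        Real.exp_le_exp]
      have h4 : ((vertexPairs n).filter (· ∈ F)).card ≤ F.card :=
        Finset.card_le_card fun e he => (Finset.mem_filter.1 he).2
      have h5 : (q : ℝ) * ((vertexPairs n).filter (· ∈ F)).card ≤ q * F.card :=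
        mul_le_mul_of_nonneg_left (by exact_mod_cast h4) q.2.1
      nlinarith
  have h6 : {G : SimpleGraph (Fin n) | 6 * m ≤ ((orderedEdges G ∩ F).card : ℝ)} =
      {G | Real.exp (3 / 2 * m) ≤ ∏ e ∈ orderedEdges G, if e ∈ F then Real.exp (1 / 4) else 1} := by
    ext G
    simp only [Set.mem_ofPred_eq]
    rw [Finset.prod_ite, Finset.prod_const_one, mul_one, Finset.prod_const, ← Real.exp_nat_mul,
      Real.exp_le_exp, Finset.filter_mem_eq_inter]
    constructor <;> intro h <;> linarith
  rw [h6]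
  have h7 : Real.exp (1.1933 * m) ≤ Real.exp (-0.3 * m) * Real.exp (3 / 2 * m) := by
    rw [← Real.exp_add, Real.exp_le_exp]
    linarith
  exact le_of_mul_le_mul_right (h1.trans (h2.trans h7)) (Real.exp_pos _)

/-- Markov bound for the number of edges in a given set of pairs. -/
lemma binomialRandom_card_markov (q : unitInterval) (F : Finset (Fin n × Fin n)) (a : ℝ) :
    (SimpleGraph.binomialRandom (Fin n) q).real {G | a ≤ ((orderedEdges G ∩ F).card : ℝ)} * a ≤
      q * F.card := by
  refine (binomialRandom_markov q (fun G => ((orderedEdges G ∩ F).card : ℝ))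
    (fun G => Nat.cast_nonneg _) a).trans ?_
  -- The indicator of an edge is one minus a product that vanishes exactly when the edge is present,
  -- so the generating function at a 0/1 argument yields its expectation.
  have h1 : ∀ G : SimpleGraph (Fin n), ((orderedEdges G ∩ F).card : ℝ) =
      ∑ e ∈ F, (1 - ∏ e' ∈ orderedEdges G, if e' = e then 0 else 1) := by
    intro G
    rw [Finset.inter_comm, ← Finset.filter_mem_eq_inter, Finset.card_filter]
    push_cast
    refine Finset.sum_congr rfl fun e _ => ?_
    by_cases he : e ∈ orderedEdges G
    · rw [if_pos he, Finset.prod_eq_zero he (by simp)]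
      simp
    · rw [if_neg he, Finset.prod_eq_one fun e' he' =>
        if_neg fun hc : e' = e => he (hc ▸ he')]
      simp
  have h2 : ∀ e : Fin n × Fin n, ∑ G : SimpleGraph (Fin n),
      (SimpleGraph.binomialRandom (Fin n) q).real {G} *
        (1 - ∏ e' ∈ orderedEdges G, if e' = e then (0 : ℝ) else 1) ≤ q := by
    intro e
    simp_rw [mul_sub]
    rw [Finset.sum_sub_distrib, sum_binomialRandom_prod]
    have h3 := sum_binomialRandom_prod (n := n) q fun _ => 1
    simp only [Finset.prod_const_one, mul_one] at h3
    simp only [mul_one, h3]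
    have h4 : ∏ e' ∈ vertexPairs n, ((q : ℝ) * (if e' = e then 0 else 1) + (1 - q)) =
        if e ∈ vertexPairs n then 1 - (q : ℝ) else 1 := by
      rw [← Finset.prod_ite_eq' (vertexPairs n) e fun _ => 1 - (q : ℝ)]
      refine Finset.prod_congr rfl fun e' _ => ?_
      split_ifs <;> simp
    rw [h4]
    have := q.2.1
    split_ifs <;> simp [this]
  simp_rw [h1, Finset.mul_sum]
  rw [Finset.sum_comm, mul_comm, ← nsmul_eq_mul]
  exact Finset.sum_le_card_nsmul _ _ _ fun e _ => h2 e

end Graph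

section Iteration

/-! ### A single iteration: random assignment of blocks to tests -/

variable {B W : ℕ} [NeZero W]

lemma unifProb_colocated {i j : Fin B} (hij : i ≠ j) :
    unifProb (fun y : Fin B → Fin W => y j = y i) = 1 / W := by
  have h := unifProb_and_eq (T := Fin W) j (fun _ => True) (fun y => y i) (fun _ _ => Iff.rfl)
    (fun y t => Function.update_of_ne hij _ _)
  rw [unifProb_true, Fintype.card_fin] at h
  rw [← h]
  exact unifProb_congr fun y => by simp

/-- Each further block joins the test of `i` with an independent probability 1/W, seen by resampling
that block. -/
lemma unifProb_colocated_three {i j c : Fin B} (hij : i ≠ j) (hci : c ≠ i) (hcj : c ≠ j) :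
    unifProb (fun y : Fin B → Fin W => y j = y i ∧ y c = y i) = 1 / W ^ 2 := by
  rw [unifProb_and_eq c (fun y => y j = y i) (fun y => y i)
    (fun y t => by rw [Function.update_of_ne hci.symm, Function.update_of_ne hcj.symm])
    (fun y t => Function.update_of_ne hci.symm _ _), unifProb_colocated hij, Fintype.card_fin]
  field_simp

lemma unifProb_colocated_four {i j c d : Fin B} (hij : i ≠ j) (hci : c ≠ i) (hcj : c ≠ j)
    (hdi : d ≠ i) (hdj : d ≠ j) (hdc : d ≠ c) :
    unifProb (fun y : Fin B → Fin W => (y j = y i ∧ y c = y i) ∧ y d = y i) = 1 / W ^ 3 := by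
  rw [unifProb_and_eq d (fun y => y j = y i ∧ y c = y i) (fun y => y i)
    (fun y t => by rw [Function.update_of_ne hdi.symm, Function.update_of_ne hdj.symm,
      Function.update_of_ne hdc.symm])
    (fun y t => Function.update_of_ne hdi.symm _ _), unifProb_colocated_three hij hci hcj,
    Fintype.card_fin]
  field_simp

/-- Two distinct pairs of blocks are colocated independently of each other. -/
lemma unifProb_colocated_pairs {i j i' j' : Fin B} (hij : i < j) (hij' : i' < j')
    (h : (i, j) ≠ (i', j')) :
    unifProb (fun y : Fin B → Fin W => y j = y i ∧ y j' = y i') = 1 / W ^ 2 := by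
  have key : ∀ c d : Fin B, c ≠ i → c ≠ j → c ≠ d →
      unifProb (fun y : Fin B → Fin W => y j = y i ∧ y c = y d) = 1 / W ^ 2 := by
    intro c d hci hcj hcd
    rw [unifProb_and_eq c (fun y => y j = y i) (fun y => y d)
      (fun y t => by rw [Function.update_of_ne hci.symm, Function.update_of_ne hcj.symm])
      (fun y t => Function.update_of_ne hcd.symm _ _), unifProb_colocated hij.ne, Fintype.card_fin]
    field_simp
  -- Both pairs are sorted and they are distinct, so some block of the second lies outside the
  -- first; this is the one to resample.
  by_cases hj' : j' ≠ i ∧ j' ≠ j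
  · exact key j' i' hj'.1 hj'.2 hij'.ne'
  · have hi' : i' ≠ i ∧ i' ≠ j := by
      simp only [ne_eq, Prod.mk.injEq] at h
      omega
    rw [← key i' j' hi'.1 hi'.2 hij'.ne]
    exact unifProb_congr fun y => and_congr_right fun _ => eq_comm

/-- The probability that one iteration puts two blocks into a common test without edges, given
bounds on the number of edges, of edges inside of a block, and of edges incident to the two
blocks. -/
lemma le_unifProb_colocated_negative {ι : Type*} (E : Finset ι) (s t : ι → Fin B) {i j : Fin B}
    (hij : i ≠ j) (hE : ∀ e ∈ E, ¬ ((s e = i ∨ s e = j) ∧ (t e = i ∨ t e = j))) :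
    1 / (W : ℝ) - ((E.filter fun e => s e = t e).card +
        (E.filter fun e => (s e = i ∨ t e = i)).card +
        (E.filter fun e => (s e = j ∨ t e = j)).card) / (W : ℝ) ^ 2 - E.card / (W : ℝ) ^ 3 ≤
      unifProb (fun y : Fin B → Fin W =>
        y j = y i ∧ ∀ e ∈ E, ¬ (y (s e) = y i ∧ y (t e) = y i)) := by
  -- Union bound over the edges that fall into the common test.
  refine le_trans ?_ (sub_sum_le_unifProb E (fun y : Fin B → Fin W => y j = y i)
    fun e y => y (s e) = y i ∧ y (t e) = y i)
  rw [unifProb_colocated hij, sub_sub]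
  refine sub_le_sub_left ?_ _
  have hW : (0 : ℝ) < W := by exact_mod_cast Nat.pos_of_ne_zero (NeZero.ne W)
  have key : ∀ e ∈ E, unifProb (fun y : Fin B → Fin W =>
      y j = y i ∧ y (s e) = y i ∧ y (t e) = y i) ≤
      ((if s e = t e then 1 else 0) + (if s e = i ∨ t e = i then 1 else 0) +
        (if s e = j ∨ t e = j then 1 else 0)) / (W : ℝ) ^ 2 + 1 / (W : ℝ) ^ 3 := by
    intro e he
    have h0 : (0 : ℝ) ≤ 1 / (W : ℝ) ^ 3 := by positivity
    have three : ∀ c, c ≠ i → c ≠ j → (∀ y : Fin B → Fin W,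
        (y j = y i ∧ y (s e) = y i ∧ y (t e) = y i) → (y j = y i ∧ y c = y i)) →
        unifProb (fun y : Fin B → Fin W => y j = y i ∧ y (s e) = y i ∧ y (t e) = y i) ≤
          1 / (W : ℝ) ^ 2 := by
      intro c hci hcj hc
      rw [← unifProb_colocated_three (W := W) hij hci hcj]
      exact unifProb_mono hc
    -- An edge inside a block, or meeting `i` or `j`, may need only one further colocation; `hE`
    -- guarantees that a third block is involved. Any other edge brings two new distinct blocks.
    by_cases h : s e = t e ∨ (s e = i ∨ t e = i) ∨ (s e = j ∨ t e = j)
    · have h1 : unifProb (fun y : Fin B → Fin W => y j = y i ∧ y (s e) = y i ∧ y (t e) = y i) ≤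
          1 / (W : ℝ) ^ 2 := by
        have := hE e he
        by_cases hs : s e = i ∨ s e = j
        · have ht : ¬ (t e = i ∨ t e = j) := fun hc => this ⟨hs, hc⟩
          push Not at ht
          exact three (t e) ht.1 ht.2 fun y hy => ⟨hy.1, hy.2.2⟩
        · push Not at hs
          exact three (s e) hs.1 hs.2 fun y hy => ⟨hy.1, hy.2.1⟩
      have h2 : (1 : ℝ) ≤ (if s e = t e then 1 else 0) + (if s e = i ∨ t e = i then 1 else 0) +
        (if s e = j ∨ t e = j then 1 else 0) := by
        rcases h with h | h | h
        · rw [if_pos h]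
          split_ifs <;> norm_num
        · rw [if_pos h]
          split_ifs <;> norm_num
        · rw [if_pos h]
          split_ifs <;> norm_num
      have h3 := div_le_div_of_nonneg_right h2 (by positivity : (0 : ℝ) ≤ (W : ℝ) ^ 2)
      linarith
    · push Not at h
      obtain ⟨h1, ⟨h2, h3⟩, h4, h5⟩ := h
      have h6 := unifProb_colocated_four (W := W) hij h2 h4 h3 h5 h1.symm
      have h7 : unifProb (fun y : Fin B → Fin W => y j = y i ∧ y (s e) = y i ∧ y (t e) = y i) =
          1 / (W : ℝ) ^ 3 := by
        rw [← h6]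
        exact unifProb_congr fun y => and_assoc.symm
      rw [h7]
      simp [h1, h2, h3, h4, h5]
  refine (Finset.sum_le_sum key).trans (le_of_eq ?_)
  rw [Finset.sum_add_distrib, ← Finset.sum_div, Finset.sum_add_distrib, Finset.sum_add_distrib,
    Finset.sum_boole, Finset.sum_boole, Finset.sum_boole, Finset.sum_const, nsmul_eq_mul]
  ring

end Iteration

section Levels

/-! ### Blocks, and the events of one level -/

variable {n : ℕ} (D : Design) (G : SimpleGraph (Fin n))

/-- The block of level `ℓ` that contains the vertex `v`. -/
def blockOf (ℓ : ℕ) (v : Fin n) : ℕ := (v : ℕ) / 2 ^ (D.depth - ℓ)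

variable {D} in
lemma blockOf_lt (hn : n ≤ 2 ^ D.depth) {ℓ : ℕ} (hℓ : ℓ ≤ D.depth) (v : Fin n) :
    blockOf D ℓ v < 2 ^ ℓ := by
  refine Nat.div_lt_of_lt_mul ?_
  rw [← pow_add, Nat.sub_add_cancel hℓ]
  exact v.2.trans_le hn

variable {D} in
lemma blockOf_div {ℓ ℓ' : ℕ} (h : ℓ ≤ ℓ') (h' : ℓ' ≤ D.depth) (v : Fin n) :
    blockOf D ℓ' v / 2 ^ (ℓ' - ℓ) = blockOf D ℓ v := by
  rw [blockOf, blockOf, Nat.div_div_eq_div_mul, ← pow_add]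
  congr 2
  omega

lemma blockOf_mono {ℓ : ℕ} {u v : Fin n} (h : u ≤ v) : blockOf D ℓ u ≤ blockOf D ℓ v :=
  Nat.div_le_div_right h

/-- The test of block `j` in the assignment `y` of one iteration. -/
def testOf {B W : ℕ} (y : Fin B → Fin W) (j : ℕ) : ℕ := if hj : j < B then (y ⟨j, hj⟩ : ℕ) else 0

variable {D} in
lemma slot_eq_testOf (h : Placement D) {ℓ : ℕ} (hℓ : ℓ ∈ Finset.Icc D.lmin D.depth)
    (r : Fin (D.iters ℓ)) (j : ℕ) : slot h ℓ r j = testOf (h ⟨ℓ, hℓ⟩ r) j := by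
  rw [slot, dif_pos hℓ, dif_pos r.2, testOf]

/-- The iteration `y` of level `ℓ` puts the pair `p` into a negative test. -/
def Detects (ℓ : ℕ) (p : ℕ × ℕ) (y : Fin (2 ^ ℓ) → Fin D.width) : Prop :=
  testOf y p.2 = testOf y p.1 ∧ ∀ e ∈ orderedEdges G,
    ¬ (testOf y (blockOf D ℓ e.1) = testOf y p.1 ∧ testOf y (blockOf D ℓ e.2) = testOf y p.1)

variable {D} in
-- Expresses exclusion through the independent assignments of single iterations, the form in which
-- product formulas apply.
lemma excluded_iff (h : Placement D) {ℓ : ℕ} (hℓ : ℓ ∈ Finset.Icc D.lmin D.depth) (p : ℕ × ℕ) :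
    Excluded h (outcomes G h) ℓ p ↔
      ∃ r : Fin (D.iters ℓ), Detects D G ℓ p (h ⟨ℓ, hℓ⟩ r) := by
  have key : ∀ r : Fin (D.iters ℓ), (slot h ℓ r p.1 = slot h ℓ r p.2 ∧
      outcomes G h ℓ r (slot h ℓ r p.1) = false) ↔ Detects D G ℓ p (h ⟨ℓ, hℓ⟩ r) := by
    intro r
    rw [Detects, eq_comm]
    refine and_congr (by rw [slot_eq_testOf h hℓ, slot_eq_testOf h hℓ]) ?_
    rw [outcomes, query, decide_eq_false_iff_not]
    simp only [pool, Finset.mem_filter, Finset.mem_univ,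
      true_and, not_exists, not_and, slot_eq_testOf h hℓ]
    constructor
    · intro H e he h1 h2
      exact H e.1 h1 e.2 h2 (mem_orderedEdges.1 he).2
    · intro H u hu v hv huv
      rcases lt_or_gt_of_ne huv.ne with hlt | hlt
      · exact H (u, v) (mem_orderedEdges.2 ⟨hlt, huv⟩) hu hv
      · exact H (v, u) (mem_orderedEdges.2 ⟨hlt, huv.symm⟩) hv hu
  constructor
  · rintro ⟨r, hr, h1⟩
    exact ⟨⟨r, Finset.mem_range.1 hr⟩, (key ⟨r, Finset.mem_range.1 hr⟩).1 h1⟩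
  · rintro ⟨r, hr⟩
    exact ⟨r, Finset.mem_range.2 r.2, (key r).2 hr⟩

/-- Some edge is contained in the union of the two blocks of the pair. -/
def Defective (ℓ : ℕ) (p : ℕ × ℕ) : Prop :=
  ∃ e ∈ orderedEdges G, (blockOf D ℓ e.1 = p.1 ∨ blockOf D ℓ e.1 = p.2) ∧
    (blockOf D ℓ e.2 = p.1 ∨ blockOf D ℓ e.2 = p.2)

variable {D G} in
-- Every test containing both blocks contains the edge, so its outcome is positive.
lemma Defective.not_excluded {h : Placement D} {ℓ : ℕ} (hℓ : ℓ ∈ Finset.Icc D.lmin D.depth)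
    {p : ℕ × ℕ} (hp : Defective D G ℓ p) : ¬ Excluded h (outcomes G h) ℓ p := by
  rw [excluded_iff G h hℓ]
  rintro ⟨r, h1, h2⟩
  obtain ⟨e, he, h3, h4⟩ := hp
  refine h2 e he ⟨?_, ?_⟩
  · rcases h3 with h3 | h3 <;> simp [h3, h1]
  · rcases h4 with h4 | h4 <;> simp [h4, h1]

/-- Pairs of vertices inside of a block of level `ℓ`. -/
def internalPairs (n : ℕ) (D : Design) (ℓ : ℕ) : Finset (Fin n × Fin n) :=
  (vertexPairs n).filter fun e => blockOf D ℓ e.1 = blockOf D ℓ e.2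

/-- Pairs of vertices that meet the block `b` of level `ℓ`. -/
def incidentPairs (n : ℕ) (D : Design) (ℓ b : ℕ) : Finset (Fin n × Fin n) :=
  (vertexPairs n).filter fun e => blockOf D ℓ e.1 = b ∨ blockOf D ℓ e.2 = b

variable {D} in
lemma internalPairs_subset {ℓ : ℕ} (h : D.lmin ≤ ℓ) (h' : ℓ ≤ D.depth) :
    internalPairs n D ℓ ⊆ internalPairs n D D.lmin := by
  intro e he
  simp only [internalPairs, Finset.mem_filter] at he ⊢
  refine ⟨he.1, ?_⟩
  rw [← blockOf_div h h', ← blockOf_div h h', he.2]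

variable {D} in
-- Blocks are nested, so the incidence bound at the coarsest level serves all finer ones.
lemma incidentPairs_subset {ℓ : ℕ} (h : D.lmin ≤ ℓ) (h' : ℓ ≤ D.depth) (b : ℕ) :
    incidentPairs n D ℓ b ⊆ incidentPairs n D D.lmin (b / 2 ^ (ℓ - D.lmin)) := by
  intro e he
  simp only [incidentPairs, Finset.mem_filter] at he ⊢
  refine ⟨he.1, ?_⟩
  rw [← blockOf_div h h', ← blockOf_div h h' e.2]
  rcases he.2 with he | he
  · exact Or.inl (by rw [he])
  · exact Or.inr (by rw [he])

lemma card_block_le (ℓ b : ℕ) :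
    (Finset.univ.filter fun v : Fin n => blockOf D ℓ v = b).card ≤ 2 ^ (D.depth - ℓ) := by
  have h1 : ((Finset.univ.filter fun v : Fin n => blockOf D ℓ v = b).image Fin.val) ⊆
      Finset.Ico (b * 2 ^ (D.depth - ℓ)) ((b + 1) * 2 ^ (D.depth - ℓ)) := by
    intro x hx
    simp only [Finset.mem_image, Finset.mem_filter, Finset.mem_univ, true_and] at hx
    obtain ⟨v, rfl, rfl⟩ := hx
    rw [Finset.mem_Ico]
    exact ⟨Nat.div_mul_le_self _ _, (Nat.div_lt_iff_lt_mul (Nat.two_pow_pos _)).1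
      (Nat.lt_succ_self _)⟩
  have h2 := Finset.card_le_card h1
  rw [Finset.card_image_of_injective _ Fin.val_injective, Nat.card_Ico, ← Nat.sub_mul] at h2
  simpa using h2

lemma card_sigma_block_le (f : Fin n → ℕ) (ℓ : ℕ) :
    (Finset.univ.filter fun e : Fin n × Fin n => blockOf D ℓ e.2 = f e.1).card ≤
      n * 2 ^ (D.depth - ℓ) := by
  rw [Finset.card_filter, Fintype.sum_prod_type]
  calc _ ≤ ∑ _u : Fin n, 2 ^ (D.depth - ℓ) := Finset.sum_le_sum fun u _ => by
        rw [← Finset.card_filter]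
        exact card_block_le D ℓ (f u)
    _ = _ := by simp

lemma card_internalPairs_le (ℓ : ℕ) :
    (internalPairs n D ℓ).card ≤ n * 2 ^ (D.depth - ℓ) := by
  refine le_trans (Finset.card_le_card fun e he => ?_) (card_sigma_block_le D (blockOf D ℓ) ℓ)
  simp only [internalPairs, Finset.mem_filter, Finset.mem_univ, true_and] at he ⊢
  exact he.2.symm

/-- Turn each pair so that its second entry lies in the block; this is injective because the pairs
are sorted. One entry is then free and the other ranges over a block. -/
lemma card_incidentPairs_le (ℓ b : ℕ) :
    (incidentPairs n D ℓ b).card ≤ n * 2 ^ (D.depth - ℓ) := by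
  refine le_trans (Finset.card_le_card_of_injOn
    (fun e => if blockOf D ℓ e.1 = b then (e.2, e.1) else e) ?_ ?_)
    (card_sigma_block_le D (fun _ => b) ℓ)
  · intro e he
    simp only [incidentPairs, Finset.coe_filter, Set.mem_ofPred_eq, Finset.mem_univ,
      true_and] at he ⊢
    split_ifs with hc
    · exact hc
    · tauto
  · rintro ⟨a, b⟩ he ⟨a', b'⟩ he' h
    simp only [incidentPairs, Finset.coe_filter, Set.mem_ofPred_eq, vertexPairs, Finset.mem_filter,
      Finset.mem_univ, true_and] at he he' h
    have h1 := he.1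
    have h2 := he'.1
    split_ifs at h <;> simp only [Prod.mk.injEq] at h ⊢ <;> omega

/-- The properties of the graph on which the analysis of the decoder rests. -/
structure IsTypical (k κ : ℝ) : Prop where
  edges : ((orderedEdges G).card : ℝ) ≤ 2 * k
  incident : ∀ b < 2 ^ D.lmin,
    ((orderedEdges G ∩ incidentPairs n D D.lmin b).card : ℝ) ≤ 6 * √k
  internal_lmin : ((orderedEdges G ∩ internalPairs n D D.lmin).card : ℝ) ≤ 6 * √k
  internal : ∀ ℓ ∈ Finset.Icc D.lmin D.depth,
    ((orderedEdges G ∩ internalPairs n D ℓ).card : ℝ) * 2 ^ ℓ ≤ κ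

variable {D G}

lemma testOf_coe {B W : ℕ} (y : Fin B → Fin W) (j : Fin B) : testOf y j = y j := by
  simp [testOf]

/-- The harmful edges number at most 3 · 6√k, so with W ≥ 27√k the losses are at most 18/27 and
2/729 of the main term 1/W, leaving at least 0.33/W. -/
lemma le_unifProb_detects [NeZero D.width] {k κ : ℝ} (hG : IsTypical D G k κ)
    (hn : n ≤ 2 ^ D.depth) (hk : 0 < k) (hW : 27 * √k ≤ D.width) {ℓ : ℕ}
    (hℓ : ℓ ∈ Finset.Icc D.lmin D.depth) {p : ℕ × ℕ} (hp : p.1 < p.2) (hp' : p.2 < 2 ^ ℓ)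
    (hdef : ¬ Defective D G ℓ p) : 0.33 / (D.width : ℝ) ≤ unifProb (Detects D G ℓ p) := by
  obtain ⟨hℓ1, hℓ2⟩ := Finset.mem_Icc.1 hℓ
  set i : Fin (2 ^ ℓ) := ⟨p.1, hp.trans hp'⟩ with hi
  set j : Fin (2 ^ ℓ) := ⟨p.2, hp'⟩ with hj
  set s : Fin n × Fin n → Fin (2 ^ ℓ) := fun e => ⟨blockOf D ℓ e.1, blockOf_lt hn hℓ2 _⟩ with hs
  set t : Fin n × Fin n → Fin (2 ^ ℓ) := fun e => ⟨blockOf D ℓ e.2, blockOf_lt hn hℓ2 _⟩ with ht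
  have hij : i ≠ j := fun hc => hp.ne (congrArg Fin.val hc)
  have hdet : unifProb (Detects D G ℓ p) = unifProb (fun y : Fin (2 ^ ℓ) → Fin D.width =>
      y j = y i ∧ ∀ e ∈ orderedEdges G, ¬ (y (s e) = y i ∧ y (t e) = y i)) := by
    refine unifProb_congr fun y => ?_
    have e1 : testOf y p.1 = y i := testOf_coe y i
    have e2 : testOf y p.2 = y j := testOf_coe y j
    have e3 : ∀ e : Fin n × Fin n, testOf y (blockOf D ℓ e.1) = y (s e) := fun e =>
      testOf_coe y (s e)
    have e4 : ∀ e : Fin n × Fin n, testOf y (blockOf D ℓ e.2) = y (t e) := fun e =>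
      testOf_coe y (t e)
    simp only [Detects, e1, e2, e3, e4, Fin.val_inj]
  rw [hdet]
  refine le_trans ?_ (le_unifProb_colocated_negative (orderedEdges G) s t hij ?_)
  · have c1 : (((orderedEdges G).filter fun e => s e = t e).card : ℝ) ≤ 6 * √k := by
      refine le_trans ?_ hG.internal_lmin
      norm_cast
      refine Finset.card_le_card fun e he => ?_
      rw [Finset.mem_filter] at he
      refine Finset.mem_inter.2 ⟨he.1, internalPairs_subset hℓ1 hℓ2 ?_⟩
      simp only [internalPairs, Finset.mem_filter]
      exact ⟨orderedEdges_subset G he.1, congrArg Fin.val he.2⟩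
    have c2 : ∀ b : Fin (2 ^ ℓ),
        (((orderedEdges G).filter fun e => s e = b ∨ t e = b).card : ℝ) ≤ 6 * √k := by
      intro b
      have hb : (b : ℕ) / 2 ^ (ℓ - D.lmin) < 2 ^ D.lmin := by
        refine Nat.div_lt_of_lt_mul ?_
        rw [← pow_add, Nat.sub_add_cancel hℓ1]
        exact b.2
      refine le_trans ?_ (hG.incident _ hb)
      norm_cast
      refine Finset.card_le_card fun e he => ?_
      rw [Finset.mem_filter] at he
      refine Finset.mem_inter.2 ⟨he.1, incidentPairs_subset hℓ1 hℓ2 _ ?_⟩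
      simp only [incidentPairs, Finset.mem_filter]
      exact ⟨orderedEdges_subset G he.1, he.2.imp (congrArg Fin.val) (congrArg Fin.val)⟩
    have hr : 0 < √k := Real.sqrt_pos.2 hk
    have hW0 : (0 : ℝ) < D.width := by linarith
    have hkk : √k * √k = k := Real.mul_self_sqrt hk.le
    have h1 := c2 i
    have h2 := c2 j
    have h3 := hG.edges
    have h4 : (18 * √k) / (D.width : ℝ) ^ 2 ≤ (18 / 27) / (D.width : ℝ) := by
      rw [div_le_div_iff₀ (by positivity) hW0]
      nlinarith
    have h5 : 2 * k / (D.width : ℝ) ^ 3 ≤ (2 / 729) / (D.width : ℝ) := by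
      rw [div_le_div_iff₀ (by positivity) hW0]
      have h6 : 729 * k ≤ (D.width : ℝ) ^ 2 := by nlinarith
      nlinarith
    have h7 := div_le_div_of_nonneg_right (add_le_add (add_le_add c1 h1) h2)
      (by positivity : (0 : ℝ) ≤ (D.width : ℝ) ^ 2)
    have h8 := div_le_div_of_nonneg_right h3 (by positivity : (0 : ℝ) ≤ (D.width : ℝ) ^ 3)
    have h9 : 0.33 / (D.width : ℝ) ≤ 1 / (D.width : ℝ) - (18 / 27) / (D.width : ℝ) -
        (2 / 729) / (D.width : ℝ) := by
      rw [← sub_div, ← sub_div]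
      exact div_le_div_of_nonneg_right (by norm_num) hW0.le
    have h10 : 6 * √k + 6 * √k + 6 * √k = 18 * √k := by ring
    rw [h10] at h7
    linarith
  · rintro e he ⟨h1, h2⟩
    refine hdef ⟨e, he, ?_, ?_⟩
    · exact h1.imp (congrArg Fin.val) (congrArg Fin.val)
    · exact h2.imp (congrArg Fin.val) (congrArg Fin.val)

/-- Detection implies colocation, and colocations of distinct pairs are independent even if the
pairs share a block. -/
lemma unifProb_detects_pair_le [NeZero D.width] {ℓ : ℕ} {p p' : ℕ × ℕ} (hp : p.1 < p.2)
    (hp2 : p.2 < 2 ^ ℓ) (hp' : p'.1 < p'.2) (hp2' : p'.2 < 2 ^ ℓ) (hne : p ≠ p') :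
    unifProb (fun y => Detects D G ℓ p y ∧ Detects D G ℓ p' y) ≤ 1 / (D.width : ℝ) ^ 2 := by
  rw [← unifProb_colocated_pairs (W := D.width) (B := 2 ^ ℓ)
    (i := ⟨p.1, hp.trans hp2⟩) (j := ⟨p.2, hp2⟩) (i' := ⟨p'.1, hp'.trans hp2'⟩)
    (j' := ⟨p'.2, hp2'⟩) hp hp' (fun hc => hne ?_)]
  · refine unifProb_mono fun y hy => ⟨?_, ?_⟩
    · have := hy.1.1
      simpa [testOf, hp2, hp.trans hp2, Fin.val_inj] using this
    · have := hy.2.1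
      simpa [testOf, hp2', hp'.trans hp2', Fin.val_inj] using this
  · simp only [Prod.mk.injEq, Fin.mk.injEq] at hc
    exact Prod.ext hc.1 hc.2

open Classical in
/-- The number of defective pairs of a level. -/
lemma card_defective_le {ℓ : ℕ} (A : Finset (ℕ × ℕ))
    (hA : ∀ p ∈ A, p.1 < p.2 ∧ p.2 < 2 ^ ℓ) :
    (A.filter (Defective D G ℓ)).card ≤
      (orderedEdges G).card + (orderedEdges G ∩ internalPairs n D ℓ).card * 2 ^ ℓ := by
  have hsub : A.filter (Defective D G ℓ) ⊆
      ((orderedEdges G).image fun e => (blockOf D ℓ e.1, blockOf D ℓ e.2)) ∪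
      ((orderedEdges G ∩ internalPairs n D ℓ) ×ˢ Finset.range (2 ^ ℓ)).image
        fun z => (min (blockOf D ℓ z.1.1) z.2, max (blockOf D ℓ z.1.1) z.2) := by
    intro p hp
    rw [Finset.mem_filter] at hp
    obtain ⟨hpA, e, he, h1, h2⟩ := hp
    obtain ⟨hlt, hlt'⟩ := hA p hpA
    have hle := blockOf_mono D (ℓ := ℓ) (mem_orderedEdges.1 he).1.le
    rw [Finset.mem_union]
    -- An edge across two blocks determines its defective pair. An edge inside a block makes every
    -- pair with that block defective, hence the factor 2 ^ ℓ.
    by_cases hint : blockOf D ℓ e.1 = blockOf D ℓ e.2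
    · right
      have he' : e ∈ orderedEdges G ∩ internalPairs n D ℓ := by
        simp only [internalPairs, Finset.mem_inter, Finset.mem_filter]
        exact ⟨he, orderedEdges_subset G he, hint⟩
      rw [Finset.mem_image]
      rcases h1 with h1 | h1
      · refine ⟨(e, p.2), Finset.mem_product.2 ⟨he', Finset.mem_range.2 hlt'⟩, ?_⟩
        simp [h1, hlt.le]
      · refine ⟨(e, p.1), Finset.mem_product.2 ⟨he', Finset.mem_range.2 (hlt.trans hlt')⟩, ?_⟩
        simp [h1, hlt.le]
    · left
      rw [Finset.mem_image]
      exact ⟨e, he, Prod.ext (by simp only; omega) (by simp only; omega)⟩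
  refine (Finset.card_le_card hsub).trans ((Finset.card_union_le _ _).trans ?_)
  refine add_le_add Finset.card_image_le (Finset.card_image_le.trans ?_)
  rw [Finset.card_product, Finset.card_range]

end Levels

section Placements

/-! ### Random placements -/

variable {n : ℕ} {D : Design} {G : SimpleGraph (Fin n)}

noncomputable instance : Fintype (Placement D) :=
  inferInstanceAs (Fintype ((ℓ : Finset.Icc D.lmin D.depth) →
    Fin (D.iters ℓ) → Fin (2 ^ (ℓ : ℕ)) → Fin D.width))

instance [NeZero D.width] : Nonempty (Placement D) :=
  inferInstanceAs (Nonempty ((ℓ : Finset.Icc D.lmin D.depth) →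
    Fin (D.iters ℓ) → Fin (2 ^ (ℓ : ℕ)) → Fin D.width))

instance : DiscreteMeasurableSpace (Placement D) := ⟨fun _ => trivial⟩

/-- Replace the assignment of one level. -/
def setLevel (h : Placement D) (i : Finset.Icc D.lmin D.depth)
    (x : Fin (D.iters i) → Fin (2 ^ (i : ℕ)) → Fin D.width) : Placement D :=
  Function.update (β := fun ℓ : Finset.Icc D.lmin D.depth =>
    Fin (D.iters ℓ) → Fin (2 ^ (ℓ : ℕ)) → Fin D.width) h i x

lemma setLevel_same (h : Placement D) (i : Finset.Icc D.lmin D.depth)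
    (x : Fin (D.iters i) → Fin (2 ^ (i : ℕ)) → Fin D.width) : setLevel h i x i = x :=
  Function.update_self (β := fun ℓ : Finset.Icc D.lmin D.depth =>
    Fin (D.iters ℓ) → Fin (2 ^ (ℓ : ℕ)) → Fin D.width) i x h

lemma setLevel_of_ne (h : Placement D) {i j : Finset.Icc D.lmin D.depth} (hij : j ≠ i)
    (x : Fin (D.iters i) → Fin (2 ^ (i : ℕ)) → Fin D.width) : setLevel h i x j = h j :=
  Function.update_of_ne (β := fun ℓ : Finset.Icc D.lmin D.depth =>
    Fin (D.iters ℓ) → Fin (2 ^ (ℓ : ℕ)) → Fin D.width) hij x h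

/-- Conditioning on the assignments of all levels but `i`. -/
lemma unifProb_placement_le [NeZero D.width] {P : Placement D → Prop}
    (i : Finset.Icc D.lmin D.depth) {ε : ℝ}
    (h : ∀ g, unifProb (fun x => P (setLevel g i x)) ≤ ε) : unifProb P ≤ ε :=
  unifProb_le_of_update (X := fun ℓ : Finset.Icc D.lmin D.depth =>
    Fin (D.iters ℓ) → Fin (2 ^ (ℓ : ℕ)) → Fin D.width) i h

/-- The possibly defective pairs depend on the assignments of the previous levels only. -/
lemma possiblyDefective_setLevel (h : Placement D) (i : Finset.Icc D.lmin D.depth)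
    (x : Fin (D.iters i) → Fin (2 ^ (i : ℕ)) → Fin D.width) (s : ℕ) (hs : D.lmin + s ≤ i) :
    possiblyDefective (setLevel h i x) (outcomes G (setLevel h i x)) s =
      possiblyDefective h (outcomes G h) s := by
  induction s with
  | zero => rfl
  | succ s ih =>
    have hi := (Finset.mem_Icc.1 i.2).2
    have hℓ : D.lmin + s ∈ Finset.Icc D.lmin D.depth := Finset.mem_Icc.2 (by omega)
    rw [possiblyDefective, possiblyDefective, ih (by omega)]
    congr 1
    refine Finset.filter_congr fun p _ => not_congr ?_
    rw [excluded_iff G _ hℓ, excluded_iff G _ hℓ, setLevel_of_ne]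
    intro hc
    have := congrArg Subtype.val hc
    simp only at this
    omega

lemma iters_of_lt {ℓ : ℕ} (h : ℓ < D.depth) : D.iters ℓ = D.reps := if_pos h

lemma iters_depth : D.iters D.depth = D.finalRounds * D.reps := if_neg (lt_irrefl _)

lemma card_childPairs_le (p : ℕ × ℕ) : (childPairs p).card ≤ 6 := Finset.card_le_six

open Classical in
/-- The number of nondefective pairs that survive a level, relative to the number of pairs
considered. -/
lemma unifProb_many_survivors_le [NeZero D.width] {k κ : ℝ} (hG : IsTypical D G k κ)
    (hn : n ≤ 2 ^ D.depth) (hk : 0 < k) (hW : 27 * √k ≤ D.width) (hκ : 0 < κ)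
    (hsurv : (1 - 0.33 / (D.width : ℝ)) ^ D.reps ≤ 1 / 12) {s : ℕ} (hs : D.lmin + s < D.depth) :
    unifProb (fun h : Placement D => ((possiblyDefective h (outcomes G h) s).card : ℝ) ≤ 48 * κ ∧
      ((possiblyDefective h (outcomes G h) s).card : ℝ) / 12 + κ ≤
        ((possiblyDefective h (outcomes G h) s).filter fun p =>
          ¬ Defective D G (D.lmin + s) p ∧ ¬ Excluded h (outcomes G h) (D.lmin + s) p).card) ≤
      48 / κ + 48 ^ 2 * (D.reps / (D.width : ℝ) ^ 2) := by
  have hℓ : D.lmin + s ∈ Finset.Icc D.lmin D.depth := Finset.mem_Icc.2 (by omega)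
  -- With the other levels frozen, the set of pairs to be checked is deterministic and this level is
  -- fresh randomness.
  refine unifProb_placement_le ⟨D.lmin + s, hℓ⟩ fun h => ?_
  set A₀ := possiblyDefective h (outcomes G h) s with hA₀
  have hnn : 0 ≤ 48 / κ + 48 ^ 2 * (D.reps / (D.width : ℝ) ^ 2) := by positivity
  have hA₀' : ∀ x, possiblyDefective (setLevel h ⟨D.lmin + s, hℓ⟩ x)
      (outcomes G (setLevel h ⟨D.lmin + s, hℓ⟩ x)) s = A₀ := fun x =>
    possiblyDefective_setLevel h ⟨D.lmin + s, hℓ⟩ x s le_rfl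
  -- The size clause is part of the event so that the second moment bound may assume it; if it
  -- fails, the event is empty.
  by_cases hcard : (A₀.card : ℝ) ≤ 48 * κ
  swap
  · refine le_trans (le_of_eq ?_) hnn
    rw [unifProb]
    refine Finset.expect_eq_zero fun x _ => if_neg ?_
    rw [hA₀']
    exact fun hc => hcard hc.1
  set A := A₀.filter fun p => ¬ Defective D G (D.lmin + s) p with hA
  have hmem : ∀ p ∈ A, p.1 < p.2 ∧ p.2 < 2 ^ (D.lmin + s) := fun p hp =>
    possiblyDefective_lt h _ s p (Finset.mem_filter.1 hp).1
  have hW1 : (1 : ℝ) ≤ D.width := by exact_mod_cast Nat.pos_of_ne_zero (NeZero.ne D.width)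
  have hAcard : (A.card : ℝ) ≤ A₀.card := by exact_mod_cast Finset.card_filter_le _ _
  refine le_trans (unifProb_mono (Q := fun x : Fin (D.iters (D.lmin + s)) →
    Fin (2 ^ (D.lmin + s)) → Fin D.width => 1 / 12 * (A.card : ℝ) + κ ≤
      (A.filter fun p => ∀ r, ¬ Detects D G (D.lmin + s) p (x r)).card) fun x hx => ?_) ?_
  · rw [hA₀'] at hx
    have h1 : (A₀.filter fun p => ¬ Defective D G (D.lmin + s) p ∧
        ¬ Excluded (setLevel h ⟨D.lmin + s, hℓ⟩ x) (outcomes G (setLevel h ⟨D.lmin + s, hℓ⟩ x))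
          (D.lmin + s) p) =
        A.filter fun p => ∀ r, ¬ Detects D G (D.lmin + s) p (x r) := by
      rw [hA, Finset.filter_filter]
      refine Finset.filter_congr fun p _ => and_congr_right fun _ => ?_
      rw [excluded_iff G _ hℓ, setLevel_same, not_exists]
    rw [h1] at hx
    linarith [hx.2]
  -- Deviation t = κ; joint detection costs two colocations, whence η = 1/W².
  · refine (unifProb_survivors_le A (Detects D G (D.lmin + s))
      (η := 1 / (D.width : ℝ) ^ 2) (by positivity) hκ (fun p hp => ?_)
      fun p hp p' hp' hne => ?_).trans ?_
    · obtain ⟨h1, h2⟩ := hmem p hp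
      have h3 := le_unifProb_detects hG hn hk hW hℓ h1 h2 (Finset.mem_filter.1 hp).2
      rw [iters_of_lt hs]
      refine le_trans (pow_le_pow_left₀ ?_ ?_ _) hsurv
      · linarith [unifProb_le_one (Detects D G (D.lmin + s) p)]
      · linarith
    · obtain ⟨h1, h2⟩ := hmem p hp
      obtain ⟨h3, h4⟩ := hmem p' hp'
      exact unifProb_detects_pair_le h1 h2 h3 h4 hne
    · rw [iters_of_lt hs]
      have h1 : (A.card : ℝ) ≤ 48 * κ := hAcard.trans hcard
      have h2 : (A.card : ℝ) ^ 2 ≤ (48 * κ) ^ 2 := pow_le_pow_left₀ (Nat.cast_nonneg _) h1 2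
      have h3 : 0 ≤ (D.reps : ℝ) * (1 / (D.width : ℝ) ^ 2) := by positivity
      calc _ ≤ (48 * κ + (48 * κ) ^ 2 * (D.reps * (1 / (D.width : ℝ) ^ 2))) / κ ^ 2 := by
            gcongr
        _ = _ := by field_simp

open Classical in
/-- If no level has too many survivors, the number of possibly defective pairs stays bounded. -/
lemma card_possiblyDefective_le {k κ : ℝ} (hG : IsTypical D G k κ) (hkκ : k ≤ κ)
    (hlmin : ((2 : ℝ) ^ D.lmin) ^ 2 ≤ 48 * k) {h : Placement D}
    (hgood : ∀ s, D.lmin + s < D.depth →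
      ¬ (((possiblyDefective h (outcomes G h) s).card : ℝ) ≤ 48 * κ ∧
      ((possiblyDefective h (outcomes G h) s).card : ℝ) / 12 + κ ≤
        ((possiblyDefective h (outcomes G h) s).filter fun p =>
          ¬ Defective D G (D.lmin + s) p ∧ ¬ Excluded h (outcomes G h) (D.lmin + s) p).card))
    (s : ℕ) (hs : D.lmin + s ≤ D.depth) :
    ((possiblyDefective h (outcomes G h) s).card : ℝ) ≤ 48 * κ := by
  induction s with
  | zero =>
    have h1 : (possiblyDefective h (outcomes G h) 0).card ≤ (2 ^ D.lmin) ^ 2 := by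
      refine (Finset.card_filter_le _ _).trans ?_
      simp [sq]
    have h2 : ((possiblyDefective h (outcomes G h) 0).card : ℝ) ≤ ((2 : ℝ) ^ D.lmin) ^ 2 := by
      exact_mod_cast h1
    linarith
  | succ s ih =>
    specialize ih (by omega)
    have h2 := lt_of_not_ge fun hc => hgood s (by omega) ⟨ih, hc⟩
    set A := possiblyDefective h (outcomes G h) s with hA
    have hlt := possiblyDefective_lt h (outcomes G h) s
    rw [← hA] at hlt
    have h3 : (possiblyDefective h (outcomes G h) (s + 1)).card ≤
        (A.filter fun p => ¬ Excluded h (outcomes G h) (D.lmin + s) p).card * 6 :=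
      Finset.card_biUnion_le_card_mul _ _ _ fun p _ => card_childPairs_le p
    have h4 : (A.filter fun p => ¬ Excluded h (outcomes G h) (D.lmin + s) p).card ≤
        (A.filter (Defective D G (D.lmin + s))).card +
        (A.filter fun p => ¬ Defective D G (D.lmin + s) p ∧
          ¬ Excluded h (outcomes G h) (D.lmin + s) p).card := by
      refine le_trans (Finset.card_le_card fun p hp => ?_) (Finset.card_union_le _ _)
      simp only [Finset.mem_union, Finset.mem_filter] at hp ⊢
      tauto
    have h5 := card_defective_le (D := D) (G := G) A hlt
    have h6 := hG.edges
    have h7 := hG.internal (D.lmin + s) (Finset.mem_Icc.2 (by omega))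
    have h3' : ((possiblyDefective h (outcomes G h) (s + 1)).card : ℝ) ≤
        (A.filter fun p => ¬ Excluded h (outcomes G h) (D.lmin + s) p).card * 6 := by
      exact_mod_cast h3
    have h4' : ((A.filter fun p => ¬ Excluded h (outcomes G h) (D.lmin + s) p).card : ℝ) ≤
        (A.filter (Defective D G (D.lmin + s))).card +
        (A.filter fun p => ¬ Defective D G (D.lmin + s) p ∧
          ¬ Excluded h (outcomes G h) (D.lmin + s) p).card := by exact_mod_cast h4
    have h5' : ((A.filter (Defective D G (D.lmin + s))).card : ℝ) ≤
      (orderedEdges G).card + (orderedEdges G ∩ internalPairs n D (D.lmin + s)).card *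
        2 ^ (D.lmin + s) := by exact_mod_cast h5
    -- At most 2k + κ ≤ 3κ pairs are defective and fewer than 48κ/12 + κ others survive, so there
    -- are at most 6 (3κ + 4κ + κ) = 48κ children. This fixes the constant 48.
    linarith

/-- All pairs of blocks among `g` blocks. -/
def blockPairs (g : ℕ) : Finset (ℕ × ℕ) :=
  (Finset.range g ×ˢ Finset.range g).filter fun p => p.1 < p.2

lemma mem_blockPairs {g : ℕ} {p : ℕ × ℕ} : p ∈ blockPairs g ↔ p.1 < p.2 ∧ p.2 < g := by
  simp only [blockPairs, Finset.mem_filter, Finset.mem_product, Finset.mem_range]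
  omega

lemma card_blockPairs_le (g : ℕ) : (blockPairs g).card ≤ g ^ 2 :=
  (Finset.card_filter_le _ _).trans (by simp [sq])

/-- The last level excludes all nondefective pairs. -/
lemma unifProb_final_error_le [NeZero D.width] {k κ : ℝ} (hG : IsTypical D G k κ)
    (hD : D.lmin ≤ D.depth) (hn : n ≤ 2 ^ D.depth) (hk : 0 < k) (hW : 27 * √k ≤ D.width) :
    unifProb (fun h : Placement D => ∃ p ∈ blockPairs (2 ^ D.depth),
      ¬ Defective D G D.depth p ∧ ¬ Excluded h (outcomes G h) D.depth p) ≤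
      ((2 : ℝ) ^ D.depth) ^ 2 * (1 - 0.33 / (D.width : ℝ)) ^ (D.finalRounds * D.reps) := by
  have hℓ : D.depth ∈ Finset.Icc D.lmin D.depth := Finset.mem_Icc.2 ⟨hD, le_rfl⟩
  have hW1 : (1 : ℝ) ≤ D.width := by exact_mod_cast Nat.pos_of_ne_zero (NeZero.ne D.width)
  have hq : 0 ≤ 1 - 0.33 / (D.width : ℝ) := by
    rw [sub_nonneg, div_le_one (by linarith)]
    linarith
  -- Union bound over all pairs of leaves, kept or not by the earlier levels, so their history is
  -- irrelevant.
  refine (unifProb_exists_le _ _).trans ?_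
  have h1 : ∀ p ∈ blockPairs (2 ^ D.depth), unifProb (fun h : Placement D =>
      ¬ Defective D G D.depth p ∧ ¬ Excluded h (outcomes G h) D.depth p) ≤
      (1 - 0.33 / (D.width : ℝ)) ^ (D.finalRounds * D.reps) := by
    intro p hp
    obtain ⟨hp1, hp2⟩ := mem_blockPairs.1 hp
    by_cases hdef : Defective D G D.depth p
    · refine le_trans (le_of_eq ?_) (pow_nonneg hq _)
      rw [unifProb]
      exact Finset.expect_eq_zero fun h _ => if_neg fun hc => hc.1 hdef
    · refine unifProb_placement_le ⟨D.depth, hℓ⟩ fun h => ?_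
      refine (unifProb_mono (Q := fun x : Fin (D.iters D.depth) →
        Fin (2 ^ D.depth) → Fin D.width => ∀ r, ¬ Detects D G D.depth p (x r))
        fun x hx => ?_).trans ?_
      · have := hx.2
        rwa [excluded_iff G _ hℓ, setLevel_same, not_exists] at this
      · rw [unifProb_forall fun y => ¬ Detects D G D.depth p y, unifProb_not, iters_depth]
        refine pow_le_pow_left₀ ?_ ?_ _
        · linarith [unifProb_le_one (Detects D G D.depth p)]
        · linarith [le_unifProb_detects hG hn hk hW hℓ hp1 hp2 hdef]
  refine (Finset.sum_le_card_nsmul _ _ _ h1).trans ?_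
  rw [nsmul_eq_mul]
  refine mul_le_mul_of_nonneg_right ?_ (pow_nonneg hq _)
  exact_mod_cast card_blockPairs_le (2 ^ D.depth)

/-- All lists of common tests are short. -/
lemma unifProb_long_list_le [NeZero D.width] (hfin : 1 ≤ D.finalRounds)
    (Λ : ℕ) :
    unifProb (fun h : Placement D => ∃ ℓ ∈ Finset.Icc D.lmin D.depth, ∃ p ∈ blockPairs (2 ^ ℓ),
      Λ < ((Finset.range (D.iters ℓ)).filter fun r => slot h ℓ r p.1 = slot h ℓ r p.2).card) ≤
      (D.depth + 1) * (((2 : ℝ) ^ D.depth) ^ 2 *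
        Real.exp (2 * (D.finalRounds * D.reps / D.width) - Λ)) := by
  classical
  refine (unifProb_exists_le _ _).trans ?_
  have h0 : ∀ ℓ ∈ Finset.Icc D.lmin D.depth, unifProb (fun h : Placement D =>
      ∃ p ∈ blockPairs (2 ^ ℓ), Λ < ((Finset.range (D.iters ℓ)).filter
        fun r => slot h ℓ r p.1 = slot h ℓ r p.2).card) ≤
      ((2 : ℝ) ^ D.depth) ^ 2 * Real.exp (2 * (D.finalRounds * D.reps / D.width) - Λ) := by
    intro ℓ hℓ
    have hℓ2 := (Finset.mem_Icc.1 hℓ).2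
    refine (unifProb_exists_le _ _).trans ?_
    have h1 : ∀ p ∈ blockPairs (2 ^ ℓ), unifProb (fun h : Placement D =>
        Λ < ((Finset.range (D.iters ℓ)).filter
          fun r => slot h ℓ r p.1 = slot h ℓ r p.2).card) ≤
        Real.exp (2 * (D.finalRounds * D.reps / D.width) - Λ) := by
      intro p hp
      obtain ⟨hp1, hp2⟩ := mem_blockPairs.1 hp
      refine unifProb_placement_le ⟨ℓ, hℓ⟩ fun h => ?_
      set i : Fin (2 ^ ℓ) := ⟨p.1, hp1.trans hp2⟩ with hi
      set j : Fin (2 ^ ℓ) := ⟨p.2, hp2⟩ with hj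
      have hij : i ≠ j := fun hc => hp1.ne (congrArg Fin.val hc)
      refine (unifProb_mono (Q := fun x : Fin (D.iters ℓ) → Fin (2 ^ ℓ) → Fin D.width =>
        (Λ : ℝ) ≤ (Finset.univ.filter fun r => x r j = x r i).card) fun x hx => ?_).trans ?_
      · have h2 : ((Finset.range (D.iters ℓ)).filter fun r =>
            slot (setLevel h ⟨ℓ, hℓ⟩ x) ℓ r p.1 = slot (setLevel h ⟨ℓ, hℓ⟩ x) ℓ r p.2) ⊆
            (Finset.univ.filter fun r => x r j = x r i).image Fin.val := by
          intro r hr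
          rw [Finset.mem_filter, Finset.mem_range] at hr
          obtain ⟨hr1, h3⟩ := hr
          refine Finset.mem_image.2 ⟨⟨r, hr1⟩, ?_, rfl⟩
          have h4 := slot_eq_testOf (setLevel h ⟨ℓ, hℓ⟩ x) hℓ ⟨r, hr1⟩
          simp only [setLevel_same] at h4
          rw [h4 p.1, h4 p.2] at h3
          have e1 : testOf (x ⟨r, hr1⟩) p.1 = x ⟨r, hr1⟩ i := testOf_coe _ i
          have e2 : testOf (x ⟨r, hr1⟩) p.2 = x ⟨r, hr1⟩ j := testOf_coe _ j
          rw [e1, e2] at h3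
          simpa using (Fin.val_injective h3).symm
        have h5 := (Finset.card_le_card h2).trans Finset.card_image_le
        exact_mod_cast hx.le.trans h5
      · refine (unifProb_le_card_le (fun y : Fin (2 ^ ℓ) → Fin D.width => y j = y i) Λ).trans ?_
        rw [unifProb_colocated hij, Real.exp_le_exp]
        -- The last level has the most iterations, since it has at least one round.
        have h6 : D.iters ℓ ≤ D.finalRounds * D.reps := by
          rcases hℓ2.lt_or_eq with h7 | rfl
          · rw [iters_of_lt h7]
            exact Nat.le_mul_of_pos_left _ hfin
          · rw [iters_depth]
        have h8 : (D.iters ℓ : ℝ) ≤ D.finalRounds * D.reps := by exact_mod_cast h6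
        have h9 : (D.iters ℓ : ℝ) * (1 / D.width) ≤ D.finalRounds * D.reps / D.width := by
          rw [mul_one_div]
          gcongr
        linarith
    refine (Finset.sum_le_card_nsmul _ _ _ h1).trans ?_
    rw [nsmul_eq_mul]
    refine mul_le_mul_of_nonneg_right ?_ (Real.exp_pos _).le
    have h2 : (blockPairs (2 ^ ℓ)).card ≤ (2 ^ D.depth) ^ 2 :=
      (card_blockPairs_le _).trans (Nat.pow_le_pow_left (Nat.pow_le_pow_right two_pos hℓ2) 2)
    exact_mod_cast h2
  refine (Finset.sum_le_card_nsmul _ _ _ h0).trans ?_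
  rw [nsmul_eq_mul]
  refine mul_le_mul_of_nonneg_right ?_ (by positivity)
  have : (Finset.Icc D.lmin D.depth).card ≤ D.depth + 1 := by simp
  exact_mod_cast this

lemma mem_edgePairs {p : ℕ × ℕ} : p ∈ edgePairs G ↔
    ∃ e ∈ orderedEdges G, ((e.1 : ℕ), (e.2 : ℕ)) = p := by
  simp [edgePairs, orderedEdges]

/-- Endpoints with different parents give a cross pair. Endpoints with the same parent are covered
by the pair of its two children, even if they share a child. -/
lemma exists_mem_childPairs {i j a b : ℕ} (hij : i < j) (hab : a ≤ b)
    (ha : a / 2 = i ∨ a / 2 = j) (hb : b / 2 = i ∨ b / 2 = j) :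
    ∃ c ∈ childPairs (i, j), (a = c.1 ∨ a = c.2) ∧ (b = c.1 ∨ b = c.2) := by
  simp only [childPairs, Finset.mem_insert, Finset.mem_singleton]
  rcases ha with ha | ha <;> rcases hb with hb | hb
  · exact ⟨(2 * i, 2 * i + 1), by simp, by simp only; omega, by simp only; omega⟩
  · refine ⟨(a, b), ?_, Or.inl rfl, Or.inr rfl⟩
    simp only [Prod.mk.injEq]
    omega
  · omega
  · exact ⟨(2 * j, 2 * j + 1), by simp, by simp only; omega, by simp only; omega⟩

/-- Every edge stays inside of the union of some possibly defective pair. -/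
lemma exists_possiblyDefective (hn : n ≤ 2 ^ D.depth) (hlmin : 1 ≤ D.lmin) (h : Placement D)
    {e : Fin n × Fin n} (he : e ∈ orderedEdges G) (s : ℕ) (hs : D.lmin + s ≤ D.depth) :
    ∃ p ∈ possiblyDefective h (outcomes G h) s,
      (blockOf D (D.lmin + s) e.1 = p.1 ∨ blockOf D (D.lmin + s) e.1 = p.2) ∧
      (blockOf D (D.lmin + s) e.2 = p.1 ∨ blockOf D (D.lmin + s) e.2 = p.2) := by
  have hle := fun ℓ => blockOf_mono D (ℓ := ℓ) (mem_orderedEdges.1 he).1.le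
  induction s with
  | zero =>
    have h1 := blockOf_lt hn (show D.lmin ≤ D.depth by omega) e.1
    have h2 := blockOf_lt hn (show D.lmin ≤ D.depth by omega) e.2
    have h3 : 2 ≤ 2 ^ D.lmin := by
      calc 2 = 2 ^ 1 := rfl
        _ ≤ _ := Nat.pow_le_pow_right two_pos hlmin
    have h4 := hle D.lmin
    simp only [possiblyDefective, Finset.mem_filter, Finset.mem_product, Finset.mem_range, add_zero]
    rcases h4.lt_or_eq with h5 | h5
    · exact ⟨(_, _), ⟨⟨h1, h2⟩, h5⟩, Or.inl rfl, Or.inr rfl⟩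
    -- The edge lies inside one block; as `lmin` is positive there is another block to pair it with.
    · by_cases h6 : blockOf D D.lmin e.1 = 0
      · exact ⟨(0, 1), ⟨⟨by omega, by omega⟩, by simp⟩, Or.inl h6, Or.inl (by simp only; omega)⟩
      · refine ⟨(0, blockOf D D.lmin e.1), ⟨⟨by simp, h1⟩, by simp only; omega⟩, Or.inr rfl,
          Or.inr (by simp only; omega)⟩
  | succ s ih =>
    obtain ⟨p, hp, h1, h2⟩ := ih (by omega)
    have hex : ¬ Excluded h (outcomes G h) (D.lmin + s) p :=
      Defective.not_excluded (Finset.mem_Icc.2 (by omega)) ⟨e, he, h1, h2⟩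
    have hlt := possiblyDefective_lt h _ s p hp
    have d1 := blockOf_div (show D.lmin + s ≤ D.lmin + (s + 1) by omega) hs e.1
    have d2 := blockOf_div (show D.lmin + s ≤ D.lmin + (s + 1) by omega) hs e.2
    rw [show D.lmin + (s + 1) - (D.lmin + s) = 1 by omega, pow_one] at d1 d2
    have hle' := hle (D.lmin + (s + 1))
    rw [← d1] at h1
    rw [← d2] at h2
    have hsub : ∀ c ∈ childPairs p, c ∈ possiblyDefective h (outcomes G h) (s + 1) := by
      intro c hc
      rw [possiblyDefective, Finset.mem_biUnion]
      exact ⟨p, Finset.mem_filter.2 ⟨hp, hex⟩, hc⟩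
    obtain ⟨c, hc, hc'⟩ := exists_mem_childPairs hlt.1 hle' h1 h2
    exact ⟨c, hsub c hc, hc'⟩

/-- The estimate is exact if the last level excludes all nondefective pairs. -/
lemma estimate_eq_edgePairs (hn : n ≤ 2 ^ D.depth) (hlmin : 1 ≤ D.lmin) (hD : D.lmin ≤ D.depth)
    {h : Placement D} (hfin : ¬ ∃ p ∈ blockPairs (2 ^ D.depth),
      ¬ Defective D G D.depth p ∧ ¬ Excluded h (outcomes G h) D.depth p) :
    estimate h (outcomes G h) = edgePairs G := by
  -- Blocks of the last level are single vertices, so a defective pair is an edge.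
  have hb : ∀ v : Fin n, blockOf D D.depth v = v := fun v => by simp [blockOf]
  have hd : D.lmin + (D.depth - D.lmin) = D.depth := by omega
  ext p
  rw [mem_edgePairs, estimate, Finset.mem_filter]
  constructor
  · rintro ⟨h1, h2⟩
    have hlt := possiblyDefective_lt h _ _ p h1
    rw [hd] at hlt
    have hdef : Defective D G D.depth p := by
      by_contra hc
      exact hfin ⟨p, mem_blockPairs.2 hlt, hc, h2⟩
    obtain ⟨e, he, h3, h4⟩ := hdef
    have h5 : (e.1 : ℕ) < e.2 := (mem_orderedEdges.1 he).1
    rw [hb] at h3 h4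
    exact ⟨e, he, Prod.ext (by simp only; omega) (by simp only; omega)⟩
  · rintro ⟨e, he, rfl⟩
    obtain ⟨p, hp, h3, h4⟩ := exists_possiblyDefective hn hlmin h he (D.depth - D.lmin) (by omega)
    have hlt := possiblyDefective_lt h _ _ p hp
    rw [hd] at h3 h4
    have hdef : Defective D G D.depth p := ⟨e, he, h3, h4⟩
    have h5 : (e.1 : ℕ) < e.2 := (mem_orderedEdges.1 he).1
    rw [hb] at h3 h4
    have h6 : p = ((e.1 : ℕ), (e.2 : ℕ)) := Prod.ext (by simp only; omega) (by simp only; omega)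
    rw [← h6]
    exact ⟨hp, hdef.not_excluded (Finset.mem_Icc.2 ⟨hD, le_rfl⟩)⟩

end Placements

section Runs

/-! ### Successful runs and their cost -/

variable {n : ℕ} {D : Design}

/-- The relations between the parameters of a design that the analysis uses. -/
structure IsRegular (n : ℕ) (q : unitInterval) (k C₁ Cfin : ℝ) (D : Design) : Prop where
  le_pow_depth : n ≤ 2 ^ D.depth
  pow_depth_le : (2 : ℝ) ^ D.depth ≤ 2 * n
  depth_le : (D.depth : ℝ) + 1 ≤ 4 * Real.log n
  one_le_lmin : 1 ≤ D.lmin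
  lmin_le : D.lmin ≤ D.depth
  le_pow_lmin : √k ≤ 2 ^ D.lmin
  pow_lmin_le : (2 : ℝ) ^ D.lmin ≤ 2 * √k
  le_width : C₁ * √k ≤ D.width
  width_le : (D.width : ℝ) ≤ 2 * (C₁ * √k)
  le_reps : C₁ ^ 2 * √k ≤ D.reps
  reps_le : (D.reps : ℝ) ≤ 2 * (C₁ ^ 2 * √k)
  le_finalRounds : Cfin * Real.log n ≤ D.finalRounds
  finalRounds_le : (D.finalRounds : ℝ) ≤ 2 * (Cfin * Real.log n)
  one_le_log : 1 ≤ Real.log n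
  one_le_sqrt : 1 ≤ √k
  sqrt_le : √k ≤ n
  mul_choose_eq : (q : ℝ) * n.choose 2 = k
  mul_pow_depth_le : (q : ℝ) * (n * 2 ^ D.depth) ≤ 4.2 * k

/-- A successful run: the estimate is correct, there are few possibly defective pairs, and the lists
of common tests are short. -/
structure IsSuccessful (κ : ℝ) (Λ : ℕ) (G : SimpleGraph (Fin n)) (h : Placement D) : Prop where
  estimate_eq : estimate h (outcomes G h) = edgePairs G
  card_le : ∀ s, D.lmin + s ≤ D.depth →
    ((possiblyDefective h (outcomes G h) s).card : ℝ) ≤ 48 * κ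
  list_le : ∀ ℓ ∈ Finset.Icc D.lmin D.depth, ∀ p : ℕ × ℕ, p.1 < p.2 → p.2 < 2 ^ ℓ →
      ((Finset.range (D.iters ℓ)).filter fun r => slot h ℓ r p.1 = slot h ℓ r p.2).card ≤ Λ

variable {q : unitInterval} {k C₁ Cfin κ : ℝ}

lemma IsRegular.sq_sqrt (hR : IsRegular n q k C₁ Cfin D) : √k * √k = k := by
  refine Real.mul_self_sqrt ?_
  by_contra hc
  have := hR.one_le_sqrt
  rw [Real.sqrt_eq_zero_of_nonpos (by linarith)] at this
  linarith

lemma IsRegular.one_le (hR : IsRegular n q k C₁ Cfin D) : 1 ≤ k := by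
  have := hR.sq_sqrt
  nlinarith [hR.one_le_sqrt]

lemma IsRegular.sqrt_le_self (hR : IsRegular n q k C₁ Cfin D) : √k ≤ k := by
  have := hR.sq_sqrt
  nlinarith [hR.one_le_sqrt]

lemma IsRegular.width_pos (hR : IsRegular n q k C₁ Cfin D) (hC : 27 < C₁) : 0 < D.width := by
  have h1 := hR.le_width
  have h2 := hR.one_le_sqrt
  have h3 : (0 : ℝ) < D.width := by nlinarith
  exact_mod_cast h3

/-- A bound on the cost of a decoder run in terms of the number of possibly defective pairs. -/
lemma IsRegular.decodeCost_le (hR : IsRegular n q k C₁ Cfin D) (hκ : k ≤ κ)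
    {h : Placement D} {Y : ℕ → ℕ → ℕ → Bool}
    (hcard : ∀ s, D.lmin + s ≤ D.depth → ((possiblyDefective h Y s).card : ℝ) ≤ 48 * κ)
    (T : ℕ → ℕ) {τ τ' : ℝ} (hτ0 : 0 ≤ τ) (hτ : ∀ ℓ < D.depth, (T ℓ : ℝ) ≤ τ)
    (hτ' : (T D.depth : ℝ) ≤ τ') :
    (decodeCost h Y T : ℝ) ≤ 48 * κ * (4 + 4 * Real.log n * (τ + 25) + τ') := by
  have hk1 := hR.one_le
  have hκ1 : 1 ≤ κ := hk1.trans hκ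
  have hlminle := hR.lmin_le
  have hsum : ∑ s ∈ Finset.range (D.depth - D.lmin),
      ((3 : ℝ) + (possiblyDefective h Y s).card * (T (D.lmin + s) + 24) + 2) ≤
      4 * Real.log n * (48 * κ * (τ + 25)) := by
    have h1 : ∀ s ∈ Finset.range (D.depth - D.lmin),
        ((3 : ℝ) + (possiblyDefective h Y s).card * (T (D.lmin + s) + 24) + 2) ≤
        48 * κ * (τ + 25) := by
      intro s hs
      rw [Finset.mem_range] at hs
      have h2 := hτ (D.lmin + s) (by omega)
      have h3 := hcard s (by omega)
      have h4 : ((possiblyDefective h Y s).card : ℝ) * (T (D.lmin + s) + 24) ≤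
          48 * κ * (τ + 24) := by gcongr
      linarith
    refine (Finset.sum_le_card_nsmul _ _ _ h1).trans ?_
    rw [nsmul_eq_mul, Finset.card_range]
    have h5 : ((D.depth - D.lmin : ℕ) : ℝ) ≤ D.depth := by exact_mod_cast Nat.sub_le _ _
    have h6 := hR.depth_le
    refine mul_le_mul_of_nonneg_right (by linarith) (by positivity)
  have hlast : ((possiblyDefective h Y (D.depth - D.lmin)).card : ℝ) * (T D.depth + 3) ≤
      48 * κ * (τ' + 3) := by
    have h3 := hcard (D.depth - D.lmin) (by omega)
    gcongr
  -- Listing the pairs of the first level is quadratic in the number of blocks, hence of order k.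
  have hg : (2 : ℝ) ^ D.lmin * 2 ^ D.lmin ≤ 4 * κ := by
    have h1 := hR.pow_lmin_le
    have h2 := hR.sq_sqrt
    have h3 := mul_le_mul h1 h1 (by positivity) (by positivity)
    nlinarith
  have hg1 : (2 : ℝ) ≤ 2 ^ D.lmin := by
    calc (2 : ℝ) = 2 ^ 1 := (pow_one _).symm
      _ ≤ _ := pow_le_pow_right₀ (by norm_num) hR.one_le_lmin
  have hlmin : (D.lmin : ℝ) ≤ 2 ^ D.lmin := by exact_mod_cast Nat.lt_two_pow_self.le
  simp only [decodeCost]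
  push_cast
  nlinarith

/-- A check scans O(√k) iterations below the last level and O(√k log n) on it, so the O(log n) lower
levels together obey the same bound as the last one. -/
lemma IsRegular.decoderTime_le (hR : IsRegular n q k C₁ Cfin D) (hC : 27 < C₁) (hfin : 3 < Cfin)
    (hκ : k ≤ κ) {G : SimpleGraph (Fin n)} {h : Placement D} {Λ : ℕ}
    (hS : IsSuccessful κ Λ G h) :
    (decoderTime h (outcomes G h) : ℝ) ≤
      48 * (5 + 4 * (26 + 12 * C₁ ^ 2) + 24 * C₁ ^ 2 * Cfin) * (κ * √k * Real.log n) := by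
  have h0 : (decoderTime h (outcomes G h) : ℝ) ≤ _ :=
    Nat.cast_le.2 (decoder_spec h (outcomes G h) hR.lmin_le).2
  have hr := hR.one_le_sqrt
  have hl := hR.one_le_log
  have hκ0 : 0 ≤ κ := by linarith [hR.one_le]
  refine h0.trans ((hR.decodeCost_le hκ hS.card_le _ (τ := 1 + 12 * C₁ ^ 2 * √k)
    (τ' := 1 + 24 * C₁ ^ 2 * Cfin * (√k * Real.log n)) (by positivity) ?_ ?_).trans ?_)
  · intro ℓ hℓ
    rw [iters_of_lt hℓ]
    push_cast
    linarith [hR.reps_le]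
  · rw [iters_depth]
    push_cast
    have := mul_le_mul hR.finalRounds_le hR.reps_le (by positivity) (by positivity)
    nlinarith
  · have h1 : 1 ≤ √k * Real.log n := by nlinarith
    have h2 : Real.log n ≤ √k * Real.log n := by nlinarith
    have h3 : 4 + 4 * Real.log n * (1 + 12 * C₁ ^ 2 * √k + 25) +
        (1 + 24 * C₁ ^ 2 * Cfin * (√k * Real.log n)) ≤
        (5 + 4 * (26 + 12 * C₁ ^ 2) + 24 * C₁ ^ 2 * Cfin) * (√k * Real.log n) := by
      nlinarith
    calc _ ≤ 48 * κ * ((5 + 4 * (26 + 12 * C₁ ^ 2) + 24 * C₁ ^ 2 * Cfin) *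
          (√k * Real.log n)) := mul_le_mul_of_nonneg_left h3 (by positivity)
      _ = _ := by ring

/-- A check costs O(log n) on each of the O(log n) levels, whence the square. -/
lemma IsRegular.fastDecoderTime_le (hR : IsRegular n q k C₁ Cfin D)
    (hκ : k ≤ κ) {G : SimpleGraph (Fin n)} {h : Placement D} {Λ : ℕ} {c : ℝ} (hc : 0 ≤ c)
    (hΛ : (Λ : ℝ) ≤ c * Real.log n) (hS : IsSuccessful κ Λ G h) :
    (fastDecoderTime h (outcomes G h) : ℝ) ≤
      48 * (6 + 4 * (27 + 3 * c) + 3 * c) * (κ * Real.log n ^ 2) := by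
  have h0 : (fastDecoderTime h (outcomes G h) : ℝ) ≤ _ :=
    Nat.cast_le.2 (fastDecoder_spec h (outcomes G h) hR.lmin_le Λ hS.list_le).2
  have hl := hR.one_le_log
  have hκ0 : 0 ≤ κ := by linarith [hR.one_le]
  refine h0.trans ((hR.decodeCost_le hκ hS.card_le _ (τ := 2 + 3 * (c * Real.log n))
    (τ' := 2 + 3 * (c * Real.log n)) (by positivity) ?_ ?_).trans ?_)
  · intro ℓ hℓ
    push_cast
    linarith
  · push_cast
    linarith
  · have h1 : 1 ≤ Real.log n ^ 2 := one_le_pow₀ hl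
    have h2 : Real.log n ≤ Real.log n ^ 2 := by nlinarith
    have h4 : c * Real.log n ≤ c * Real.log n ^ 2 := mul_le_mul_of_nonneg_left h2 hc
    have h3 : 4 + 4 * Real.log n * (2 + 3 * (c * Real.log n) + 25) +
        (2 + 3 * (c * Real.log n)) ≤
        (6 + 4 * (27 + 3 * c) + 3 * c) * Real.log n ^ 2 := by
      nlinarith
    calc _ ≤ 48 * κ * ((6 + 4 * (27 + 3 * c) + 3 * c) * Real.log n ^ 2) :=
          mul_le_mul_of_nonneg_left h3 (by positivity)
      _ = _ := by ring

/-- One block of `reps` iterations uses O(k) tests; there is one per lower level and O(log n) of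
them at the last. -/
lemma IsRegular.numTests_le (hR : IsRegular n q k C₁ Cfin D) (hC : 27 < C₁) (hfin : 3 < Cfin) :
    (D.numTests : ℝ) ≤ 4 * C₁ ^ 3 * (4 + 2 * Cfin) * (k * Real.log n) := by
  have h1 : D.numTests ≤ (D.depth + 1 + D.finalRounds) * (D.reps * D.width) := by
    rw [Design.numTests, ← Finset.Ico_insert_right hR.lmin_le,
      Finset.sum_insert Finset.right_notMem_Ico, iters_depth]
    have h2 : ∀ ℓ ∈ Finset.Ico D.lmin D.depth, D.iters ℓ * D.width ≤ D.reps * D.width := by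
      intro ℓ hℓ
      rw [iters_of_lt (Finset.mem_Ico.1 hℓ).2]
    have h3 := Finset.sum_le_card_nsmul _ _ _ h2
    rw [smul_eq_mul, Nat.card_Ico] at h3
    have h4 : (D.depth - D.lmin) * (D.reps * D.width) ≤ (D.depth + 1) * (D.reps * D.width) :=
      Nat.mul_le_mul_right _ (by omega)
    rw [add_mul, mul_assoc]
    omega
  have h2 : (D.numTests : ℝ) ≤ (D.depth + 1 + D.finalRounds) * (D.reps * D.width) := by
    exact_mod_cast h1
  refine h2.trans ?_
  have h3 := hR.depth_le
  have h4 := hR.finalRounds_le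
  have h5 := hR.one_le_log
  have h6 := mul_le_mul hR.reps_le hR.width_le (by positivity) (by positivity)
  calc _ ≤ (4 * Real.log n + 2 * (Cfin * Real.log n)) *
        (2 * (C₁ ^ 2 * √k) * (2 * (C₁ * √k))) :=
        mul_le_mul (by linarith) h6 (by positivity) (by positivity)
    _ = 4 * C₁ ^ 3 * (4 + 2 * Cfin) * ((√k * √k) * Real.log n) := by ring
    _ = _ := by rw [hR.sq_sqrt]

lemma sum_four_pow_le (L : ℕ) : ∑ ℓ ∈ Finset.range L, 4 ^ ℓ ≤ 4 ^ L := by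
  induction L with
  | zero => simp
  | succ L ih =>
    rw [Finset.sum_range_succ, pow_succ]
    omega

/-- The numbers of pairs per level are bounded by a geometric series of ratio 4, so the last level
dominates, with O(n²) pairs and O(√k log n) iterations. -/
lemma IsRegular.preprocessTime_le (hR : IsRegular n q k C₁ Cfin D) (hC : 27 < C₁)
    (hfin : 3 < Cfin) (h : Placement D) :
    (preprocessTime h : ℝ) ≤
      4 * (29 + 16 * C₁ ^ 2 + 32 * C₁ ^ 2 * Cfin) * ((n : ℝ) ^ 2 * √k * Real.log n) := by
  have h1 : preprocessTime h ≤ 4 ^ D.depth *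
      (29 + 8 * D.reps + 8 * (D.finalRounds * D.reps)) := by
    refine (RAM.preprocess_spec h).2.trans ?_
    have h2 : ∀ ℓ, (1 + (1 + ℓ * 3) + (1 + 2 ^ ℓ * (3 + 2 ^ ℓ *
        (3 + D.iters ℓ * 8))) + 2) ≤ 4 ^ ℓ * (14 + 8 * D.iters ℓ) := by
      intro ℓ
      have e1 : ℓ < 2 ^ ℓ := Nat.lt_two_pow_self
      have e2 : 4 ^ ℓ = 2 ^ ℓ * 2 ^ ℓ := by rw [← mul_pow]; norm_num
      rw [e2]
      generalize 2 ^ ℓ = z at *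
      nlinarith [Nat.zero_le (z * z * D.iters ℓ)]
    have h3 : ∑ s ∈ Finset.range (D.depth + 1 - D.lmin),
      (1 + (1 + (D.lmin + s) * 3) + (1 + 2 ^ (D.lmin + s) * (3 + 2 ^ (D.lmin + s) *
        (3 + D.iters (D.lmin + s) * 8))) + 2) ≤
        ∑ ℓ ∈ Finset.range (D.depth + 1), 4 ^ ℓ * (14 + 8 * D.iters ℓ) := by
      refine (Finset.sum_le_sum fun s _ => h2 (D.lmin + s)).trans ?_
      rw [← Finset.sum_image (f := fun ℓ => 4 ^ ℓ * (14 + 8 * D.iters ℓ))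
        (g := fun s => D.lmin + s) (fun a _ b _ hab => by simpa using hab)]
      refine Finset.sum_le_sum_of_subset fun ℓ hℓ => ?_
      simp only [Finset.mem_image, Finset.mem_range] at hℓ ⊢
      omega
    have h4 : ∑ ℓ ∈ Finset.range D.depth, 4 ^ ℓ * (14 + 8 * D.iters ℓ) ≤
        4 ^ D.depth * (14 + 8 * D.reps) := by
      refine le_trans (le_of_eq ?_) (Nat.mul_le_mul_right _ (sum_four_pow_le D.depth))
      rw [Finset.sum_mul]
      refine Finset.sum_congr rfl fun ℓ hℓ => ?_
      rw [iters_of_lt (Finset.mem_range.1 hℓ)]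
    rw [Finset.sum_range_succ, iters_depth] at h3
    have h5 : 1 ≤ 4 ^ D.depth := Nat.one_le_pow _ _ (by norm_num)
    nlinarith
  have h2 : (preprocessTime h : ℝ) ≤ 4 ^ D.depth *
      (29 + 8 * D.reps + 8 * (D.finalRounds * D.reps)) := by exact_mod_cast h1
  refine h2.trans ?_
  have hr := hR.one_le_sqrt
  have hl := hR.one_le_log
  have h3 : (4 : ℝ) ^ D.depth ≤ 4 * (n : ℝ) ^ 2 := by
    have h4 := pow_le_pow_left₀ (by positivity) hR.pow_depth_le 2
    calc (4 : ℝ) ^ D.depth = (2 ^ D.depth) ^ 2 := by rw [← pow_mul, mul_comm, pow_mul]; norm_num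
      _ ≤ _ := h4
      _ = _ := by ring
  have h4 := mul_le_mul hR.finalRounds_le hR.reps_le (by positivity) (by positivity)
  have h5 : 29 + 8 * (D.reps : ℝ) + 8 * (D.finalRounds * D.reps) ≤
      (29 + 16 * C₁ ^ 2 + 32 * C₁ ^ 2 * Cfin) * (√k * Real.log n) := by
    have h6 : 1 ≤ √k * Real.log n := by nlinarith
    have h7 : √k ≤ √k * Real.log n := by nlinarith
    have h8 : C₁ ^ 2 * √k ≤ C₁ ^ 2 * (√k * Real.log n) :=
      mul_le_mul_of_nonneg_left h7 (by positivity)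
    nlinarith [hR.reps_le]
  calc _ ≤ 4 * (n : ℝ) ^ 2 * ((29 + 16 * C₁ ^ 2 + 32 * C₁ ^ 2 * Cfin) * (√k * Real.log n)) :=
        mul_le_mul h3 h5 (by positivity) (by positivity)
    _ = _ := by ring

end Runs

section FailureProbability

/-! ### The probability of an unsuccessful run -/

variable {n : ℕ} {D : Design} {q : unitInterval} {k C₁ Cfin κ : ℝ}

instance instIsProbabilityMeasureLaw [NeZero D.width] : IsProbabilityMeasure (law n q D) := by
  unfold law
  infer_instance

/-- Fubini for the independent graph and placement; atypical graphs are charged with conditional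
probability one. -/
lemma law_le [NeZero D.width] (T : SimpleGraph (Fin n) → Prop)
    (P : SimpleGraph (Fin n) → Placement D → Prop) {ε : ℝ}
    (h : ∀ G, T G → unifProb (P G) ≤ ε) :
    law n q D {ω | P ω.1 ω.2} ≤
      SimpleGraph.binomialRandom (Fin n) q {G | ¬ T G} + ENNReal.ofReal ε := by
  classical
  rw [law, Measure.prod_apply (.of_discrete)]
  calc _ ≤ ∫⁻ G, ({G | ¬ T G}.indicator 1 G + ENNReal.ofReal ε)
        ∂(SimpleGraph.binomialRandom (Fin n) q) := by
        refine lintegral_mono fun G => ?_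
        by_cases hT : T G
        · refine le_trans (le_of_eq (uniformOn_univ_eq_ofReal (P G))) ?_
          exact (ENNReal.ofReal_le_ofReal (h G hT)).trans le_add_self
        · rw [Set.indicator_of_mem (by exact hT)]
          exact prob_le_one.trans le_self_add
    _ = _ := by
        rw [lintegral_add_right _ measurable_const, lintegral_indicator_one .of_discrete]
        simp

/-- The probability that the graph is not typical. -/
lemma IsRegular.not_isTypical_le (hR : IsRegular n q k C₁ Cfin D) {ε : ℝ}
    (hint : (SimpleGraph.binomialRandom (Fin n) q).real {G | ∃ ℓ ∈ Finset.Icc D.lmin D.depth,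
      κ < ((orderedEdges G ∩ internalPairs n D ℓ).card : ℝ) * 2 ^ ℓ} ≤ ε) :
    (SimpleGraph.binomialRandom (Fin n) q).real {G | ¬ IsTypical D G k κ} ≤
      Real.exp (-0.3 * (k / 3)) + 2 * √k * Real.exp (-0.3 * √k) + Real.exp (-0.3 * √k) + ε := by
  set μ := SimpleGraph.binomialRandom (Fin n) q
  have hk := hR.one_le
  -- Restricting to one block of level `lmin` divides the bound 4.2 k by 2 ^ lmin ≥ √k; it bounds
  -- the mean numbers of incident and of internal edges.
  have hlocal : (q : ℝ) * (n * 2 ^ (D.depth - D.lmin) : ℕ) ≤ 4.2 * √k := by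
    have h1 := hR.mul_pow_depth_le
    have h2 : (2 : ℝ) ^ D.depth = 2 ^ (D.depth - D.lmin) * 2 ^ D.lmin := by
      rw [← pow_add, Nat.sub_add_cancel hR.lmin_le]
    rw [h2, ← hR.sq_sqrt] at h1
    push_cast
    have h3 := hR.le_pow_lmin
    have h4 := hR.one_le_sqrt
    have h5 : 0 ≤ (q : ℝ) * (n * 2 ^ (D.depth - D.lmin)) :=
      mul_nonneg q.2.1 (by positivity)
    have h6 := mul_le_mul_of_nonneg_left h3 h5
    refine le_of_mul_le_mul_right ?_ (by linarith : 0 < √k)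
    linarith
  have chern : ∀ F : Finset (Fin n × Fin n), F.card ≤ n * 2 ^ (D.depth - D.lmin) →
      μ.real {G | 6 * √k ≤ ((orderedEdges G ∩ F).card : ℝ)} ≤ Real.exp (-0.3 * √k) := by
    intro F hF
    refine binomialRandom_chernoff q F (le_trans ?_ hlocal)
    exact mul_le_mul_of_nonneg_left (by exact_mod_cast hF) q.2.1
  have hsub : {G | ¬ IsTypical D G k κ} ⊆
      {G | 6 * (k / 3) ≤ ((orderedEdges G ∩ vertexPairs n).card : ℝ)} ∪
      (⋃ b ∈ Finset.range (2 ^ D.lmin),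
        {G | 6 * √k ≤ ((orderedEdges G ∩ incidentPairs n D D.lmin b).card : ℝ)}) ∪
      {G | 6 * √k ≤ ((orderedEdges G ∩ internalPairs n D D.lmin).card : ℝ)} ∪
      {G | ∃ ℓ ∈ Finset.Icc D.lmin D.depth,
        κ < ((orderedEdges G ∩ internalPairs n D ℓ).card : ℝ) * 2 ^ ℓ} := by
    intro G hG
    by_contra hc
    simp only [Set.mem_union, Set.mem_ofPred_eq, Set.mem_iUnion, Finset.mem_range, not_or,
      not_exists, not_and, not_lt, not_le] at hc
    obtain ⟨⟨⟨h1, h2⟩, h3⟩, h4⟩ := hc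
    refine hG ⟨?_, fun b hb => ?_, h3.le, h4⟩
    · rw [Finset.inter_eq_left.2 (orderedEdges_subset G)] at h1
      linarith
    · exact (h2 b hb).le
  -- Here m = k/3: the threshold is 6m = 2k and the mean k = 3m is below 4.2 m.
  have hA : μ.real {G | 6 * (k / 3) ≤ ((orderedEdges G ∩ vertexPairs n).card : ℝ)} ≤
      Real.exp (-0.3 * (k / 3)) := by
    refine binomialRandom_chernoff q _ ?_
    rw [card_vertexPairs, hR.mul_choose_eq]
    linarith
  have hB : μ.real (⋃ b ∈ Finset.range (2 ^ D.lmin),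
        {G | 6 * √k ≤ ((orderedEdges G ∩ incidentPairs n D D.lmin b).card : ℝ)}) ≤
      2 * √k * Real.exp (-0.3 * √k) := by
    refine (measureReal_biUnion_finset_le _ _).trans ?_
    refine (Finset.sum_le_card_nsmul _ _ _ fun b _ =>
      chern _ (card_incidentPairs_le D D.lmin b)).trans ?_
    rw [nsmul_eq_mul, Finset.card_range]
    refine mul_le_mul_of_nonneg_right ?_ (Real.exp_pos _).le
    exact_mod_cast hR.pow_lmin_le
  have hC := chern _ (card_internalPairs_le D D.lmin)
  refine (measureReal_mono hsub (measure_ne_top _ _)).trans ?_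
  refine (measureReal_union_le _ _).trans (add_le_add ?_ hint)
  refine (measureReal_union_le _ _).trans (add_le_add ?_ hC)
  exact (measureReal_union_le _ _).trans (add_le_add hA hB)

/-- Edges inside of blocks, dense case. -/
lemma IsRegular.internal_dense (hR : IsRegular n q k C₁ Cfin D) :
    (SimpleGraph.binomialRandom (Fin n) q).real {G | ∃ ℓ ∈ Finset.Icc D.lmin D.depth,
      6 * k < ((orderedEdges G ∩ internalPairs n D ℓ).card : ℝ) * 2 ^ ℓ} ≤
      4 * Real.log n * Real.exp (-0.15 * (k / n)) := by
  have hk := hR.one_le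
  have hn : (0 : ℝ) < n := by
    have := hR.sqrt_le
    have := hR.one_le_sqrt
    linarith
  have hsub : {G | ∃ ℓ ∈ Finset.Icc D.lmin D.depth,
      6 * k < ((orderedEdges G ∩ internalPairs n D ℓ).card : ℝ) * 2 ^ ℓ} ⊆
      ⋃ ℓ ∈ Finset.Icc D.lmin D.depth,
        {G | 6 * (k / 2 ^ ℓ) ≤ ((orderedEdges G ∩ internalPairs n D ℓ).card : ℝ)} := by
    rintro G ⟨ℓ, hℓ, h⟩
    refine Set.mem_biUnion hℓ ?_
    rw [Set.mem_ofPred_eq, ← mul_div_assoc, div_le_iff₀ (by positivity)]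
    exact h.le
  refine (measureReal_mono hsub (measure_ne_top _ _)).trans
    ((measureReal_biUnion_finset_le _ _).trans ?_)
  have h1 : ∀ ℓ ∈ Finset.Icc D.lmin D.depth, (SimpleGraph.binomialRandom (Fin n) q).real
      {G | 6 * (k / 2 ^ ℓ) ≤ ((orderedEdges G ∩ internalPairs n D ℓ).card : ℝ)} ≤
      Real.exp (-0.15 * (k / n)) := by
    intro ℓ hℓ
    have hℓ2 := (Finset.mem_Icc.1 hℓ).2
    refine (binomialRandom_chernoff q _ ?_).trans ?_
    · have h2 : ((internalPairs n D ℓ).card : ℝ) ≤ n * 2 ^ (D.depth - ℓ) := by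
        exact_mod_cast card_internalPairs_le D ℓ
      have h3 : (2 : ℝ) ^ D.depth = 2 ^ (D.depth - ℓ) * 2 ^ ℓ := by
        rw [← pow_add, Nat.sub_add_cancel hℓ2]
      have h4 := hR.mul_pow_depth_le
      rw [h3] at h4
      have h5 := mul_le_mul_of_nonneg_left h2 q.2.1
      refine h5.trans ?_
      rw [← mul_div_assoc, le_div_iff₀ (by positivity)]
      linarith
    · rw [Real.exp_le_exp]
      -- The rate is weakest at the last level, where 2 ^ ℓ may be as large as 2n.
      have h2 : k / (2 * n) ≤ k / 2 ^ ℓ := by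
        gcongr
        exact (pow_le_pow_right₀ (by norm_num) hℓ2).trans hR.pow_depth_le
      have h3 : k / (2 * n) = (k / n) / 2 := by field_simp
      rw [h3] at h2
      linarith
  refine (Finset.sum_le_card_nsmul _ _ _ h1).trans ?_
  rw [nsmul_eq_mul]
  refine mul_le_mul_of_nonneg_right ?_ (Real.exp_pos _).le
  refine le_trans ?_ hR.depth_le
  have : (Finset.Icc D.lmin D.depth).card ≤ D.depth + 1 := by simp
  exact_mod_cast this

/-- Edges inside of blocks, general case. -/
lemma IsRegular.internal_sparse (hR : IsRegular n q k C₁ Cfin D) (hκ : 0 < κ) :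
    (SimpleGraph.binomialRandom (Fin n) q).real {G | ∃ ℓ ∈ Finset.Icc D.lmin D.depth,
      κ < ((orderedEdges G ∩ internalPairs n D ℓ).card : ℝ) * 2 ^ ℓ} ≤
      4 * Real.log n * (4.2 * k / κ) := by
  have hk := hR.one_le
  have hsub : {G | ∃ ℓ ∈ Finset.Icc D.lmin D.depth,
      κ < ((orderedEdges G ∩ internalPairs n D ℓ).card : ℝ) * 2 ^ ℓ} ⊆
      ⋃ ℓ ∈ Finset.Icc D.lmin D.depth,
        {G | κ / 2 ^ ℓ ≤ ((orderedEdges G ∩ internalPairs n D ℓ).card : ℝ)} := by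
    rintro G ⟨ℓ, hℓ, h⟩
    refine Set.mem_biUnion hℓ ?_
    rw [Set.mem_ofPred_eq, div_le_iff₀ (by positivity)]
    exact h.le
  refine (measureReal_mono hsub (measure_ne_top _ _)).trans
    ((measureReal_biUnion_finset_le _ _).trans ?_)
  have h1 : ∀ ℓ ∈ Finset.Icc D.lmin D.depth, (SimpleGraph.binomialRandom (Fin n) q).real
      {G | κ / 2 ^ ℓ ≤ ((orderedEdges G ∩ internalPairs n D ℓ).card : ℝ)} ≤ 4.2 * k / κ := by
    intro ℓ hℓ
    have hℓ2 := (Finset.mem_Icc.1 hℓ).2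
    -- Markov only: at deep levels the mean may be too small for a useful exponential bound.
    have h0 := binomialRandom_card_markov q (internalPairs n D ℓ) (κ / 2 ^ ℓ)
    have h2 : ((internalPairs n D ℓ).card : ℝ) ≤ n * 2 ^ (D.depth - ℓ) := by
      exact_mod_cast card_internalPairs_le D ℓ
    have h3 : (2 : ℝ) ^ D.depth = 2 ^ (D.depth - ℓ) * 2 ^ ℓ := by
      rw [← pow_add, Nat.sub_add_cancel hℓ2]
    have h4 := hR.mul_pow_depth_le
    rw [h3] at h4
    have h5 := mul_le_mul_of_nonneg_left h2 q.2.1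
    have h6 := h0.trans h5
    rw [← mul_div_assoc, div_le_iff₀ (by positivity)] at h6
    rw [le_div_iff₀ hκ]
    linarith
  refine (Finset.sum_le_card_nsmul _ _ _ h1).trans ?_
  rw [nsmul_eq_mul]
  refine mul_le_mul_of_nonneg_right ?_ (by positivity)
  refine le_trans ?_ hR.depth_le
  have : (Finset.Icc D.lmin D.depth).card ≤ D.depth + 1 := by simp
  exact_mod_cast this

lemma IsRegular.one_le_natCast (hR : IsRegular n q k C₁ Cfin D) : (1 : ℝ) ≤ n :=
  hR.one_le_sqrt.trans hR.sqrt_le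

lemma IsRegular.sqrt_le_width (hR : IsRegular n q k C₁ Cfin D) (hC : 27 < C₁) :
    27 * √k ≤ D.width := by
  nlinarith [hR.one_le_sqrt, hR.le_width]

lemma IsRegular.survival_base_nonneg (hR : IsRegular n q k C₁ Cfin D) (hC : 27 < C₁) :
    0 ≤ 1 - 0.33 / (D.width : ℝ) := by
  have := hR.sqrt_le_width hC
  have := hR.one_le_sqrt
  rw [sub_nonneg, div_le_one (by linarith)]
  linarith

/-- The probability that a nondefective pair survives `reps` iterations. -/
lemma IsRegular.survival_le (hR : IsRegular n q k C₁ Cfin D) (hC : 27 < C₁) :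
    (1 - 0.33 / (D.width : ℝ)) ^ D.reps ≤ Real.exp (-3) := by
  have hr := hR.one_le_sqrt
  have hW0 : (0 : ℝ) < D.width := by linarith [hR.sqrt_le_width hC]
  have h1 : 1 - 0.33 / (D.width : ℝ) ≤ Real.exp (-(0.33 / (D.width : ℝ))) := by
    have := Real.add_one_le_exp (-(0.33 / (D.width : ℝ)))
    linarith
  refine (pow_le_pow_left₀ (hR.survival_base_nonneg hC) h1 _).trans ?_
  rw [← Real.exp_nat_mul, Real.exp_le_exp]
  -- The product is at least 0.33 C₁² / (2 C₁) = 0.165 C₁ > 4, where the 2 pays for rounding up the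
  -- width.
  have h2 : 3 ≤ (D.reps : ℝ) * (0.33 / (D.width : ℝ)) := by
    rw [← mul_div_assoc, le_div_iff₀ hW0]
    have h3 := hR.width_le
    have h4 := hR.le_reps
    have h5 : 0 < C₁ * √k := by positivity
    nlinarith
  linarith

lemma exp_neg_three_le : Real.exp (-3) ≤ 1 / 12 := by
  rw [Real.exp_neg, ← one_div]
  refine one_div_le_one_div_of_le (by norm_num) ?_
  have h1 := Real.exp_one_gt_d9
  have h2 : Real.exp 3 = Real.exp 1 ^ 3 := by rw [← Real.exp_nat_mul]; norm_num
  rw [h2]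
  have h3 : (2.7 : ℝ) ^ 3 ≤ Real.exp 1 ^ 3 := pow_le_pow_left₀ (by norm_num) (by linarith) 3
  norm_num at h3 ⊢
  linarith

lemma IsRegular.exp_neg_mul_log (hR : IsRegular n q k C₁ Cfin D) (m : ℕ) :
    Real.exp (-(m * Real.log n)) = 1 / (n : ℝ) ^ m := by
  rw [Real.exp_neg, Real.exp_nat_mul, Real.exp_log (by linarith [hR.one_le_natCast]), one_div]

lemma IsRegular.sq_pow_depth_le (hR : IsRegular n q k C₁ Cfin D) :
    ((2 : ℝ) ^ D.depth) ^ 2 ≤ 4 * (n : ℝ) ^ 2 := by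
  have h1 := pow_le_pow_left₀ (by positivity) hR.pow_depth_le 2
  linarith

/-- Failure of one level: `reps` is of order √k and the squared width of order k. The constant is 48
+ 2 · 48². -/
lemma IsRegular.many_survivors_bound_le (hR : IsRegular n q k C₁ Cfin D) (hC : 27 < C₁)
    (hκ : k ≤ κ) : 48 / κ + 48 ^ 2 * (D.reps / (D.width : ℝ) ^ 2) ≤ 4656 / √k := by
  have hr := hR.one_le_sqrt
  have hrk := hR.sqrt_le_self
  have hW0 : (0 : ℝ) < D.width := by linarith [hR.sqrt_le_width hC]
  have h3 : 48 / κ ≤ 48 / √k := by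
    gcongr
    linarith
  have h4 : (D.reps : ℝ) / (D.width : ℝ) ^ 2 ≤ 2 / √k := by
    rw [div_le_div_iff₀ (by positivity) (by linarith)]
    have h6 : (C₁ * √k) ^ 2 ≤ (D.width : ℝ) ^ 2 :=
      pow_le_pow_left₀ (by positivity) hR.le_width 2
    have h7 := mul_le_mul_of_nonneg_right hR.reps_le (by positivity : 0 ≤ √k)
    linarith
  have h5 : (4656 : ℝ) / √k = 48 / √k + 48 ^ 2 * (2 / √k) := by ring
  rw [h5]
  linarith

/-- A round contributes a factor e⁻³ and there are at least log n rounds, hence at most n⁻³ per pair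
against 4n² pairs. The outcome 4/n is weakened to the common rate by √k ≤ n. -/
lemma IsRegular.final_error_bound_le (hR : IsRegular n q k C₁ Cfin D) (hC : 27 < C₁)
    (hfin : 3 < Cfin) :
    ((2 : ℝ) ^ D.depth) ^ 2 * (1 - 0.33 / (D.width : ℝ)) ^ (D.finalRounds * D.reps) ≤
      4 * (Real.log n / √k) := by
  have hr := hR.one_le_sqrt
  have hl := hR.one_le_log
  have hrn := hR.sqrt_le
  have hn1 := hR.one_le_natCast
  have hbase := hR.survival_base_nonneg hC
  have h1 : (1 - 0.33 / (D.width : ℝ)) ^ (D.finalRounds * D.reps) ≤ 1 / (n : ℝ) ^ 3 := by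
    rw [mul_comm, pow_mul, ← hR.exp_neg_mul_log]
    refine (pow_le_pow_left₀ (pow_nonneg hbase _) (hR.survival_le hC) _).trans ?_
    rw [← Real.exp_nat_mul, Real.exp_le_exp]
    have h2 := hR.le_finalRounds
    push_cast
    nlinarith
  have h2 := mul_le_mul hR.sq_pow_depth_le h1 (pow_nonneg hbase _) (by positivity)
  have h3 : 4 * (n : ℝ) ^ 2 * (1 / (n : ℝ) ^ 3) = 4 * (1 / n) := by field_simp
  have hlr : 1 / (n : ℝ) ≤ Real.log n / √k := by
    rw [div_le_div_iff₀ (by linarith) (by linarith)]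
    nlinarith
  rw [h3] at h2
  linarith

/-- The mean length is at most 4 C₁ Cfin log n. The Chernoff bound doubles it, and the extra 4 log n
in `Λ` leaves n⁻⁴ per pair, enough for 4n² pairs on each of O(log n) levels. -/
lemma IsRegular.long_list_bound_le (hR : IsRegular n q k C₁ Cfin D) (hC : 27 < C₁)
    (hfin : 3 < Cfin) {Λ : ℕ} (hΛ : (8 * C₁ * Cfin + 4) * Real.log n ≤ Λ) :
    (D.depth + 1) * (((2 : ℝ) ^ D.depth) ^ 2 *
        Real.exp (2 * (D.finalRounds * D.reps / D.width) - Λ)) ≤ 16 * (Real.log n / √k) := by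
  have hr := hR.one_le_sqrt
  have hl := hR.one_le_log
  have hrn := hR.sqrt_le
  have hn1 := hR.one_le_natCast
  have hW0 : (0 : ℝ) < D.width := by linarith [hR.sqrt_le_width hC]
  have h1 : Real.exp (2 * (D.finalRounds * D.reps / D.width) - Λ) ≤ 1 / (n : ℝ) ^ 4 := by
    rw [← hR.exp_neg_mul_log, Real.exp_le_exp]
    have h2 : (D.finalRounds : ℝ) * D.reps / D.width ≤ 4 * C₁ * Cfin * Real.log n := by
      rw [div_le_iff₀ hW0]
      have h3 := mul_le_mul hR.finalRounds_le hR.reps_le (by positivity) (by positivity)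
      have h4 : 0 ≤ 4 * C₁ * Cfin * Real.log n := by positivity
      have h5 := mul_le_mul_of_nonneg_left hR.le_width h4
      linarith
    push_cast
    linarith
  have h2 := mul_le_mul hR.sq_pow_depth_le h1 (Real.exp_pos _).le (by positivity)
  have h3 := mul_le_mul hR.depth_le h2 (by positivity) (by positivity)
  refine h3.trans ?_
  have h4 : 4 * (n : ℝ) ^ 2 * (1 / (n : ℝ) ^ 4) = 4 * (1 / (n : ℝ) ^ 2) := by field_simp
  rw [h4]
  have h5 : 1 / (n : ℝ) ^ 2 ≤ 1 / √k := by
    refine one_div_le_one_div_of_le (by linarith) ?_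
    nlinarith
  have h6 : Real.log n * (1 / (n : ℝ) ^ 2) ≤ Real.log n / √k := by
    rw [show Real.log n / √k = Real.log n * (1 / √k) by ring]
    exact mul_le_mul_of_nonneg_left h5 (by linarith)
  linarith

open Classical in
/-- For a typical graph, most placements lead to a successful run. -/
lemma IsRegular.not_isSuccessful_le [NeZero D.width] (hR : IsRegular n q k C₁ Cfin D)
    (hC : 27 < C₁) (hfin : 3 < Cfin) (hκ : k ≤ κ) {Λ : ℕ}
    (hΛ : (8 * C₁ * Cfin + 4) * Real.log n ≤ Λ) {G : SimpleGraph (Fin n)}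
    (hG : IsTypical D G k κ) :
    unifProb (fun h : Placement D => ¬ IsSuccessful κ Λ G h) ≤
      20000 * (Real.log n / √k) := by
  have hk := hR.one_le
  have hr := hR.one_le_sqrt
  have hl := hR.one_le_log
  have hκ0 : 0 < κ := by linarith
  have hW := hR.sqrt_le_width hC
  have hfin1 : 1 ≤ D.finalRounds := by
    have h1 := hR.le_finalRounds
    have h2 : (0 : ℝ) < D.finalRounds := by nlinarith
    exact_mod_cast h2
  have hlmin : ((2 : ℝ) ^ D.lmin) ^ 2 ≤ 48 * k := by
    have h1 := pow_le_pow_left₀ (by positivity) hR.pow_lmin_le 2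
    nlinarith [hR.sq_sqrt]
  have hb := unifProb_exists_le (Finset.range (D.depth - D.lmin))
    fun s (h : Placement D) => ((possiblyDefective h (outcomes G h) s).card : ℝ) ≤ 48 * κ ∧
      ((possiblyDefective h (outcomes G h) s).card : ℝ) / 12 + κ ≤
        ((possiblyDefective h (outcomes G h) s).filter fun p =>
          ¬ Defective D G (D.lmin + s) p ∧ ¬ Excluded h (outcomes G h) (D.lmin + s) p).card
  have he := (unifProb_final_error_le hG hR.lmin_le hR.le_pow_depth (by linarith) hW).trans
    (hR.final_error_bound_le hC hfin)
  have hll := (unifProb_long_list_le (D := D) hfin1 Λ).trans (hR.long_list_bound_le hC hfin hΛ)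
  have hb' := hb.trans ((Finset.sum_le_card_nsmul _ _ (4656 / √k) fun s hs =>
    (unifProb_many_survivors_le hG hR.le_pow_depth (by linarith) hW hκ0
      ((hR.survival_le hC).trans exp_neg_three_le)
      (by have := Finset.mem_range.1 hs; omega)).trans (hR.many_survivors_bound_le hC hκ)))
  rw [nsmul_eq_mul, Finset.card_range] at hb'
  have h5 : ((D.depth - D.lmin : ℕ) : ℝ) ≤ 4 * Real.log n := by
    have : ((D.depth - D.lmin : ℕ) : ℝ) ≤ D.depth := by exact_mod_cast Nat.sub_le _ _
    linarith [hR.depth_le]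
  have h6 : ((D.depth - D.lmin : ℕ) : ℝ) * (4656 / √k) ≤ 18624 * (Real.log n / √k) :=
    calc _ ≤ 4 * Real.log n * (4656 / √k) := mul_le_mul_of_nonneg_right h5 (by positivity)
      _ = _ := by ring
  have h0 : 0 ≤ Real.log n / √k := by positivity
  refine le_trans (unifProb_mono fun h hS => ?_) ((unifProb_or_le _ _).trans
    ((add_le_add ((unifProb_or_le _ _).trans (add_le_add hb' he)) hll).trans ?_))
  · by_contra hc
    simp only [not_or] at hc
    obtain ⟨⟨h1, h2⟩, h3⟩ := hc
    refine hS ⟨?_, ?_, ?_⟩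
    · exact estimate_eq_edgePairs hR.le_pow_depth hR.one_le_lmin hR.lmin_le h2
    · exact card_possiblyDefective_le hG hκ hlmin fun s hs hbad =>
        h1 ⟨s, Finset.mem_range.2 (by omega), hbad⟩
    · intro ℓ hℓ p hp hp'
      by_contra hlt
      exact h3 ⟨ℓ, hℓ, p, mem_blockPairs.2 ⟨hp, hp'⟩, not_le.1 hlt⟩
  -- 18624 + 4 + 16 ≤ 20000.
  · linarith

end FailureProbability

section Asymptotics

/-! ### Asymptotics -/

lemma expectedEdges_eq (n : ℕ) (q : unitInterval) :
    expectedEdges n q = (q : ℝ) * ((n : ℝ) * (n - 1) / 2) := by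
  rw [expectedEdges, Nat.cast_choose_two]

lemma sqrt_expectedEdges_le (n : ℕ) (q : unitInterval) : √(expectedEdges n q) ≤ n := by
  rw [Real.sqrt_le_left (Nat.cast_nonneg n), expectedEdges]
  have h1 : (n.choose 2 : ℝ) ≤ (n : ℝ) ^ 2 := by exact_mod_cast Nat.choose_le_pow n 2
  calc (q : ℝ) * n.choose 2 ≤ 1 * (n : ℝ) ^ 2 :=
        mul_le_mul q.2.2 h1 (Nat.cast_nonneg _) zero_le_one
    _ = _ := one_mul _

/-- Since q ≤ 1 gives √k ≤ n, this needs no largeness of n (for k = 0, `Real.logb` takes the value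
0), which makes the exactness of both decoders unconditional. -/
lemma lmin_le_depth (n : ℕ) (q : unitInterval) (C₁ C₂ Cfin : ℝ) :
    (design n (expectedEdges n q) C₁ C₂ Cfin).lmin ≤
      (design n (expectedEdges n q) C₁ C₂ Cfin).depth := by
  simp only [design]
  rw [Nat.ceil_le]
  rcases (Real.sqrt_nonneg (expectedEdges n q)).eq_or_lt with h | h
  · rw [← h, Real.logb_zero]
    exact Nat.cast_nonneg _
  · rw [Real.logb_le_iff_le_rpow (by norm_num) h, Real.rpow_natCast]
    refine (sqrt_expectedEdges_le n q).trans ?_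
    exact_mod_cast Nat.le_pow_clog one_lt_two n

/-- The design is regular once `n` and the expected number of edges are large. -/
lemma isRegular_design {n : ℕ} {q : unitInterval} {C₁ Cfin : ℝ} (hC : 27 < C₁) (hfin : 3 < Cfin)
    (hn : 21 ≤ n) (hk : 2 ≤ √(expectedEdges n q)) :
    IsRegular n q (expectedEdges n q) C₁ Cfin
      (design n (expectedEdges n q) C₁ (C₁ ^ 2) Cfin) := by
  have hn' : (21 : ℝ) ≤ n := by exact_mod_cast hn
  set r := √(expectedEdges n q) with hr
  have hpow : (2 : ℝ) ^ Nat.clog 2 n ≤ 2 * n := by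
    have h1 := (Nat.pow_pred_clog_lt_self one_lt_two (show 1 < n by omega)).le
    have h2 : 0 < Nat.clog 2 n := Nat.clog_pos one_lt_two (by omega)
    have h3 : 2 ^ Nat.clog 2 n = 2 * 2 ^ (Nat.clog 2 n).pred := by
      rw [← pow_succ']
      congr 1
      exact (Nat.succ_pred_eq_of_pos h2).symm
    have h4 : 2 ^ Nat.clog 2 n ≤ 2 * n := by omega
    exact_mod_cast h4
  have hlog : 1 ≤ Real.log n := by
    rw [Real.le_log_iff_exp_le (by linarith)]
    linarith [Real.exp_one_lt_d9]
  have hlogb : r = (2 : ℝ) ^ Real.logb 2 r :=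
    (Real.rpow_logb (by norm_num) (by norm_num) (by linarith)).symm
  have hlogb1 : 1 ≤ Real.logb 2 r := by
    rw [Real.le_logb_iff_rpow_le (by norm_num) (by linarith), Real.rpow_one]
    exact hk
  have hk0 : 0 ≤ expectedEdges n q := mul_nonneg q.2.1 (Nat.cast_nonneg _)
  have hCr : 1 ≤ C₁ * r := by nlinarith
  have hCr2 : 1 ≤ C₁ ^ 2 * r := by nlinarith
  have hCl : 1 ≤ Cfin * Real.log n := by nlinarith
  refine ⟨Nat.le_pow_clog one_lt_two n, hpow, ?_, ?_, lmin_le_depth n q _ _ _, ?_, ?_,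
    Nat.le_ceil _, ?_, Nat.le_ceil _, ?_, Nat.le_ceil _, ?_, hlog, by linarith,
    sqrt_expectedEdges_le n q, rfl, ?_⟩
  -- The depth is at most 1 + log n / log 2, and log n ≥ 1 absorbs the constants.
  · have h1 := Real.log_le_log (by positivity) hpow
    rw [Real.log_pow, Real.log_mul (by norm_num) (by linarith)] at h1
    have h2 := Real.log_two_gt_d9
    have h3 := Real.log_two_lt_d9
    have h4 : (0 : ℝ) ≤ Nat.clog 2 n := Nat.cast_nonneg _
    simp only [design]
    nlinarith
  · simp only [design]
    exact Nat.one_le_ceil_iff.2 (by linarith)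
  · simp only [design]
    rw [← hr, hlogb, ← Real.rpow_natCast]
    exact Real.rpow_le_rpow_of_exponent_le (by norm_num) (by rw [← hlogb]; exact Nat.le_ceil _)
  · simp only [design]
    rw [← hr, ← Real.rpow_natCast]
    have h1 : (⌈Real.logb 2 r⌉₊ : ℝ) ≤ Real.logb 2 r + 1 := (Nat.ceil_lt_add_one (by linarith)).le
    calc (2 : ℝ) ^ (⌈Real.logb 2 r⌉₊ : ℝ) ≤ 2 ^ (Real.logb 2 r + 1) :=
          Real.rpow_le_rpow_of_exponent_le (by norm_num) h1
      _ = 2 * r := by rw [Real.rpow_add (by norm_num), ← hlogb, Real.rpow_one, mul_comm]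
  · simp only [design]
    linarith [Nat.ceil_lt_add_one (show 0 ≤ C₁ * r by linarith)]
  · simp only [design]
    linarith [Nat.ceil_lt_add_one (show 0 ≤ C₁ ^ 2 * r by linarith)]
  · simp only [design]
    linarith [Nat.ceil_lt_add_one (show 0 ≤ Cfin * Real.log n by linarith)]
  · simp only [design]
    rw [expectedEdges_eq]
    have h1 : (q : ℝ) * (n * 2 ^ Nat.clog 2 n) ≤ q * (n * (2 * n)) :=
      mul_le_mul_of_nonneg_left (mul_le_mul_of_nonneg_left hpow (by linarith)) q.2.1
    -- n ≥ 21 means n ≤ 1.05 (n - 1); this is the origin of 4.2 = 2 · 2.1.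
    have h2 : (q : ℝ) * (n * (2 * n)) ≤ q * (2.1 * (n * (n - 1))) :=
      mul_le_mul_of_nonneg_left (by nlinarith) q.2.1
    linarith

variable {θ : ℝ} {q : ℕ → unitInterval}

/-- The expected number of edges is at least of the order `n ^ (2 * θ)`. -/
lemma exists_le_expectedEdges (hq : (fun n => (q n : ℝ)) =Θ[atTop]
    fun n : ℕ => (n : ℝ) ^ (-2 * (1 - θ))) :
    ∃ c > 0, ∀ᶠ n : ℕ in atTop, c * (n : ℝ) ^ (2 * θ) ≤ expectedEdges n (q n) := by
  obtain ⟨C, hC, h⟩ := hq.2.exists_pos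
  refine ⟨1 / (4 * C), by positivity, ?_⟩
  filter_upwards [h.bound, eventually_ge_atTop 2] with n hn hn2
  have hn2' : (2 : ℝ) ≤ n := by exact_mod_cast hn2
  have hn0 : (0 : ℝ) < n := by linarith
  rw [Real.norm_of_nonneg (Real.rpow_nonneg hn0.le _), Real.norm_of_nonneg (q n).2.1] at hn
  have h1 : (n : ℝ) ^ (2 * θ) = (n : ℝ) ^ (-2 * (1 - θ)) * (n : ℝ) ^ 2 := by
    rw [← Real.rpow_natCast, ← Real.rpow_add hn0]
    congr 1
    push_cast
    ring
  rw [expectedEdges_eq, h1, div_mul_eq_mul_div, one_mul, div_le_iff₀ (by positivity)]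
  have h2 : (n : ℝ) ^ (-2 * (1 - θ)) * (n : ℝ) ^ 2 ≤ C * q n * (n : ℝ) ^ 2 :=
    mul_le_mul_of_nonneg_right hn (by positivity)
  have h3 : 0 ≤ C * q n := mul_nonneg hC.le (q n).2.1
  have h4 : (n : ℝ) ^ 2 ≤ 2 * (n * (n - 1)) := by nlinarith
  have h5 := mul_le_mul_of_nonneg_left h4 h3
  linarith

lemma tendsto_sqrt_expectedEdges (hθ : 0 < θ) (hq : (fun n => (q n : ℝ)) =Θ[atTop]
    fun n : ℕ => (n : ℝ) ^ (-2 * (1 - θ))) :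
    Tendsto (fun n => √(expectedEdges n (q n))) atTop atTop := by
  obtain ⟨c, hc, h⟩ := exists_le_expectedEdges hq
  refine Real.tendsto_sqrt_atTop.comp (tendsto_atTop_mono' _ h ?_)
  exact ((tendsto_rpow_atTop (by linarith)).comp tendsto_natCast_atTop_atTop).const_mul_atTop hc

/-- The common rate of all placement failures; √k is at least of order n ^ θ. -/
lemma tendsto_log_div_sqrt (hθ : 0 < θ) (hq : (fun n => (q n : ℝ)) =Θ[atTop]
    fun n : ℕ => (n : ℝ) ^ (-2 * (1 - θ))) :
    Tendsto (fun n : ℕ => Real.log n / √(expectedEdges n (q n))) atTop (𝓝 0) := by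
  obtain ⟨c, hc, h⟩ := exists_le_expectedEdges hq
  have h1 : Tendsto (fun n : ℕ => (√c)⁻¹ * (Real.log n / (n : ℝ) ^ θ)) atTop (𝓝 0) := by
    rw [← mul_zero (√c)⁻¹]
    exact ((isLittleO_log_rpow_atTop hθ).tendsto_div_nhds_zero.comp
      tendsto_natCast_atTop_atTop).const_mul _
  refine squeeze_zero' ?_ ?_ h1
  · filter_upwards with n
    exact div_nonneg (Real.log_natCast_nonneg n) (Real.sqrt_nonneg _)
  · filter_upwards [h, eventually_ge_atTop 1] with n hn hn1
    have hn0 : (0 : ℝ) < n := by exact_mod_cast hn1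
    have h2 : √c * (n : ℝ) ^ θ ≤ √(expectedEdges n (q n)) := by
      refine Real.le_sqrt_of_sq_le ?_
      rw [mul_pow, Real.sq_sqrt hc.le, ← Real.rpow_natCast ((n : ℝ) ^ θ), ← Real.rpow_mul hn0.le,
        mul_comm θ]
      exact_mod_cast hn
    have h3 : 0 < √c * (n : ℝ) ^ θ := mul_pos (Real.sqrt_pos.2 hc) (Real.rpow_pos_of_pos hn0 _)
    calc _ ≤ Real.log n / (√c * (n : ℝ) ^ θ) :=
          div_le_div_of_nonneg_left (Real.log_natCast_nonneg n) h3 h2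
      _ = _ := by field_simp

lemma eventually_le_log_expectedEdges (hθ : 0 < θ) (hq : (fun n => (q n : ℝ)) =Θ[atTop]
    fun n : ℕ => (n : ℝ) ^ (-2 * (1 - θ))) :
    ∀ᶠ n : ℕ in atTop, θ * Real.log n ≤ Real.log (expectedEdges n (q n)) := by
  obtain ⟨c, hc, h⟩ := exists_le_expectedEdges hq
  have h1 : Tendsto (fun n : ℕ => θ * Real.log n) atTop atTop :=
    (Real.tendsto_log_atTop.comp tendsto_natCast_atTop_atTop).const_mul_atTop hθ
  -- log k is at least 2θ log n + log c; half of the main term absorbs the constant.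
  filter_upwards [h, eventually_ge_atTop 1, h1.eventually_ge_atTop (-Real.log c)] with n hn hn1 hn2
  have hn0 : (0 : ℝ) < n := by exact_mod_cast hn1
  have h2 := Real.log_le_log (mul_pos hc (Real.rpow_pos_of_pos hn0 _)) hn
  rw [Real.log_mul hc.ne' (Real.rpow_pos_of_pos hn0 _).ne', Real.log_rpow hn0] at h2
  linarith

/-- The bound for edges inside of blocks, sparse case. -/
lemma tendsto_internal_sparse (hθ : 0 < θ) (hq : (fun n => (q n : ℝ)) =Θ[atTop]
    fun n : ℕ => (n : ℝ) ^ (-2 * (1 - θ))) :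
    Tendsto (fun n : ℕ => 4 * Real.log n * (4.2 * expectedEdges n (q n) /
      (expectedEdges n (q n) * Real.log (expectedEdges n (q n)) ^ 2))) atTop (𝓝 0) := by
  have hlog : Tendsto (fun n : ℕ => Real.log n) atTop atTop :=
    Real.tendsto_log_atTop.comp tendsto_natCast_atTop_atTop
  have h1 : Tendsto (fun n : ℕ => 16.8 / θ ^ 2 * (Real.log n)⁻¹) atTop (𝓝 0) := by
    rw [← mul_zero (16.8 / θ ^ 2)]
    exact hlog.inv_tendsto_atTop.const_mul _
  refine squeeze_zero' ?_ ?_ h1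
  · filter_upwards with n
    have h2 : 0 ≤ expectedEdges n (q n) := mul_nonneg (q n).2.1 (Nat.cast_nonneg _)
    have h3 := Real.log_natCast_nonneg n
    positivity
  · filter_upwards [eventually_le_log_expectedEdges hθ hq, hlog.eventually_ge_atTop 1,
      (tendsto_sqrt_expectedEdges hθ hq).eventually_ge_atTop 1] with n hn hn1 hk
    have hk0 : 0 < expectedEdges n (q n) := Real.sqrt_pos.1 (by linarith)
    have h2 : 0 < θ * Real.log n := by positivity
    -- One factor of log² k pays for the union bound over levels, the other makes the bound vanish.
    have h3 : (θ * Real.log n) ^ 2 ≤ Real.log (expectedEdges n (q n)) ^ 2 :=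
      pow_le_pow_left₀ h2.le hn 2
    have h4 : 0 < Real.log (expectedEdges n (q n)) := by linarith
    calc _ = 16.8 * Real.log n / Real.log (expectedEdges n (q n)) ^ 2 := by
          field_simp
          norm_num
      _ ≤ 16.8 * Real.log n / (θ * Real.log n) ^ 2 := by gcongr
      _ = _ := by field_simp

/-- The bound for edges inside of blocks, dense case. -/
lemma tendsto_internal_dense (hθ : 1 / 2 < θ) (hq : (fun n => (q n : ℝ)) =Θ[atTop]
    fun n : ℕ => (n : ℝ) ^ (-2 * (1 - θ))) :
    Tendsto (fun n : ℕ => 4 * Real.log n * Real.exp (-0.15 * (expectedEdges n (q n) / n))) atTop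
      (𝓝 0) := by
  obtain ⟨c, hc, h⟩ := exists_le_expectedEdges hq
  have hδ : 0 < 2 * θ - 1 := by linarith
  have h1 : Tendsto (fun n : ℕ => 4 / (0.15 * c) * (Real.log n / (n : ℝ) ^ (2 * θ - 1))) atTop
      (𝓝 0) := by
    rw [← mul_zero (4 / (0.15 * c))]
    exact ((isLittleO_log_rpow_atTop hδ).tendsto_div_nhds_zero.comp
      tendsto_natCast_atTop_atTop).const_mul _
  refine squeeze_zero' ?_ ?_ h1
  · filter_upwards with n
    have h3 := Real.log_natCast_nonneg n
    positivity
  · filter_upwards [h, eventually_ge_atTop 1] with n hn hn1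
    have hn0 : (0 : ℝ) < n := by exact_mod_cast hn1
    have h2 : c * (n : ℝ) ^ (2 * θ - 1) ≤ expectedEdges n (q n) / n := by
      rw [le_div_iff₀ hn0, Real.rpow_sub hn0, Real.rpow_one]
      calc _ = c * (n : ℝ) ^ (2 * θ) := by field_simp
        _ ≤ _ := hn
    have h3 : 0 < c * (n : ℝ) ^ (2 * θ - 1) := mul_pos hc (Real.rpow_pos_of_pos hn0 _)
    set x := 0.15 * (expectedEdges n (q n) / n) with hx
    have h4 : 0.15 * (c * (n : ℝ) ^ (2 * θ - 1)) ≤ x := by rw [hx]; linarith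
    -- exp(-x) ≤ 1/x is enough, since a power of n beats log n.
    have h5 : Real.exp (-0.15 * (expectedEdges n (q n) / n)) ≤
        1 / (0.15 * (c * (n : ℝ) ^ (2 * θ - 1))) := by
      rw [show -0.15 * (expectedEdges n (q n) / n) = -x by rw [hx]; ring, Real.exp_neg, ← one_div]
      refine one_div_le_one_div_of_le (by positivity) ?_
      linarith [Real.add_one_le_exp x]
    have h6 := Real.log_natCast_nonneg n
    calc _ ≤ 4 * Real.log n * (1 / (0.15 * (c * (n : ℝ) ^ (2 * θ - 1)))) := by gcongr
      _ = _ := by field_simp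

lemma tendsto_mul_exp_neg {f : ℕ → ℝ} (hf : Tendsto f atTop atTop) {b : ℝ} (hb : 0 < b) :
    Tendsto (fun n => f n * Real.exp (-b * f n)) atTop (𝓝 0) := by
  have h1 : Tendsto (fun n => 1 / b * ((b * f n) ^ 1 * Real.exp (-(b * f n)))) atTop (𝓝 0) := by
    rw [← mul_zero (1 / b)]
    exact ((Real.tendsto_pow_mul_exp_neg_atTop_nhds_zero 1).comp
      (hf.const_mul_atTop hb)).const_mul _
  refine h1.congr fun n => ?_
  rw [pow_one, neg_mul]
  field_simp

lemma tendsto_exp_neg_mul {f : ℕ → ℝ} (hf : Tendsto f atTop atTop) {b : ℝ} (hb : 0 < b) :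
    Tendsto (fun n => Real.exp (-b * f n)) atTop (𝓝 0) := by
  have := Real.tendsto_exp_neg_atTop_nhds_zero.comp (hf.const_mul_atTop hb)
  refine this.congr fun n => ?_
  simp

/-- With high probability the run is successful. -/
lemma tendsto_law_not_isSuccessful (hθ : 0 < θ) (hq : (fun n => (q n : ℝ)) =Θ[atTop]
      fun n : ℕ => (n : ℝ) ^ (-2 * (1 - θ))) {C₁ Cfin : ℝ} (hC : 27 < C₁) (hfin : 3 < Cfin)
    {D : ℕ → Design}
    (hR : ∀ᶠ n in atTop, IsRegular n (q n) (expectedEdges n (q n)) C₁ Cfin (D n))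
    {κ δ : ℕ → ℝ} (hκ : ∀ᶠ n in atTop, expectedEdges n (q n) ≤ κ n)
    (hδ : Tendsto δ atTop (𝓝 0))
    (hint : ∀ᶠ n in atTop, (SimpleGraph.binomialRandom (Fin n) (q n)).real
      {G | ∃ ℓ ∈ Finset.Icc (D n).lmin (D n).depth,
        κ n < ((orderedEdges G ∩ internalPairs n (D n) ℓ).card : ℝ) * 2 ^ ℓ} ≤ δ n)
    {Λ : ℕ → ℕ} (hΛ : ∀ n : ℕ, (8 * C₁ * Cfin + 4) * Real.log n ≤ Λ n) :
    Tendsto (fun n => law n (q n) (D n) {ω | ¬ IsSuccessful (κ n) (Λ n) ω.1 ω.2}) atTop (𝓝 0) := by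
  have hr := tendsto_sqrt_expectedEdges hθ hq
  have hk : Tendsto (fun n => expectedEdges n (q n)) atTop atTop := by
    refine tendsto_atTop_mono' _ ?_ hr
    filter_upwards [hR] with n hn using hn.sqrt_le_self
  have hlim : Tendsto (fun n => (Real.exp (-0.1 * expectedEdges n (q n)) +
      2 * (√(expectedEdges n (q n)) * Real.exp (-0.3 * √(expectedEdges n (q n)))) +
      Real.exp (-0.3 * √(expectedEdges n (q n))) + δ n) +
      20000 * (Real.log n / √(expectedEdges n (q n)))) atTop (𝓝 0) := by
    have h1 := ((((tendsto_exp_neg_mul hk (by norm_num : (0 : ℝ) < 0.1)).add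
      ((tendsto_mul_exp_neg hr (by norm_num : (0 : ℝ) < 0.3)).const_mul 2)).add
      (tendsto_exp_neg_mul hr (by norm_num : (0 : ℝ) < 0.3))).add hδ).add
      ((tendsto_log_div_sqrt hθ hq).const_mul 20000)
    simpa using h1
  have hlim' := ENNReal.tendsto_ofReal hlim
  rw [ENNReal.ofReal_zero] at hlim'
  refine tendsto_of_tendsto_of_tendsto_of_le_of_le' tendsto_const_nhds hlim'
    (Eventually.of_forall fun _ => zero_le) ?_
  filter_upwards [hR, hκ, hint] with n hRn hκn hintn
  have : NeZero (D n).width := ⟨(hRn.width_pos hC).ne'⟩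
  have h1 := law_le (n := n) (q := q n) (D := D n)
    (fun G => IsTypical (D n) G (expectedEdges n (q n)) (κ n))
    (fun G h => ¬ IsSuccessful (κ n) (Λ n) G h)
    (fun G hG => hRn.not_isSuccessful_le hC hfin hκn (hΛ n) hG)
  refine h1.trans ?_
  have h2 := hRn.not_isTypical_le hintn
  have h0 : 0 ≤ 20000 * (Real.log n / √(expectedEdges n (q n))) := by
    have := hRn.one_le_log
    positivity
  have h3 : Real.exp (-0.3 * (expectedEdges n (q n) / 3)) =
      Real.exp (-0.1 * expectedEdges n (q n)) := by
    congr 1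
    ring
  rw [h3, mul_assoc 2] at h2
  rw [ENNReal.ofReal_add (measureReal_nonneg.trans h2) h0, ← ofReal_measureReal]
  exact add_le_add_left (ENNReal.ofReal_le_ofReal h2) _

/-- Events implied by a successful run have probability tending to one. -/
lemma tendsto_law_of_isSuccessful {C₁ Cfin : ℝ} (hC : 27 < C₁) {D : ℕ → Design} {k : ℕ → ℝ}
    (hR : ∀ᶠ n in atTop, IsRegular n (q n) (k n) C₁ Cfin (D n)) {κ : ℕ → ℝ} {Λ : ℕ → ℕ}
    (hlim : Tendsto (fun n => law n (q n) (D n) {ω | ¬ IsSuccessful (κ n) (Λ n) ω.1 ω.2}) atTop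
      (𝓝 0))
    {P : (n : ℕ) → SimpleGraph (Fin n) → Placement (D n) → Prop}
    (hP : ∀ᶠ n in atTop, ∀ G h, IsSuccessful (κ n) (Λ n) G h → P n G h) :
    Tendsto (fun n => law n (q n) (D n) {ω | P n ω.1 ω.2}) atTop (𝓝 1) := by
  have h1 : Tendsto (fun n => 1 - law n (q n) (D n) {ω | ¬ IsSuccessful (κ n) (Λ n) ω.1 ω.2}) atTop
      (𝓝 1) := by
    have := ENNReal.Tendsto.sub (tendsto_const_nhds (x := (1 : ENNReal))) hlim
      (Or.inl ENNReal.one_ne_top)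
    simpa using this
  refine tendsto_of_tendsto_of_tendsto_of_le_of_le' h1 tendsto_const_nhds ?_ ?_
  · filter_upwards [hR, hP] with n hRn hPn
    have : NeZero (D n).width := ⟨(hRn.width_pos hC).ne'⟩
    rw [tsub_le_iff_right, ← measure_univ (μ := law n (q n) (D n))]
    refine (measure_mono fun ω _ => ?_).trans (measure_union_le _ _)
    by_cases hS : IsSuccessful (κ n) (Λ n) ω.1 ω.2
    · exact Or.inl (hPn _ _ hS)
    · exact Or.inr hS
  · filter_upwards [hR] with n hRn
    have : NeZero (D n).width := ⟨(hRn.width_pos hC).ne'⟩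
    exact prob_le_one

end Asymptotics

end GraphSplitting

/-! ### Assembly: the list bound and the budget for edges inside blocks -/

open GraphSplitting

theorem theorem1 (θ : ℝ) (hθ : θ ∈ Set.Ioo (0 : ℝ) 1) (q : ℕ → unitInterval)
    (hq : (fun n => (q n : ℝ)) =Θ[atTop] fun n : ℕ => (n : ℝ) ^ (-2 * (1 - θ)))
    (C₁ C₂ Cfin : ℝ) (hC₁ : 27 < C₁) (hC₂ : C₂ = C₁ ^ 2) (hCfin : 3 < Cfin)
    (k : ℕ → ℝ) (hk : k = fun n => GraphSplitting.expectedEdges n (q n))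
    (D : ℕ → GraphSplitting.Design)
    (hD : D = fun n => GraphSplitting.design n (k n) C₁ C₂ Cfin) :
    -- number of tests
    (fun n => ((D n).numTests : ℝ)) =O[atTop] (fun n => k n * Real.log n) ∧
    -- error probability
    Tendsto (fun n => GraphSplitting.law n (q n) (D n)
      {ω | GraphSplitting.estimate ω.2 (GraphSplitting.outcomes ω.1 ω.2) ≠
        GraphSplitting.edgePairs ω.1}) atTop (𝓝 0) ∧
    -- both decoding programs compute the estimate
    (∀ (n : ℕ) (G : SimpleGraph (Fin n)) (h : GraphSplitting.Placement (D n)),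
      (GraphSplitting.decoderOutput h (GraphSplitting.outcomes G h)).toFinset =
        GraphSplitting.estimate h (GraphSplitting.outcomes G h) ∧
      (GraphSplitting.fastDecoderOutput h (GraphSplitting.outcomes G h)).toFinset =
        GraphSplitting.estimate h (GraphSplitting.outcomes G h)) ∧
    -- pre-processing time
    (∃ K : ℝ, ∀ᶠ n : ℕ in atTop, ∀ h : GraphSplitting.Placement (D n),
      (GraphSplitting.preprocessTime h : ℝ) ≤ K * ((n : ℝ) ^ 2 * √(k n) * Real.log n)) ∧
    -- decoding time, dense case
    (1 / 2 < θ →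
      (∃ K : ℝ, Tendsto (fun n : ℕ => GraphSplitting.law n (q n) (D n)
        {ω | (GraphSplitting.decoderTime ω.2 (GraphSplitting.outcomes ω.1 ω.2) : ℝ) ≤
          K * ((k n) ^ (3 / 2 : ℝ) * Real.log n)}) atTop (𝓝 1)) ∧
      (∃ K : ℝ, Tendsto (fun n : ℕ => GraphSplitting.law n (q n) (D n)
        {ω | (GraphSplitting.fastDecoderTime ω.2 (GraphSplitting.outcomes ω.1 ω.2) : ℝ) ≤
          K * (k n * Real.log n ^ 2)}) atTop (𝓝 1))) ∧
    -- decoding time, sparse case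
    (θ ≤ 1 / 2 →
      (∃ K : ℝ, Tendsto (fun n : ℕ => GraphSplitting.law n (q n) (D n)
        {ω | (GraphSplitting.decoderTime ω.2 (GraphSplitting.outcomes ω.1 ω.2) : ℝ) ≤
          K * ((k n) ^ (3 / 2 : ℝ) * Real.log (k n) ^ 2 * Real.log n)}) atTop (𝓝 1)) ∧
      (∃ K : ℝ, Tendsto (fun n : ℕ => GraphSplitting.law n (q n) (D n)
        {ω | (GraphSplitting.fastDecoderTime ω.2 (GraphSplitting.outcomes ω.1 ω.2) : ℝ) ≤
          K * (k n * Real.log (k n) ^ 2 * Real.log n ^ 2)}) atTop (𝓝 1))) := by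
  obtain ⟨hθ0, -⟩ := hθ
  subst hk hD hC₂
  have hsqrt := tendsto_sqrt_expectedEdges hθ0 hq
  have hR : ∀ᶠ n in atTop, IsRegular n (q n) (expectedEdges n (q n)) C₁ Cfin
      (design n (expectedEdges n (q n)) C₁ (C₁ ^ 2) Cfin) := by
    filter_upwards [eventually_ge_atTop 21, hsqrt.eventually_ge_atTop 2] with n hn hk
    exact isRegular_design hC₁ hCfin hn hk
  have hc0 : 0 < 8 * C₁ * Cfin + 4 := by positivity
  set Λ : ℕ → ℕ := fun n => ⌈(8 * C₁ * Cfin + 4) * Real.log n⌉₊ with hΛdef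
  have hΛ : ∀ n : ℕ, (8 * C₁ * Cfin + 4) * Real.log n ≤ Λ n := fun n => Nat.le_ceil _
  have hΛ' : ∀ n : ℕ, 1 ≤ Real.log n → (Λ n : ℝ) ≤ (8 * C₁ * Cfin + 5) * Real.log n := by
    intro n hn
    have := Nat.ceil_lt_add_one (show 0 ≤ (8 * C₁ * Cfin + 4) * Real.log n by positivity)
    linarith
  -- The Markov budget works for every θ, so it also serves for the error probability.
  set κ : ℕ → ℝ := fun n => expectedEdges n (q n) * Real.log (expectedEdges n (q n)) ^ 2 with hκdef
  have hκ : ∀ᶠ n in atTop, expectedEdges n (q n) ≤ κ n := by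
    have hlog : Tendsto (fun n : ℕ => θ * Real.log n) atTop atTop :=
      (Real.tendsto_log_atTop.comp tendsto_natCast_atTop_atTop).const_mul_atTop hθ0
    filter_upwards [hR, eventually_le_log_expectedEdges hθ0 hq, hlog.eventually_ge_atTop 1]
      with n hn h1 h2
    refine le_mul_of_one_le_right (by linarith [hn.one_le]) (one_le_pow₀ ?_)
    linarith
  have hsparse := tendsto_law_not_isSuccessful hθ0 hq hC₁ hCfin hR hκ
    (tendsto_internal_sparse hθ0 hq)
    (by filter_upwards [hR, hκ] with n hn h1
        exact hn.internal_sparse (by linarith [hn.one_le])) hΛ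
  have hpow : ∀ n, √(expectedEdges n (q n)) * √(expectedEdges n (q n)) = expectedEdges n (q n) →
      expectedEdges n (q n) ^ (3 / 2 : ℝ) =
        expectedEdges n (q n) * √(expectedEdges n (q n)) := by
    intro n hn
    have h0 : 0 ≤ expectedEdges n (q n) := mul_nonneg (q n).2.1 (Nat.cast_nonneg _)
    rw [Real.sqrt_eq_rpow, ← Real.rpow_one_add' h0 (by norm_num)]
    norm_num
  refine ⟨?_, ?_, ?_, ?_, fun hθ' => ⟨?_, ?_⟩, fun _ => ⟨?_, ?_⟩⟩
  · refine Asymptotics.IsBigO.of_bound (4 * C₁ ^ 3 * (4 + 2 * Cfin)) ?_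
    filter_upwards [hR] with n hn
    rw [Real.norm_of_nonneg (Nat.cast_nonneg _), Real.norm_of_nonneg]
    · exact hn.numTests_le hC₁ hCfin
    · have := hn.one_le
      have := hn.one_le_log
      positivity
  · refine tendsto_of_tendsto_of_tendsto_of_le_of_le tendsto_const_nhds hsparse
      (fun _ => zero_le) fun n => measure_mono fun ω hω hS => hω hS.estimate_eq
  · intro n G h
    have hle := lmin_le_depth n (q n) C₁ (C₁ ^ 2) Cfin
    refine ⟨(decoder_spec h _ hle).1, ?_⟩
    -- Exactness needs no probability: no list is longer than the number of iterations.
    refine (fastDecoder_spec h _ hle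
      ((Finset.Icc (design n (expectedEdges n (q n)) C₁ (C₁ ^ 2) Cfin).lmin
        (design n (expectedEdges n (q n)) C₁ (C₁ ^ 2) Cfin).depth).sup
        (design n (expectedEdges n (q n)) C₁ (C₁ ^ 2) Cfin).iters) ?_).1
    intro ℓ hℓ p _ _
    exact (Finset.card_filter_le _ _).trans ((Finset.card_range _).le.trans (Finset.le_sup hℓ))
  · refine ⟨4 * (29 + 16 * C₁ ^ 2 + 32 * C₁ ^ 2 * Cfin), ?_⟩
    filter_upwards [hR] with n hn h using hn.preprocessTime_le hC₁ hCfin h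
  -- For θ > 1/2 the Chernoff budget 6k costs only a constant factor.
  · have hdense := tendsto_law_not_isSuccessful (κ := fun n => 6 * expectedEdges n (q n)) hθ0 hq
      hC₁ hCfin hR (by filter_upwards [hR] with n hn; linarith [hn.one_le])
      (tendsto_internal_dense hθ' hq) (by filter_upwards [hR] with n hn using hn.internal_dense) hΛ
    refine ⟨48 * (5 + 4 * (26 + 12 * C₁ ^ 2) + 24 * C₁ ^ 2 * Cfin) * 6, ?_⟩
    refine tendsto_law_of_isSuccessful (P := fun n G h =>
      (decoderTime h (outcomes G h) : ℝ) ≤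
        (48 * (5 + 4 * (26 + 12 * C₁ ^ 2) + 24 * C₁ ^ 2 * Cfin) * 6) *
        (expectedEdges n (q n) ^ (3 / 2 : ℝ) * Real.log n)) hC₁ hR hdense ?_
    filter_upwards [hR] with n hn G h hS
    refine (hn.decoderTime_le hC₁ hCfin (by linarith [hn.one_le]) hS).trans (le_of_eq ?_)
    rw [hpow n hn.sq_sqrt]
    ring
  · have hdense := tendsto_law_not_isSuccessful (κ := fun n => 6 * expectedEdges n (q n)) hθ0 hq
      hC₁ hCfin hR (by filter_upwards [hR] with n hn; linarith [hn.one_le])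
      (tendsto_internal_dense hθ' hq) (by filter_upwards [hR] with n hn using hn.internal_dense) hΛ
    refine ⟨48 * (6 + 4 * (27 + 3 * (8 * C₁ * Cfin + 5)) + 3 * (8 * C₁ * Cfin + 5)) * 6, ?_⟩
    refine tendsto_law_of_isSuccessful (P := fun n G h =>
      (fastDecoderTime h (outcomes G h) : ℝ) ≤
        (48 * (6 + 4 * (27 + 3 * (8 * C₁ * Cfin + 5)) + 3 * (8 * C₁ * Cfin + 5)) * 6) *
        (expectedEdges n (q n) * Real.log n ^ 2)) hC₁ hR hdense ?_
    filter_upwards [hR] with n hn G h hS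
    refine (hn.fastDecoderTime_le (by linarith [hn.one_le]) (by positivity)
      (hΛ' n hn.one_le_log) hS).trans (le_of_eq ?_)
    ring
  · refine ⟨48 * (5 + 4 * (26 + 12 * C₁ ^ 2) + 24 * C₁ ^ 2 * Cfin), ?_⟩
    refine tendsto_law_of_isSuccessful (P := fun n G h =>
      (decoderTime h (outcomes G h) : ℝ) ≤
        (48 * (5 + 4 * (26 + 12 * C₁ ^ 2) + 24 * C₁ ^ 2 * Cfin)) *
        (expectedEdges n (q n) ^ (3 / 2 : ℝ) * Real.log (expectedEdges n (q n)) ^ 2 * Real.log n)) hC₁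
      hR hsparse ?_
    filter_upwards [hR, hκ] with n hn h1 G h hS
    refine (hn.decoderTime_le hC₁ hCfin h1 hS).trans (le_of_eq ?_)
    rw [hpow n hn.sq_sqrt]
    ring
  · refine ⟨48 * (6 + 4 * (27 + 3 * (8 * C₁ * Cfin + 5)) + 3 * (8 * C₁ * Cfin + 5)), ?_⟩
    refine tendsto_law_of_isSuccessful (P := fun n G h =>
      (fastDecoderTime h (outcomes G h) : ℝ) ≤
        (48 * (6 + 4 * (27 + 3 * (8 * C₁ * Cfin + 5)) + 3 * (8 * C₁ * Cfin + 5))) *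
        (expectedEdges n (q n) * Real.log (expectedEdges n (q n)) ^ 2 * Real.log n ^ 2)) hC₁ hR hsparse ?_
    filter_upwards [hR, hκ] with n hn h1 G h hS
    exact hn.fastDecoderTime_le h1 (by positivity) (hΛ' n hn.one_le_log) hS
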